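/- A graph on a finite vertex set $V$ is a set $E \subseteq V\times V$; the edge $u-v$ is undirected if $(u,v),(v,u)\in E$ and directed, $u\to v$, if only $(u,v)\in E$. Two DAGs on $V$ are Markov equivalent if they encode the same conditional independence relations, i.e. if for all pairwise disjoint $X,Y,Z\subseteq V$ the set $Z$ d-separates $X$ and $Y$ in one iff it does so in the other. The CPDAG of a Markov equivalence class is the union graph of all DAGs in the class, and for a CPDAG $G$ the set $[G]$ consists of all DAGs of the class represented by $G$. Theorem. The Markov equivalence class $[G]$ of a CPDAG $G$ with $n$ vertices and $m$ edges can be enumerated with worst-case delay $O(n+m)$. That is, there is one algorithm (a program for a word RAM with words of $O(\log(n+m+2))$ bits and unit-cost operations) and a constant $C$ such that, for every CPDAG $G$ with $n$ vertices and $m$ edges (an undirected edge being counted once), given as $n$ and a list of the pairs in its edge set $E$ in any order, the algorithm writes out every DAG in $[G]$ exactly once (as a list of its edges) and nothing else, and halts; the time until the first output is completed, the time between the completion of any two consecutive outputs, and the time from the last output to the halt are each at most $C\,(n+m+1)$. (The summand $1$ matters only for $n=0$.) -/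

import Mathlib

/-! ## Directed acyclic graphs, Markov equivalence and CPDAGs

A graph is a set of ordered pairs `E ⊆ V × V`, that is, a `Digraph V`. An edge between `u` and `v`
is undirected if both `(u, v)` and `(v, u)` belong to `E`, and directed from `u` to `v` if only
`(u, v)` does. -/

namespace MarkovEnum

variable {V : Type*}

/-- A DAG: there is no closed directed walk `v → ⋯ → v` of positive length. In particular there
are no loops and no undirected edges (closed walks of length one and two). -/
def IsDAG (D : Digraph V) : Prop :=
  ∀ v, ¬ Relation.TransGen D.Adj v v

/-- `l` is a path of `D` (distinct vertices, consecutive ones linked by an edge in either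
direction) that is active (not blocked) given `Z`: every collider `a → b ← c` on it has `b` or a
descendant of `b` in `Z`, and every other inner vertex of it lies outside `Z`. -/
def IsActivePath (D : Digraph V) (Z : Set V) (l : List V) : Prop :=
  l.Nodup ∧ l.IsChain (fun a b => D.Adj a b ∨ D.Adj b a) ∧
    ∀ a b c, [a, b, c] <:+: l →
      ((D.Adj a b ∧ D.Adj c b) → ∃ z ∈ Z, Relation.ReflTransGen D.Adj b z) ∧
      (¬ (D.Adj a b ∧ D.Adj c b) → b ∉ Z)

/-- `Z` d-separates `X` and `Y` in `D`: no path between a vertex of `X` and a vertex of `Y` is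
active given `Z`. These are the conditional independence relations `X ⊥ Y | Z` encoded by `D`. -/
def DSep (D : Digraph V) (X Y Z : Set V) : Prop :=
  ∀ x ∈ X, ∀ y ∈ Y, ∀ l : List V,
    l.head? = some x → l.getLast? = some y → ¬ IsActivePath D Z l

/-- Markov equivalence: `D` and `D'` encode the same conditional independence relations. -/
def MarkovEquiv (D D' : Digraph V) : Prop :=
  ∀ X Y Z : Set V, Disjoint X Y → Disjoint X Z → Disjoint Y Z → (DSep D X Y Z ↔ DSep D' X Y Z)

/-- The Markov equivalence class of the DAG `D`. -/
def markovClass (D : Digraph V) : Set (Digraph V) :=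
  {D' | IsDAG D' ∧ MarkovEquiv D D'}

/-- The CPDAG that represents the Markov equivalence class of the DAG `D`: the union graph of the
DAGs in the class. -/
def cpdag (D : Digraph V) : Digraph V :=
  sSup (markovClass D)

/-- `G` is a CPDAG: it represents the Markov equivalence class of some DAG. -/
def IsCPDAG (G : Digraph V) : Prop :=
  ∃ D, IsDAG D ∧ cpdag D = G

/-- The set `[G]` of all DAGs in the Markov equivalence class represented by the CPDAG `G`. -/
def representedDAGs (G : Digraph V) : Set (Digraph V) :=
  {D | IsDAG D ∧ cpdag D = G}

/-- The number of edges of `G`, an undirected edge being one edge. -/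
noncomputable def numEdges (G : Digraph V) : ℕ :=
  G.toSimpleGraphInclusive.edgeSet.ncard

/-! ## The machine model

A word RAM with finitely many registers and arrays in any given program. It is programmed in a
structured language, its words are the natural numbers below `W`, and its arithmetic is modulo
`W`. -/

/-- The contents of the registers and of the arrays. -/
structure Store where
  reg : ℕ → ℕ
  arr : ℕ → ℕ → ℕ

/-- Arithmetic expressions; `read a e` is the entry of array `a` at the position that is the value
of `e`. -/
inductive Expr where
  | const (c : ℕ)
  | reg (x : ℕ)
  | read (a : ℕ) (e : Expr)
  | add (e f : Expr)
  | sub (e f : Expr)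
  | mul (e f : Expr)

/-- The value of an expression (`sub` is truncated at zero). -/
def Expr.eval (W : ℕ) (s : Store) : Expr → ℕ
  | .const c => c % W
  | .reg x => s.reg x
  | .read a e => s.arr a (e.eval W s)
  | .add e f => (e.eval W s + f.eval W s) % W
  | .sub e f => e.eval W s - f.eval W s
  | .mul e f => (e.eval W s * f.eval W s) % W

/-- The time for evaluating an expression: one unit for every symbol in it. -/
def Expr.cost : Expr → ℕ
  | .const _ => 1
  | .reg _ => 1
  | .read _ e => e.cost + 1
  | .add e f => e.cost + f.cost + 1
  | .sub e f => e.cost + f.cost + 1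
  | .mul e f => e.cost + f.cost + 1

/-- Conditions for branches and loops. -/
inductive Test where
  | lt (e f : Expr)
  | eq (e f : Expr)
  | not (b : Test)

/-- The truth of a condition. -/
def Test.Holds (W : ℕ) (s : Store) : Test → Prop
  | .lt e f => e.eval W s < f.eval W s
  | .eq e f => e.eval W s = f.eval W s
  | .not b => ¬ b.Holds W s

/-- The time for evaluating a condition. -/
def Test.cost : Test → ℕ
  | .lt e f => e.cost + f.cost + 1
  | .eq e f => e.cost + f.cost + 1
  | .not b => b.cost + 1

/-- Programs. `assign x e` writes a register, `write a i e` writes position `i` of array `a`,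
`emit e` outputs one word, and `mark` announces that the current output object is complete. -/
inductive Prog where
  | skip
  | assign (x : ℕ) (e : Expr)
  | write (a : ℕ) (i e : Expr)
  | seq (p q : Prog)
  | ite (b : Test) (p q : Prog)
  | loop (b : Test) (p : Prog)
  | emit (e : Expr)
  | mark

/-- What can happen in one unit of time: an internal step, the output of one word, or the
announcement that the current output object is complete. -/
inductive Event where
  | tick
  | word (v : ℕ)
  | mark

/-- `t` internal steps. -/
def ticks (t : ℕ) : List Event :=
  List.replicate t Event.tick

/-- The store after writing `v` to register `x`. -/
def Store.setReg (s : Store) (x v : ℕ) : Store :=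
  { s with reg := Function.update s.reg x v }

/-- The store after writing `v` to position `i` of array `a`. -/
def Store.setArr (s : Store) (a i v : ℕ) : Store :=
  { s with arr := Function.update s.arr a (Function.update (s.arr a) i v) }

/-- `Exec W p s s' tr`: the (deterministic) run of `p` from the store `s` with words below `W`
halts in the store `s'`, and `tr` lists, in order, what happens in each unit of time of the run.
So the length of `tr`, or of a segment of it, is the running time spent there. -/
inductive Exec (W : ℕ) : Prog → Store → Store → List Event → Prop where
  | skip (s : Store) : Exec W .skip s s (ticks 1)
  | assign (x : ℕ) (e : Expr) (s : Store) :
      Exec W (.assign x e) s (s.setReg x (e.eval W s)) (ticks (e.cost + 1))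
  | write (a : ℕ) (i e : Expr) (s : Store) :
      Exec W (.write a i e) s (s.setArr a (i.eval W s) (e.eval W s)) (ticks (i.cost + e.cost + 1))
  | seq {p q : Prog} {s s' s'' : Store} {t t' : List Event} :
      Exec W p s s' t → Exec W q s' s'' t' → Exec W (.seq p q) s s'' (t ++ t')
  | ite_true {b : Test} {p : Prog} (q : Prog) {s s' : Store} {t : List Event} :
      b.Holds W s → Exec W p s s' t → Exec W (.ite b p q) s s' (ticks b.cost ++ t)
  | ite_false {b : Test} (p : Prog) {q : Prog} {s s' : Store} {t : List Event} :
      ¬ b.Holds W s → Exec W q s s' t → Exec W (.ite b p q) s s' (ticks b.cost ++ t)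
  | loop_false {b : Test} (p : Prog) {s : Store} :
      ¬ b.Holds W s → Exec W (.loop b p) s s (ticks b.cost)
  | loop_true {b : Test} {p : Prog} {s s' s'' : Store} {t t' : List Event} :
      b.Holds W s → Exec W p s s' t → Exec W (.loop b p) s' s'' t' →
      Exec W (.loop b p) s s'' (ticks b.cost ++ t ++ t')
  | emit (e : Expr) (s : Store) :
      Exec W (.emit e) s s (ticks e.cost ++ [Event.word (e.eval W s)])
  | mark (s : Store) : Exec W .mark s s [Event.mark]

/-! ## Input, output and delay -/

/-- `L` lists the elements of the edge set `E ⊆ V × V` of `G`, each exactly once (an undirected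
edge is listed in both directions, a directed one in its own). -/
def IsArcList (L : List (V × V)) (G : Digraph V) : Prop :=
  L.Nodup ∧ ∀ u v, (u, v) ∈ L ↔ G.Adj u v

/-- The initial store: register `0` holds the number `n` of vertices, register `1` the length of
the list `L`, position `i` of array `0` and of array `1` the first and the second component of the
`i`-th pair of `L`. Everything else is zero. -/
def inputStore {n : ℕ} (L : List (Fin n × Fin n)) : Store where
  reg x := if x = 0 then n else if x = 1 then L.length else 0
  arr a i :=
    if a = 0 then ((L.map fun e => (e.1 : ℕ))[i]?).getD 0
    else if a = 1 then ((L.map fun e => (e.2 : ℕ))[i]?).getD 0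
    else 0

/-- The words that are output during the segment `t` of a run. -/
def outputWords (t : List Event) : List ℕ :=
  t.filterMap fun e => match e with
    | .word v => some v
    | _ => none

/-- The words `ws` describe the graph `D`: they are `u₁, v₁, u₂, v₂, …` for a list
`(u₁, v₁), (u₂, v₂), …` of its edges, each edge being listed exactly once. -/
def Describes {n : ℕ} (ws : List ℕ) (D : Digraph (Fin n)) : Prop :=
  ∃ L : List (Fin n × Fin n), IsArcList L D ∧ ws = L.flatMap fun e => [(e.1 : ℕ), (e.2 : ℕ)]

/-- The run `tr` enumerates the set `S` of graphs with worst-case delay at most `B`. The run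
consists of one block for each output graph, ended by the event `mark`, and of a rest in which
nothing is output. The blocks describe all elements of `S`, each exactly once; and the time until
the first output, between any two consecutive outputs, and from the last output to the halt is at
most `B`. -/
def EnumeratesWithDelay {n : ℕ} (tr : List Event) (S : Set (Digraph (Fin n))) (B : ℕ) : Prop :=
  ∃ (blocks : List (List Event)) (rest : List Event) (Ds : List (Digraph (Fin n))),
    tr = (blocks.flatMap fun t => t ++ [Event.mark]) ++ rest ∧
    (∀ t ∈ blocks, Event.mark ∉ t) ∧ Event.mark ∉ rest ∧
    List.Forall₂ (fun t D => Describes (outputWords t) D) blocks Ds ∧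
    outputWords rest = [] ∧
    Ds.Nodup ∧ (∀ D, D ∈ Ds ↔ D ∈ S) ∧
    (∀ t ∈ blocks, t.length + 1 ≤ B) ∧ rest.length ≤ B

end MarkovEnum

/-!
The algorithm runs a backtracking maximum cardinality search on the undirected edges of the CPDAG,
and outputs one orientation for each complete visiting order that it finds.

*The class in terms of the CPDAG.* By the criterion of Verma and Pearl
(`markovEquiv_iff_samePattern`), Markov equivalent DAGs are those with the same skeleton and the
same v-structures. The edges whose direction this forces by Meek's rules are `Compelled`. A
compelled edge followed by a non-compelled one is shielded by a compelled edge
(`Compelled.trans_reversible`); so every orientation of the other edges along a perfect order of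
the chordal graph they form gives a member of the class (`reorient_isDAG`,
`reorient_samePattern`). Every maximum cardinality search order of a chordal graph is perfect
(`IsSearch.isPerfectOrder`), and it can start at any vertex. Hence the CPDAG has exactly the
compelled edges as directed edges (`cpdag_adj_iff`), and every complete search order on its
undirected edges yields a member of the class (`IsCPDAG.orient_mem`).

*No repetitions, no dead ends.* Suppose that the search has visited `τ` and may visit `v` next. The
`Alternative`s to `v` are the vertices linked to `v` through unvisited vertices with the same label
as `v`. A member of the class for which `τ` is the beginning of a topological order is consistent
with exactly one alternative as the next vertex: with at least one, as a source among the
alternatives has no further parent (`Consistent.exists_alternative`), and with at most one, as a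
connected set has only one source when there are no unshielded colliders
(`Consistent.alternative_unique`). So the search branches over the alternatives. Every inner node
has a child, every leaf is a member of the class, and every member occurs at one leaf only
(`TreeInv`).

*Delay.* From a leaf the program goes up, undoing the visits, until it finds a level with an
alternative left, and then it searches down to the next leaf again (`runs_search`). The
alternatives at a level are listed only when the program first returns to the level, by a breadth
first search. If it finds none besides the vertex `v` visited there, then the costs are
proportional to the degree of `v`, and these degrees sum up to at most the length of the input
list; otherwise the search goes down, so a costlier list is made at most once between two outputs
(`runs_backtrack`). Maximum cardinality search itself runs in linear time with buckets from which
outdated entries are removed only when they are encountered. Running times are bounded in a small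
program logic (`Runs`), with potential functions for the loops.
-/

namespace MarkovEnum

variable {V : Type*}

/-! ### d-separation, skeletons and v-structures -/

/-- Adjacency in the skeleton of `D`. -/
def Skel (D : Digraph V) (a b : V) : Prop := D.Adj a b ∨ D.Adj b a

/-- `a → b ← c` is a v-structure (an unshielded collider) of `D`. -/
def VStruct (D : Digraph V) (a b c : V) : Prop :=
  a ≠ c ∧ D.Adj a b ∧ D.Adj c b ∧ ¬ Skel D a c

/-- `D` and `D'` have the same skeleton and the same v-structures. -/
def SamePattern (D D' : Digraph V) : Prop :=
  (∀ a b, Skel D a b ↔ Skel D' a b) ∧ ∀ a b c, VStruct D a b c ↔ VStruct D' a b c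

/-- The inner vertex `b` of the stretch `a, b, c` of a path does not block it given `Z`. -/
def OpenAt (D : Digraph V) (Z : Set V) (a b c : V) : Prop :=
  ((D.Adj a b ∧ D.Adj c b) → ∃ z ∈ Z, Relation.ReflTransGen D.Adj b z) ∧
    (¬ (D.Adj a b ∧ D.Adj c b) → b ∉ Z)

/-- `f 0, …, f k` is an active path given `Z`. -/
structure ActiveSeq (D : Digraph V) (Z : Set V) (k : ℕ) (f : ℕ → V) : Prop where
  inj : ∀ i j, i ≤ k → j ≤ k → f i = f j → i = j
  skel : ∀ i, i < k → Skel D (f i) (f (i + 1))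
  openAt : ∀ i, i + 2 ≤ k → OpenAt D Z (f i) (f (i + 1)) (f (i + 2))

theorem Skel.symm {D : Digraph V} {a b : V} (h : Skel D a b) : Skel D b a := Or.symm h

theorem OpenAt.symm {D : Digraph V} {Z : Set V} {a b c : V} (h : OpenAt D Z a b c) :
    OpenAt D Z c b a :=
  ⟨fun h' => h.1 h'.symm, fun h' => h.2 fun h'' => h' h''.symm⟩

theorem SamePattern.symm {D D' : Digraph V} (h : SamePattern D D') : SamePattern D' D :=
  ⟨fun a b => (h.1 a b).symm, fun a b c => (h.2 a b c).symm⟩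

theorem IsDAG.irrefl {D : Digraph V} (hD : IsDAG D) (a : V) : ¬ D.Adj a a :=
  fun h => hD a (.single h)

theorem IsDAG.asymm {D : Digraph V} (hD : IsDAG D) {a b : V} (h : D.Adj a b) : ¬ D.Adj b a :=
  fun h' => hD a (.tail (.single h) h')

theorem IsDAG.no_triangle {D : Digraph V} (hD : IsDAG D) {a b c : V} (h : D.Adj a b)
    (h' : D.Adj b c) : ¬ D.Adj c a :=
  fun h'' => hD a (.tail (.tail (.single h) h') h'')

theorem Skel.ne {D : Digraph V} (hD : IsDAG D) {a b : V} (h : Skel D a b) : a ≠ b := by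
  rintro rfl
  exact h.elim (hD.irrefl a) (hD.irrefl a)

theorem ActiveSeq.reverse {D : Digraph V} {Z : Set V} {k : ℕ} {f : ℕ → V}
    (h : ActiveSeq D Z k f) : ActiveSeq D Z k fun i => f (k - i) where
  inj i j hi hj hij := by
    have := h.inj _ _ (by omega) (by omega) hij
    omega
  skel i hi := by
    have := (h.skel (k - (i + 1)) (by omega)).symm
    rwa [show k - (i + 1) + 1 = k - i by omega] at this
  openAt i hi := by
    have := (h.openAt (k - (i + 2)) (by omega)).symm
    rwa [show k - (i + 2) + 2 = k - i by omega, show k - (i + 2) + 1 = k - (i + 1) by omega] at this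

theorem exists_activePath_iff {D : Digraph V} {Z : Set V} {x y : V} :
    (∃ l : List V, l.head? = some x ∧ l.getLast? = some y ∧ IsActivePath D Z l) ↔
      ∃ k f, f 0 = x ∧ f k = y ∧ ActiveSeq D Z k f := by
  constructor
  · rintro ⟨l, hx, hy, hnd, hch, hop⟩
    have hl : l ≠ [] := by rintro rfl; simp at hx
    have hpos : 0 < l.length := List.length_pos_iff.2 hl
    have hget : ∀ i, (h : i < l.length) → l.getD i x = l[i] := fun i h => by simp [h]
    refine ⟨l.length - 1, fun i => l.getD i x, ?_, ?_, ?_, ?_, ?_⟩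
    · change l.getD 0 x = x
      rw [hget 0 hpos]
      rw [List.head?_eq_getElem?, List.getElem?_eq_getElem hpos] at hx
      exact Option.some.inj hx
    · simp only
      rw [hget _ (by omega)]
      rw [List.getLast?_eq_getElem?, List.getElem?_eq_getElem (by omega)] at hy
      exact Option.some.inj hy
    · intro i j hi hj hij
      rw [hget i (by omega), hget j (by omega)] at hij
      exact (List.Nodup.getElem_inj_iff hnd).1 hij
    · intro i hi
      rw [hget i (by omega), hget (i + 1) (by omega)]
      exact List.isChain_iff_getElem.1 hch i (by omega)
    · intro i hi
      rw [hget i (by omega), hget (i + 1) (by omega), hget (i + 2) (by omega)]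
      refine hop _ _ _ ⟨l.take i, l.drop (i + 3), ?_⟩
      conv_rhs => rw [← List.take_append_drop i l]
      rw [List.append_assoc]
      congr 1
      rw [List.drop_eq_getElem_cons (by omega : i < l.length),
        List.drop_eq_getElem_cons (by omega : i + 1 < l.length),
        List.drop_eq_getElem_cons (by omega : i + 1 + 1 < l.length)]
      rfl
  · rintro ⟨k, f, rfl, rfl, h⟩
    refine ⟨(List.range (k + 1)).map f, ?_, ?_, ?_, ?_, ?_⟩
    · simp [List.head?_eq_getElem?]
    · simp [List.getLast?_eq_getElem?]
    · refine List.Nodup.map_on ?_ List.nodup_range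
      intro i hi j hj
      simp only [List.mem_range] at hi hj
      exact h.inj i j (by omega) (by omega)
    · rw [List.isChain_iff_getElem]
      intro i hi
      simp only [List.length_map, List.length_range] at hi
      simpa [Skel] using h.skel i (by omega)
    · rintro a b c ⟨l₁, l₂, hl⟩
      have hlen := congrArg List.length hl
      simp at hlen
      have key : ∀ t, (ht : t < 3) → f (l₁.length + t) = [a, b, c][t] := by
        intro t ht
        have h1 : (l₁ ++ [a, b, c] ++ l₂)[l₁.length + t]? =
            ((List.range (k + 1)).map f)[l₁.length + t]? := by rw [hl]
        rw [List.append_assoc, List.getElem?_append_right (by omega),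
          List.getElem?_append_left (by simp; omega), List.getElem?_map,
          List.getElem?_range (by omega)] at h1
        simp only [Nat.add_sub_cancel_left, Option.map_some] at h1
        rw [List.getElem?_eq_getElem (by simpa using ht)] at h1
        exact (Option.some.inj h1).symm
      have := h.openAt l₁.length (by omega)
      have k0 := key 0 (by omega)
      have k1 := key 1 (by omega)
      have k2 := key 2 (by omega)
      simp only [Nat.add_zero] at k0
      rw [k0, k1, k2] at this
      exact this

theorem dSep_iff {D : Digraph V} {X Y Z : Set V} :
    DSep D X Y Z ↔ ∀ k f, f 0 ∈ X → f k ∈ Y → ¬ ActiveSeq D Z k f := by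
  constructor
  · intro h k f hx hy hf
    obtain ⟨l, h1, h2, h3⟩ := exists_activePath_iff.2 ⟨k, f, rfl, rfl, hf⟩
    exact h _ hx _ hy l h1 h2 h3
  · intro h x hx y hy l h1 h2 h3
    obtain ⟨k, f, rfl, rfl, hf⟩ := exists_activePath_iff.1 ⟨l, h1, h2, h3⟩
    exact h k f hx hy hf

/-- A vertex is separated by its parents from its non-neighbours that it is no ancestor of: an
active path could leave it only along a directed path. -/
theorem not_activeSeq_parents {D : Digraph V} (hD : IsDAG D) {k : ℕ} {f : ℕ → V}
    (hs : ¬ Skel D (f 0) (f k)) (hr : ¬ Relation.ReflTransGen D.Adj (f 0) (f k)) :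
    ¬ ActiveSeq D {p | D.Adj p (f 0)} k f := by
  intro h
  have hk0 : k ≠ 0 := by rintro rfl; exact hr .refl
  have hk1 : k ≠ 1 := by rintro rfl; exact hs (h.skel 0 (by omega))
  have key : ∀ i, i < k → D.Adj (f i) (f (i + 1)) ∧
      Relation.ReflTransGen D.Adj (f 0) (f (i + 1)) := by
    intro i
    induction i with
    | zero =>
      intro _
      rcases h.skel 0 (by omega) with h1 | h1
      · exact ⟨h1, .single h1⟩
      · exact absurd h1 ((h.openAt 0 (by omega)).2 fun h2 => hD.asymm h1 h2.1)
    | succ i ih =>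
      intro hi
      obtain ⟨h1, h2⟩ := ih (by omega)
      rcases h.skel (i + 1) hi with h3 | h3
      · exact ⟨h3, h2.tail h3⟩
      · obtain ⟨z, hz, hz'⟩ := (h.openAt i (by omega)).1 ⟨h1, h3⟩
        exact (hD _ (.tail' (h2.trans hz') hz)).elim
  obtain ⟨i, rfl⟩ := Nat.exists_eq_succ_of_ne_zero hk0
  exact hr (key i (by omega)).2

/-- Two vertices that are not adjacent are separated by the parents of one of them. -/
theorem exists_dSep {D : Digraph V} (hD : IsDAG D) {a b : V} (hab : a ≠ b) (hs : ¬ Skel D a b) :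
    ∃ Z : Set V, a ∉ Z ∧ b ∉ Z ∧ DSep D {a} {b} Z := by
  by_cases hr : Relation.ReflTransGen D.Adj a b
  · refine ⟨{p | D.Adj p b}, fun h => hs (.inl h), hD.irrefl b, dSep_iff.2 ?_⟩
    rintro k f rfl rfl hf
    have := hf.reverse
    refine not_activeSeq_parents hD (f := fun i => f (k - i)) ?_ ?_ ?_ (k := k)
    · simpa using fun h => hs h.symm
    · simp only [Nat.sub_zero, Nat.sub_self]
      intro hr'
      rcases (Relation.reflTransGen_iff_eq_or_transGen.1 hr) with h | h
      · exact hab h.symm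
      · exact hD _ (h.trans_left hr')
    · simpa using this
  · refine ⟨{p | D.Adj p a}, hD.irrefl a, fun h => hs (.inr h), dSep_iff.2 ?_⟩
    rintro k f rfl rfl
    exact not_activeSeq_parents hD hs hr

theorem not_dSep_of_skel {D : Digraph V} {a b : V} (hab : a ≠ b) (hs : Skel D a b) (Z : Set V) :
    ¬ DSep D {a} {b} Z := by
  rw [dSep_iff]
  intro h
  refine h 1 (fun i => if i = 0 then a else b) (by simp) (by simp) ⟨?_, ?_, ?_⟩
  · intro i j hi hj hij
    interval_cases i <;> interval_cases j <;> simp_all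
  · intro i hi
    interval_cases i
    simpa using hs
  · intro i hi
    omega

theorem not_dSep_of_openAt {D : Digraph V} {Z : Set V} {a b c : V} (hab : a ≠ b) (hbc : b ≠ c)
    (hac : a ≠ c) (h1 : Skel D a b) (h2 : Skel D b c) (ho : OpenAt D Z a b c) :
    ¬ DSep D {a} {c} Z := by
  rw [dSep_iff]
  intro h
  refine h 2 (fun i => if i = 0 then a else if i = 1 then b else c) (by simp) (by simp) ⟨?_, ?_, ?_⟩
  · intro i j hi hj hij
    interval_cases i <;> interval_cases j <;> simp_all
  · intro i hi
    interval_cases i <;> simpa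
  · intro i hi
    obtain rfl : i = 0 := by omega
    simpa using ho

theorem MarkovEquiv.skel {D D' : Digraph V} (hD' : IsDAG D') (hD : IsDAG D)
    (h : MarkovEquiv D D') {a b : V} (hs : Skel D a b) : Skel D' a b := by
  have hab := hs.ne hD
  by_contra hs'
  obtain ⟨Z, ha, hb, hZ⟩ := exists_dSep hD' hab hs'
  exact not_dSep_of_skel hab hs Z ((h {a} {b} Z (by simpa using hab) (by simpa) (by simpa)).2 hZ)

theorem MarkovEquiv.symm {D D' : Digraph V} (h : MarkovEquiv D D') : MarkovEquiv D' D :=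
  fun X Y Z h1 h2 h3 => (h X Y Z h1 h2 h3).symm

theorem MarkovEquiv.trans {D D' D'' : Digraph V} (h : MarkovEquiv D D') (h' : MarkovEquiv D' D'') :
    MarkovEquiv D D'' :=
  fun X Y Z h1 h2 h3 => (h X Y Z h1 h2 h3).trans (h' X Y Z h1 h2 h3)

/-- A set separating the ends of a v-structure does not contain its middle vertex, whereas the
middle vertex would have to be in it if it were no collider. -/
theorem MarkovEquiv.vStruct {D D' : Digraph V} (hD' : IsDAG D') (hD : IsDAG D)
    (h : MarkovEquiv D D') {a b c : V} (hs : VStruct D a b c) : VStruct D' a b c := by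
  obtain ⟨hac, h1, h2, h3⟩ := hs
  have h1' : Skel D a b := .inl h1
  have h2' : Skel D b c := .inr h2
  have hab := h1'.ne hD
  have hbc := h2'.ne hD
  by_contra hcon
  have hcol : ¬ (D'.Adj a b ∧ D'.Adj c b) := fun h4 =>
    hcon ⟨hac, h4.1, h4.2, fun h5 => h3 (h.symm.skel hD hD' h5)⟩
  obtain ⟨Z, ha, hc, hZ⟩ := exists_dSep hD hac h3
  have hZ' := (h {a} {c} Z (by simpa using hac) (by simpa) (by simpa)).1 hZ
  by_cases hb : b ∈ Z
  · exact not_dSep_of_openAt hab hbc hac h1' h2'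
      ⟨fun _ => ⟨b, hb, .refl⟩, fun h4 => (h4 ⟨h1, h2⟩).elim⟩ hZ
  · exact not_dSep_of_openAt hab hbc hac (h.skel hD' hD h1') (h.skel hD' hD h2')
      ⟨fun h4 => (hcol h4).elim, fun _ => hb⟩ hZ'

theorem MarkovEquiv.samePattern {D D' : Digraph V} (hD : IsDAG D) (hD' : IsDAG D')
    (h : MarkovEquiv D D') : SamePattern D D' :=
  ⟨fun _ _ => ⟨h.skel hD' hD, h.symm.skel hD hD'⟩,
    fun _ _ _ => ⟨h.vStruct hD' hD, h.symm.vStruct hD hD'⟩⟩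

/-- Leaving out the inner vertices strictly between positions `i` and `j` keeps a path active if
the two ends of the new edge are not blocked. -/
theorem ActiveSeq.splice {D : Digraph V} {Z : Set V} {k : ℕ} {f : ℕ → V} (h : ActiveSeq D Z k f)
    {i j : ℕ} (hij : i + 2 ≤ j) (hj : j ≤ k) (hs : Skel D (f i) (f j))
    (hi : ∀ p, p + 1 = i → OpenAt D Z (f p) (f i) (f j))
    (hj' : j + 1 ≤ k → OpenAt D Z (f i) (f j) (f (j + 1))) :
    ∃ k' g, k' < k ∧ g 0 = f 0 ∧ g k' = f k ∧ ActiveSeq D Z k' g := by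
  obtain ⟨e, rfl⟩ : ∃ e, j = i + 1 + e := ⟨j - i - 1, by omega⟩
  refine ⟨k - e, fun t => if t ≤ i then f t else f (t + e), by omega, by simp, ?_, ?_, ?_, ?_⟩
  · simp only
    rw [if_neg (by omega), show k - e + e = k by omega]
  · intro s t hs ht hst
    split_ifs at hst <;> have := h.inj _ _ (by omega) (by omega) hst <;> omega
  · intro t ht
    rcases lt_trichotomy t i with h1 | h1 | h1
    · rw [if_pos (by omega), if_pos (by omega)]
      exact h.skel t (by omega)
    · subst h1
      rw [if_pos le_rfl, if_neg (by omega)]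
      exact hs
    · rw [if_neg (by omega), if_neg (by omega), show t + 1 + e = t + e + 1 by omega]
      exact h.skel _ (by omega)
  · intro t ht
    by_cases h1 : t + 2 ≤ i
    · rw [if_pos (by omega), if_pos (by omega), if_pos (by omega)]
      exact h.openAt t (by omega)
    by_cases h2 : t + 1 = i
    · subst h2
      rw [if_pos (by omega), if_pos (by omega), if_neg (by omega)]
      exact hi t rfl
    by_cases h3 : t = i
    · subst h3
      rw [if_pos le_rfl, if_neg (by omega), if_neg (by omega),
        show t + 2 + e = t + 1 + e + 1 by omega]
      exact hj' (by omega)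
    · rw [if_neg (by omega), if_neg (by omega), if_neg (by omega),
        show t + 2 + e = t + e + 2 by omega, show t + 1 + e = t + e + 1 by omega]
      exact h.openAt _ (by omega)

/-- Exchanging one inner vertex of an active path by a vertex off the path. -/
theorem ActiveSeq.replace {D : Digraph V} {Z : Set V} {k : ℕ} {f : ℕ → V} (h : ActiveSeq D Z k f)
    {i : ℕ} (hi : i + 2 ≤ k) {d : V} (hd : ∀ t, t ≤ k → f t ≠ d)
    (hs1 : Skel D (f i) d) (hs2 : Skel D d (f (i + 2)))
    (h0 : OpenAt D Z (f i) d (f (i + 2)))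
    (h1 : ∀ p, p + 1 = i → OpenAt D Z (f p) (f i) d)
    (h2 : i + 3 ≤ k → OpenAt D Z d (f (i + 2)) (f (i + 3))) :
    ActiveSeq D Z k (Function.update f (i + 1) d) where
  inj s t hs ht hst := by
    simp only [Function.update_apply] at hst
    split_ifs at hst with h3 h4 h4
    · omega
    · exact (hd t ht hst.symm).elim
    · exact (hd s hs hst).elim
    · exact h.inj s t hs ht hst
  skel t ht := by
    simp only [Function.update_apply]
    by_cases h3 : t = i
    · subst h3; simpa
    by_cases h4 : t = i + 1
    · subst h4; simpa
    · rw [if_neg (by omega), if_neg (by omega)]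
      exact h.skel t ht
  openAt t ht := by
    simp only [Function.update_apply]
    by_cases h3 : t = i
    · subst h3; simpa
    by_cases h4 : t = i + 1
    · subst h4; simpa using h2 (by omega)
    by_cases h5 : t + 1 = i
    · subst h5
      rw [if_neg (by omega), if_neg (by omega), if_pos (by omega)]
      exact h1 t rfl
    · rw [if_neg (by omega), if_neg (by omega), if_neg (by omega)]
      exact h.openAt t ht

/-- The condition at the inner vertex `a` persists when an edge leaving `a` is exchanged for another
edge leaving it. -/
theorem OpenAt.of_out {D : Digraph V} (hD : IsDAG D) {Z : Set V} {p a b c : V}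
    (h : OpenAt D Z p a b) (hab : D.Adj a b) (hac : D.Adj a c) : OpenAt D Z p a c :=
  ⟨fun h' => (hD.asymm hac h'.2).elim, fun _ => h.2 fun h' => hD.asymm hab h'.2⟩

/-- The condition at the inner vertex `a` persists when an edge entering `a` is exchanged for
another edge entering it. -/
theorem OpenAt.of_in {D : Digraph V} {Z : Set V} {p a b c : V}
    (h : OpenAt D Z p a b) (hba : D.Adj b a) (hca : D.Adj c a) : OpenAt D Z p a c :=
  ⟨fun h' => h.1 ⟨h'.1, hba⟩, fun h' => h.2 fun h'' => h' ⟨h''.1, hca⟩⟩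

section Shortest

variable {D : Digraph V} {Z : Set V} {k : ℕ} {f : ℕ → V}

/-- No active path with the same ends is shorter. -/
def NoShorter (D : Digraph V) (Z : Set V) (k : ℕ) (f : ℕ → V) : Prop :=
  ∀ k' g, k' < k → g 0 = f 0 → g k' = f k → ¬ ActiveSeq D Z k' g

theorem ActiveSeq.no_splice (h : ActiveSeq D Z k f) (hs : NoShorter D Z k f) {i j : ℕ}
    (hij : i + 2 ≤ j) (hj : j ≤ k) (hsk : Skel D (f i) (f j))
    (hi : ∀ p, p + 1 = i → OpenAt D Z (f p) (f i) (f j))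
    (hj' : j + 1 ≤ k → OpenAt D Z (f i) (f j) (f (j + 1))) : False := by
  obtain ⟨k', g, h1, h2, h3, h4⟩ := h.splice hij hj hsk hi hj'
  exact hs k' g h1 h2 h3 h4

theorem ActiveSeq.openAt_left (h : ActiveSeq D Z k f) {i p : ℕ} (hi : i + 1 ≤ k) (hp : p + 1 = i) :
    OpenAt D Z (f p) (f i) (f (i + 1)) := by
  subst hp
  exact h.openAt p hi

/-- The colliders of a shortest active path are unshielded. -/
theorem ActiveSeq.unshielded_of_collider (hD : IsDAG D) (h : ActiveSeq D Z k f)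
    (hs : NoShorter D Z k f) {i : ℕ} (hi : i + 2 ≤ k) (h1 : D.Adj (f i) (f (i + 1)))
    (h2 : D.Adj (f (i + 2)) (f (i + 1))) : ¬ Skel D (f i) (f (i + 2)) := by
  intro hsk
  obtain ⟨z, hz, hbz⟩ := (h.openAt i hi).1 ⟨h1, h2⟩
  rcases hsk with h3 | h3
  · refine h.no_splice hs le_rfl hi (.inl h3)
      (fun p hp => (h.openAt_left (by omega) hp).of_out hD h1 h3)
      fun hj => ⟨fun _ => ?_, fun _ => ?_⟩
    · exact ⟨z, hz, .head h2 hbz⟩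
    · exact (h.openAt (i + 1) (by omega)).2 fun h4 => hD.asymm h2 h4.1
  · refine h.no_splice hs le_rfl hi (.inr h3)
      (fun p hp => ⟨fun _ => ?_, fun _ => ?_⟩) fun hj =>
        ((h.openAt (i + 1) (by omega)).symm.of_out hD h2 h3).symm
    · exact ⟨z, hz, .head h1 hbz⟩
    · exact (h.openAt_left (by omega) hp).2 fun h4 => hD.asymm h1 h4.2

/-- The chains of a shortest active path are unshielded. -/
theorem ActiveSeq.unshielded_of_chain (hD : IsDAG D) (h : ActiveSeq D Z k f)
    (hs : NoShorter D Z k f) {i : ℕ} (hi : i + 2 ≤ k)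
    (h1 : D.Adj (f i) (f (i + 1)) ∧ D.Adj (f (i + 1)) (f (i + 2)) ∨
      D.Adj (f (i + 2)) (f (i + 1)) ∧ D.Adj (f (i + 1)) (f i)) : ¬ Skel D (f i) (f (i + 2)) := by
  intro hsk
  rcases h1 with ⟨h1, h2⟩ | ⟨h1, h2⟩
  · have h3 : D.Adj (f i) (f (i + 2)) := hsk.resolve_right (hD.no_triangle h1 h2)
    exact h.no_splice hs le_rfl hi hsk (fun p hp => (h.openAt_left (by omega) hp).of_out hD h1 h3)
      fun hj => ((h.openAt (i + 1) (by omega)).symm.of_in h2 h3).symm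
  · have h3 : D.Adj (f (i + 2)) (f i) := hsk.resolve_left (hD.no_triangle h1 h2)
    exact h.no_splice hs le_rfl hi hsk (fun p hp => (h.openAt_left (by omega) hp).of_in h2 h3)
      fun hj => ((h.openAt (i + 1) (by omega)).symm.of_out hD h1 h3).symm

/-- A shielded fork of a shortest active path sits next to a collider. -/
theorem ActiveSeq.collider_of_fork (hD : IsDAG D) (h : ActiveSeq D Z k f)
    (hs : NoShorter D Z k f) {i : ℕ} (hi : i + 2 ≤ k) (h1 : D.Adj (f (i + 1)) (f i))
    (h2 : D.Adj (f (i + 1)) (f (i + 2))) (hsk : Skel D (f i) (f (i + 2))) :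
    (∃ p, p + 1 = i ∧ D.Adj (f p) (f i)) ∨
      (i + 3 ≤ k ∧ D.Adj (f (i + 3)) (f (i + 2))) := by
  by_contra hcon
  rw [not_or] at hcon
  obtain ⟨hc1, hc2⟩ := hcon
  rcases hsk with h3 | h3
  · refine h.no_splice hs le_rfl hi (.inl h3) (fun p hp => ⟨fun h4 => ?_, fun _ => ?_⟩) fun hj =>
      ((h.openAt (i + 1) (by omega)).symm.of_in h2 h3).symm
    · exact (hD.asymm h3 h4.2).elim
    · exact (h.openAt_left (by omega) hp).2 fun h4 => hc1 ⟨p, hp, h4.1⟩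
  · refine h.no_splice hs le_rfl hi (.inr h3)
      (fun p hp => (h.openAt_left (by omega) hp).of_in h1 h3) fun hj => ⟨fun h4 => ?_, fun _ => ?_⟩
    · exact (hD.asymm h3 h4.1).elim
    · exact (h.openAt (i + 1) (by omega)).2 fun h4 => hc2 ⟨hj, h4.2⟩

/-- A shortest active path has the same colliders in every DAG with the same skeleton and the same
v-structures. -/
theorem ActiveSeq.collider_iff {D' : Digraph V} (hD : IsDAG D) (hD' : IsDAG D')
    (hP : SamePattern D D') (h : ActiveSeq D Z k f) (hs : NoShorter D Z k f) {i : ℕ}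
    (hi : i + 2 ≤ k) :
    (D.Adj (f i) (f (i + 1)) ∧ D.Adj (f (i + 2)) (f (i + 1))) ↔
      (D'.Adj (f i) (f (i + 1)) ∧ D'.Adj (f (i + 2)) (f (i + 1))) := by
  have hne : f i ≠ f (i + 2) := fun h' => by
    have := h.inj _ _ (by omega) (by omega) h'
    omega
  by_cases hsk : Skel D (f i) (f (i + 2))
  · refine ⟨fun h1 => (h.unshielded_of_collider hD hs hi h1.1 h1.2 hsk).elim, fun h1 => ?_⟩
    exfalso
    have hch := fun h2 => h.unshielded_of_chain hD hs hi h2 hsk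
    rcases h.skel i (by omega) with h2 | h2 <;> rcases h.skel (i + 1) (by omega) with h3 | h3
    · exact hch (.inl ⟨h2, h3⟩)
    · exact h.unshielded_of_collider hD hs hi h2 h3 hsk
    · rcases h.collider_of_fork hD hs hi h2 h3 hsk with ⟨p, rfl, h4⟩ | ⟨hj, h4⟩
      · have h5 := h.unshielded_of_collider hD hs (i := p) (by omega) h4 h2
        have hne' : f p ≠ f (p + 2) := fun h' => by
          have := h.inj _ _ (by omega) (by omega) h'
          omega
        exact hD'.asymm h1.1 ((hP.2 _ _ _).1 ⟨hne', h4, h2, h5⟩).2.2.1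
      · have h5 := h.unshielded_of_collider hD hs (i := i + 1) (by omega) h3 h4
        have hne' : f (i + 1) ≠ f (i + 3) := fun h' => by
          have := h.inj _ _ (by omega) (by omega) h'
          omega
        exact hD'.asymm h1.2 ((hP.2 _ _ _).1 ⟨hne', h3, h4, h5⟩).2.1
    · exact hch (.inr ⟨h3, h2⟩)
  · constructor
    · intro h1
      have := (hP.2 _ _ _).1 ⟨hne, h1.1, h1.2, hsk⟩
      exact ⟨this.2.1, this.2.2.1⟩
    · intro h1
      have := (hP.2 _ _ _).2 ⟨hne, h1.1, h1.2, fun h' => hsk ((hP.1 _ _).2 h')⟩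
      exact ⟨this.2.1, this.2.2.1⟩

end Shortest

/-- The number of descendants of `v`. -/
noncomputable def descCount (D : Digraph V) (v : V) : ℕ :=
  {w | Relation.ReflTransGen D.Adj v w}.ncard

theorem descCount_lt [Finite V] {D : Digraph V} (hD : IsDAG D) {a b : V} (h : D.Adj a b) :
    descCount D b < descCount D a := by
  refine Set.ncard_lt_ncard ⟨fun w hw => .head h hw, fun hsub => ?_⟩ (Set.toFinite _)
  have : Relation.ReflTransGen D.Adj b a := hsub Relation.ReflTransGen.refl
  exact hD _ (.head' h this)

/-- A shortest directed path from `b` into `Z`. -/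
theorem exists_shortest_chain {D : Digraph V} (hD : IsDAG D) {Z : Set V} {b z : V} (hz : z ∈ Z)
    (h : Relation.ReflTransGen D.Adj b z) :
    ∃ (m : ℕ) (g : ℕ → V), g 0 = b ∧ g m ∈ Z ∧ (∀ t, t < m → D.Adj (g t) (g (t + 1))) ∧
      ∀ t, t + 2 ≤ m → ¬ Skel D (g t) (g (t + 2)) := by
  classical
  have hex : ∃ m, ∃ g : ℕ → V, g 0 = b ∧ g m ∈ Z ∧ ∀ t, t < m → D.Adj (g t) (g (t + 1)) := by
    induction h using Relation.ReflTransGen.head_induction_on with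
    | refl => exact ⟨0, fun _ => z, rfl, hz, by simp⟩
    | head h' _ ih =>
      obtain ⟨m, g, h1, h2, h3⟩ := ih
      refine ⟨m + 1, fun t => if t = 0 then _ else g (t - 1), by simp; rfl, by simpa, ?_⟩
      intro t ht
      rcases t with _ | t
      · simpa [h1] using h'
      · simpa using h3 t (by omega)
  obtain ⟨g, h1, h2, h3⟩ := Nat.find_spec hex
  refine ⟨Nat.find hex, g, h1, h2, h3, fun t ht hsk => ?_⟩
  have h4 : D.Adj (g t) (g (t + 2)) :=
    hsk.resolve_right (hD.no_triangle (h3 t (by omega)) (h3 (t + 1) (by omega)))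
  refine Nat.find_min hex (m := Nat.find hex - 1) (by omega)
    ⟨fun s => if s ≤ t then g s else g (s + 1), by simpa, ?_, ?_⟩
  · beta_reduce
    rw [if_neg (by omega), show Nat.find hex - 1 + 1 = Nat.find hex by omega]
    exact h2
  · intro s hs
    beta_reduce
    rcases lt_trichotomy s t with h5 | h5 | h5
    · rw [if_pos (by omega), if_pos (by omega)]
      exact h3 s (by omega)
    · subst h5
      rw [if_pos le_rfl, if_neg (by omega)]
      exact h4
    · rw [if_neg (by omega), if_neg (by omega)]
      exact h3 _ (by omega)

/-- A directed path whose consecutive triples are unshielded is directed the same way in `D'`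
once the edge entering it is. -/
theorem SamePattern.chain {D D' : Digraph V} (hD : IsDAG D)
    (hP : SamePattern D D') {a : V} {m : ℕ} {g : ℕ → V} (h0 : D.Adj a (g 0)) (h0' : D'.Adj a (g 0))
    (hg : ∀ t, t < m → D.Adj (g t) (g (t + 1))) (ha : 0 < m → ¬ Skel D a (g 1))
    (hu : ∀ t, t + 2 ≤ m → ¬ Skel D (g t) (g (t + 2))) :
    ∀ t, t < m → D'.Adj (g t) (g (t + 1)) := by
  have key : ∀ p q r, D.Adj p q → D'.Adj p q → D.Adj q r → ¬ Skel D p r → D'.Adj q r := by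
    intro p q r h1 h1' h2 h3
    refine ((hP.1 q r).1 (.inl h2)).resolve_right fun h4 => ?_
    refine hD.asymm h2 ((hP.2 p q r).2 ⟨?_, h1', h4, fun h5 => h3 ((hP.1 _ _).2 h5)⟩).2.2.1
    rintro rfl
    exact hD.asymm h1 h2
  intro t
  induction t with
  | zero => exact fun ht => key _ _ _ h0 h0' (hg 0 ht) (ha ht)
  | succ t ih => exact fun ht => key _ _ _ (hg t (by omega)) (ih (by omega)) (hg _ ht) (hu t ht)

/-- A shortest active path with the fewest descendants of its vertices is active in `D'` too. It has
the same colliders there. If a collider lost its directed path into `Z`, then both of its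
neighbours on the path would be adjacent to the first vertex of this directed path, which could
replace the collider and has fewer descendants. -/
theorem SamePattern.activeSeq_aux [Finite V] {D D' : Digraph V} (hD : IsDAG D) (hD' : IsDAG D')
    (hP : SamePattern D D') {Z : Set V} {k : ℕ} {f : ℕ → V} (h : ActiveSeq D Z k f)
    (hs : NoShorter D Z k f)
    (hmin : ∀ g, g 0 = f 0 → g k = f k → ActiveSeq D Z k g →
      ∑ i ∈ Finset.range (k + 1), descCount D (f i) ≤
        ∑ i ∈ Finset.range (k + 1), descCount D (g i)) : ActiveSeq D' Z k f := by
  refine ⟨h.inj, fun i hi => (hP.1 _ _).1 (h.skel i hi), fun i hi => ⟨fun hc' => ?_, fun hc' => ?_⟩⟩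
  swap
  · exact (h.openAt i hi).2 fun hc => hc' ((h.collider_iff hD hD' hP hs hi).1 hc)
  obtain ⟨h1, h2⟩ := (h.collider_iff hD hD' hP hs hi).2 hc'
  obtain ⟨z, hz, hbz⟩ := (h.openAt i hi).1 ⟨h1, h2⟩
  obtain ⟨m, g, hg0, hgm, hg, hu⟩ := exists_shortest_chain hD hz hbz
  -- If the directed path keeps its direction in `D'`, the collider is open there.
  have hfin : (∀ t, t < m → D'.Adj (g t) (g (t + 1))) →
      ∃ z ∈ Z, Relation.ReflTransGen D'.Adj (f (i + 1)) z := by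
    intro hg'
    refine ⟨g m, hgm, ?_⟩
    have : ∀ t, t ≤ m → Relation.ReflTransGen D'.Adj (g 0) (g t) := by
      intro t
      induction t with
      | zero => exact fun _ => .refl
      | succ t ih => exact fun ht => (ih (by omega)).tail (hg' t ht)
    rw [← hg0]
    exact this m le_rfl
  rw [← hg0] at h1 h2 hc'
  by_cases hm : m = 0
  · exact hfin fun t ht => by omega
  by_cases ha : Skel D (f i) (g 1)
  swap
  · exact hfin (hP.chain hD h1 hc'.1 hg (fun _ => ha) hu)
  by_cases hc : Skel D (f (i + 2)) (g 1)
  swap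
  · exact hfin (hP.chain hD h2 hc'.2 hg (fun _ => hc) hu)
  -- Otherwise the next vertex of the directed path can take the place of the collider.
  exfalso
  have hbd : D.Adj (g 0) (g 1) := hg 0 (by omega)
  have had : D.Adj (f i) (g 1) := ha.resolve_right (hD.no_triangle h1 hbd)
  have hcd : D.Adj (f (i + 2)) (g 1) := hc.resolve_right (hD.no_triangle h2 hbd)
  have hdz : ∃ z ∈ Z, Relation.ReflTransGen D.Adj (g 1) z := by
    refine ⟨g m, hgm, ?_⟩
    have : ∀ t, t + 1 ≤ m → Relation.ReflTransGen D.Adj (g 1) (g (t + 1)) := by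
      intro t
      induction t with
      | zero => exact fun _ => .refl
      | succ t ih => exact fun ht => (ih (by omega)).tail (hg _ ht)
    have := this (m - 1) (by omega)
    rwa [show m - 1 + 1 = m by omega] at this
  have hL : ∀ p, p + 1 = i → OpenAt D Z (f p) (f i) (g 1) := fun p hp =>
    (h.openAt_left (by omega) hp).of_out hD (hg0 ▸ h1) had
  have hR : i + 3 ≤ k → OpenAt D Z (g 1) (f (i + 2)) (f (i + 3)) := fun hj =>
    ((h.openAt (i + 1) (by omega)).symm.of_out hD (hg0 ▸ h2) hcd).symm
  have hoff : ∀ t, t ≤ k → f t ≠ g 1 := by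
    intro t ht hft
    have e0 : t ≠ i := by rintro rfl; rw [hft] at had; exact hD.irrefl _ had
    have e1 : t ≠ i + 1 := by rintro rfl; rw [← hft, hg0] at hbd; exact hD.irrefl _ hbd
    have e2 : t ≠ i + 2 := by rintro rfl; rw [hft] at hcd; exact hD.irrefl _ hcd
    rcases Nat.lt_or_ge t i with h3 | h3
    · refine h.no_splice hs (i := t) (j := i + 2) (by omega) hi (.inr (hft ▸ hcd)) ?_ ?_
      · intro p hp
        refine ⟨fun _ => hft ▸ hdz, fun h4 => ?_⟩
        refine (h.openAt_left (i := t) (by omega) hp).2 fun h5 => h4 ⟨h5.1, hft ▸ hcd⟩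
      · intro hj
        rw [hft]
        exact hR hj
    · refine h.no_splice hs (i := i) (j := t) (by omega) ht (.inl (hft ▸ had)) ?_ ?_
      · intro p hp
        rw [hft]
        exact hL p hp
      · intro hj
        refine ⟨fun _ => hft ▸ hdz, fun h4 => ?_⟩
        refine (h.openAt_left (i := t) (by omega) (p := t - 1) (by omega)).2 fun h5 =>
          h4 ⟨hft ▸ had, h5.2⟩
  have hrep := h.replace hi hoff (.inl had) (.inr hcd)
    ⟨fun _ => hdz, fun h3 => (h3 ⟨had, hcd⟩).elim⟩ hL hR
  have hle := hmin _ (by simp) (by rw [Function.update_of_ne (by omega)]) hrep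
  refine absurd hle (not_le.2 ?_)
  refine Finset.sum_lt_sum (fun t _ => ?_) ⟨i + 1, by simp; omega, ?_⟩
  · rw [Function.update_apply]
    split_ifs with h3
    · rw [h3, ← hg0]
      exact (descCount_lt hD hbd).le
    · exact le_rfl
  · rw [Function.update_self, ← hg0]
    exact descCount_lt hD hbd

/-- DAGs with the same skeleton and v-structures link the same vertices by active paths. The path
found is a shortest one that has, among those, the fewest descendants of its vertices. -/
theorem SamePattern.activeSeq [Finite V] {D D' : Digraph V} (hD : IsDAG D) (hD' : IsDAG D')
    (hP : SamePattern D D') {Z : Set V} {k : ℕ} {f : ℕ → V} (h : ActiveSeq D Z k f) :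
    ∃ k' g, g 0 = f 0 ∧ g k' = f k ∧ ActiveSeq D' Z k' g := by
  classical
  have hex : ∃ k', ∃ g : ℕ → V, g 0 = f 0 ∧ g k' = f k ∧ ActiveSeq D Z k' g :=
    ⟨k, f, rfl, rfl, h⟩
  obtain ⟨g₀, hg₀⟩ := Nat.find_spec hex
  set K := Nat.find hex with hK
  have hex' : ∃ s, ∃ g : ℕ → V, (g 0 = f 0 ∧ g K = f k ∧ ActiveSeq D Z K g) ∧
      ∑ i ∈ Finset.range (K + 1), descCount D (g i) = s := ⟨_, g₀, hg₀, rfl⟩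
  obtain ⟨g, ⟨hg1, hg2, hg3⟩, hg4⟩ := Nat.find_spec hex'
  refine ⟨K, g, hg1, hg2, hP.activeSeq_aux hD hD' hg3 ?_ ?_⟩
  · intro k' g' hk' h1 h2 h3
    exact Nat.find_min hex hk' ⟨g', h1.trans hg1, h2.trans hg2, h3⟩
  · intro g' h1 h2 h3
    rw [hg4]
    exact Nat.find_min' hex' ⟨g', ⟨h1.trans hg1, h2.trans hg2, h3⟩, rfl⟩

/-- Two DAGs are Markov equivalent iff they have the same skeleton and the same v-structures
(Verma and Pearl). -/
theorem markovEquiv_iff_samePattern [Finite V] {D D' : Digraph V} (hD : IsDAG D) (hD' : IsDAG D') :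
    MarkovEquiv D D' ↔ SamePattern D D' := by
  refine ⟨fun h => h.samePattern hD hD', fun h X Y Z _ _ _ => ?_⟩
  rw [dSep_iff, dSep_iff]
  constructor
  · intro h1 k f hx hy hf
    obtain ⟨k', g, h2, h3, h4⟩ := h.symm.activeSeq hD' hD hf
    exact h1 k' g (h2 ▸ hx) (h3 ▸ hy) h4
  · intro h1 k f hx hy hf
    obtain ⟨k', g, h2, h3, h4⟩ := h.activeSeq hD hD' hf
    exact h1 k' g (h2 ▸ hx) (h3 ▸ hy) h4

end MarkovEnum

namespace MarkovEnum

variable {V : Type*}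

/-! ### Maximum cardinality search on chordal graphs -/

/-- `pos` orders the graph `U` such that the earlier neighbours of every vertex form a clique.
Orienting the edges along `pos` then creates no unshielded collider, and such an order exists iff
`U` is chordal. -/
structure IsPerfectOrder (U : V → V → Prop) (pos : V → ℕ) : Prop where
  ne : ∀ a b, U a b → pos a ≠ pos b
  clique : ∀ a b c, U a b → U c b → pos a < pos b → pos c < pos b → a ≠ c → U a c

/-- In a chordal graph, two neighbours of `a` that are linked by a walk avoiding the other
neighbours of `a` are adjacent. Walks may pause, so that a vertex of the walk that is last in a
perfect order can always be left out. -/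
theorem IsPerfectOrder.adj_of_walk {U : V → V → Prop} (hU : Std.Symm U) {pos : V → ℕ}
    (hp : IsPerfectOrder U pos) {a x y : V} (hx : U a x) (hy : U a y) :
    ∀ (k : ℕ) (f : ℕ → V), f 0 = x → f k = y →
      (∀ i, i < k → f i = f (i + 1) ∨ U (f i) (f (i + 1))) →
      (∀ i, 0 < i → i < k → f i = y ∨ (¬ U a (f i) ∧ f i ≠ a)) → x = y ∨ U x y := by
  intro k
  induction k with
  | zero =>
    rintro f rfl rfl - -
    exact .inl rfl
  | succ k ih =>
    intro f h0 hk hs hi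
    rcases Nat.eq_zero_or_pos k with rfl | hkpos
    · have := hs 0 (by omega)
      rwa [zero_add, h0, hk] at this
    obtain ⟨j, hj, hmax⟩ := Finset.exists_max_image (Finset.range (k + 2)) (fun i => pos (f i))
      ⟨0, by simp⟩
    simp only [Finset.mem_range] at hj hmax
    -- The two neighbours in the graph of a vertex that is last among them are adjacent or equal.
    have hlast : ∀ p q z, U p z → U q z → pos p ≤ pos z → pos q ≤ pos z → p = q ∨ U p q := by
      intro p q z h1 h2 h3 h4
      by_cases h5 : p = q
      · exact .inl h5
      · exact .inr (hp.clique p z q h1 h2 (lt_of_le_of_ne h3 (hp.ne _ _ h1))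
          (lt_of_le_of_ne h4 (hp.ne _ _ h2)) h5)
    have hmax0 := h0 ▸ hmax 0 (by omega)
    have hmaxk := hk ▸ hmax (k + 1) (by omega)
    by_cases ha : pos (f j) < pos a
    · exact hlast x y a (hU.symm _ _ hx) (hU.symm _ _ hy) (hmax0.trans ha.le) (hmaxk.trans ha.le)
    rw [not_lt] at ha
    by_cases hj0 : j = 0
    · subst hj0
      rcases hi 1 (by omega) (by omega) with h1 | h1
      · have := hs 0 (by omega)
        rwa [zero_add, h0, h1] at this
      · exfalso
        have h2 := hs 0 (by omega)
        rw [zero_add, h0] at h2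
        rcases h2 with h2 | h2
        · exact h1.1 (h2 ▸ hx)
        · rw [h0] at ha hmax
          rcases hlast a (f 1) x hx (hU.symm _ _ h2) ha (hmax 1 (by omega)) with h3 | h3
          · exact h1.2 h3.symm
          · exact h1.1 h3
    by_cases hjk : j = k + 1
    · subst hjk
      rcases hi k hkpos (by omega) with h1 | h1
      · exact ih f h0 h1 (fun i hik => hs i (by omega)) fun i h2 h3 => hi i h2 (by omega)
      · exfalso
        have h2 := hs k (by omega)
        rw [hk] at h2 ha
        rcases h2 with h2 | h2
        · exact h1.1 (h2 ▸ hy)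
        · rcases hlast a (f k) y hy h2 ha (hk ▸ hmax k (by omega)) with h3 | h3
          · exact h1.2 h3.symm
          · exact h1.1 h3
    · have hstep : f (j - 1) = f (j + 1) ∨ U (f (j - 1)) (f (j + 1)) := by
        have h1 := hs (j - 1) (by omega)
        have h2 := hs j (by omega)
        rw [show j - 1 + 1 = j by omega] at h1
        rcases h1 with h1 | h1
        · rwa [h1]
        rcases h2 with h2 | h2
        · right
          rwa [← h2]
        · exact hlast _ _ _ h1 (hU.symm _ _ h2) (hmax _ (by omega)) (hmax _ (by omega))
      refine ih (fun i => if i < j then f i else f (i + 1)) ?_ ?_ ?_ ?_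
      · rwa [if_pos (by omega)]
      · rwa [if_neg (by omega)]
      · intro i hik
        rcases lt_trichotomy (i + 1) j with h1 | h1 | h1
        · rw [if_pos (by omega), if_pos (by omega)]
          exact hs i (by omega)
        · subst h1
          rw [if_pos (by omega), if_neg (by omega)]
          exact hstep
        · rw [if_neg (by omega), if_neg (by omega)]
          exact hs _ (by omega)
      · intro i h1 h2
        split_ifs
        · exact hi i h1 (by omega)
        · exact hi _ (by omega) (by omega)

theorem exists_walk_of_reflTransGen {r : V → V → Prop} {x y : V} (h : Relation.ReflTransGen r x y) :
    ∃ (k : ℕ) (f : ℕ → V), f 0 = x ∧ f k = y ∧ ∀ i, i < k → r (f i) (f (i + 1)) := by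
  induction h using Relation.ReflTransGen.head_induction_on with
  | refl => exact ⟨0, fun _ => y, rfl, rfl, by simp⟩
  | @head a c h' _ ih =>
    obtain ⟨m, g, h1, h2, h3⟩ := ih
    refine ⟨m + 1, fun t => if t = 0 then a else g (t - 1), by simp, by simpa, ?_⟩
    intro t ht
    rcases t with _ | t
    · simpa [h1] using h'
    · simpa using h3 t (by omega)

/-- A walk that starts at a neighbour of `a` contains a last neighbour of `a`. -/
theorem exists_last_neighbour {r : V → V → Prop} (P : V → Prop) {v w : V}
    (h : Relation.ReflTransGen r v w) (hv : P v) :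
    ∃ v', P v' ∧ (v' = v ∨ ∃ z, r z v') ∧
      Relation.ReflTransGen (fun x y => r x y ∧ ¬ P y) v' w := by
  suffices H : (∃ v', P v' ∧ (v' = v ∨ ∃ z, r z v') ∧
      Relation.ReflTransGen (fun x y => r x y ∧ ¬ P y) v' w) ∨
      Relation.ReflTransGen (fun x y => r x y ∧ ¬ P y) v w by
    rcases H with H | H
    · exact H
    · exact ⟨v, hv, .inl rfl, H⟩
  clear hv
  induction h using Relation.ReflTransGen.head_induction_on with
  | refl => exact .inr .refl
  | @head a c h' _ ih =>
    rcases ih with ⟨v', h1, h2, h3⟩ | ih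
    · refine .inl ⟨v', h1, .inr ?_, h3⟩
      rcases h2 with rfl | h2
      · exact ⟨a, h'⟩
      · exact h2
    · by_cases hc : P c
      · exact .inl ⟨c, hc, .inr ⟨a, h'⟩, ih⟩
      · exact .inr (.head ⟨h', hc⟩ ih)

/-- Two vertices are not linked through vertices that come after both of them unless they are
adjacent. Among the linked pairs, one whose later element is as early as possible is
contradictory. -/
theorem IsPerfectOrder.not_linked {U : V → V → Prop} (hU : Std.Symm U) {pos₀ pos : V → ℕ}
    (hp : IsPerfectOrder U pos₀) (hinj : Function.Injective pos)
    (hmax : ∀ a b c, pos a < pos b → pos b < pos c → U a c → ¬ U a b →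
      ∃ d, pos d < pos b ∧ U d b ∧ ¬ U d c) (M : ℕ) :
    ∀ a b, max (pos a) (pos b) = M → a ≠ b → ¬ U a b → ∀ v w, U a v → M < pos v → U w b →
      ¬ Relation.ReflTransGen (fun x y => U x y ∧ M < pos x ∧ M < pos y) v w := by
  induction M using Nat.strong_induction_on with
  | _ M ih =>
    suffices H : ∀ a b, pos a < pos b → pos b = M → ¬ U a b → ∀ v w, U a v → M < pos v → U w b →
        ¬ Relation.ReflTransGen (fun x y => U x y ∧ M < pos x ∧ M < pos y) v w by
      intro a b hM hab hnab v w hav hv hwb hvw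
      rcases lt_trichotomy (pos a) (pos b) with h | h | h
      · exact H a b h (by omega) hnab v w hav hv hwb hvw
      · exact hab (hinj h)
      · have hw : M < pos w := by
          rcases Relation.ReflTransGen.cases_tail hvw with h1 | ⟨z, _, h1⟩
          · exact h1 ▸ hv
          · exact h1.2.2
        refine H b a h (by omega) (fun h' => hnab (hU.symm _ _ h')) w v (hU.symm _ _ hwb) hw
          (hU.symm _ _ hav) ?_
        have : Std.Symm fun x y => U x y ∧ M < pos x ∧ M < pos y :=
          ⟨fun x y h' => ⟨hU.symm _ _ h'.1, h'.2.2, h'.2.1⟩⟩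
        exact (Relation.ReflTransGen.stdSymm
          (r := fun x y => U x y ∧ M < pos x ∧ M < pos y)).symm _ _ hvw
    intro a b hab hM hnab v w hav hv hwb hvw
    obtain ⟨v', hav', hv', hv'w⟩ := exists_last_neighbour (U a) hvw hav
    have hv'M : M < pos v' := by
      rcases hv' with rfl | ⟨z, hz⟩
      · exact hv
      · exact hz.2.2
    obtain ⟨d, hdb, hUdb, hdv⟩ := hmax a b v' hab (by omega) hav' hnab
    have hwb' : w ≠ a := by
      rintro rfl
      exact hnab hwb
    by_cases had : U a d
    · -- The neighbours `v'` and `d` of `a` are linked by a walk through `b` avoiding `a`.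
      have hwalk : Relation.ReflTransGen
          (fun x y => U x y ∧ (y = d ∨ (¬ U a y ∧ y ≠ a))) v' d := by
        refine .tail (.tail (Relation.ReflTransGen.mono ?_ _ _ hv'w) ⟨hwb, .inr ⟨hnab, ?_⟩⟩)
          ⟨hU.symm _ _ hUdb, .inl rfl⟩
        · rintro x y ⟨⟨h1, _, h2⟩, h3⟩
          refine ⟨h1, .inr ⟨h3, ?_⟩⟩
          rintro rfl
          omega
        · rintro rfl
          omega
      obtain ⟨k, f, hf0, hfk, hf⟩ := exists_walk_of_reflTransGen hwalk
      have hin : ∀ i, 0 < i → i < k → f i = d ∨ (¬ U a (f i) ∧ f i ≠ a) := by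
        intro i h1 h2
        obtain ⟨i, rfl⟩ := Nat.exists_eq_succ_of_ne_zero h1.ne'
        exact (hf i (by omega)).2
      rcases hp.adj_of_walk hU hav' had k f hf0 hfk (fun i hi => .inr (hf i hi).1) hin with h | h
      · subst h
        omega
      · exact hdv (hU.symm _ _ h)
    · have hda : a ≠ d := by
        rintro rfl
        exact hnab hUdb
      refine ih (max (pos a) (pos d)) (by omega) a d rfl hda had v' b hav' (by omega)
        (hU.symm _ _ hUdb) (.tail (Relation.ReflTransGen.mono ?_ _ _ hv'w) ⟨hwb, ?_, by omega⟩)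
      · rintro x y ⟨⟨h1, h2, h3⟩, -⟩
        exact ⟨h1, by omega, by omega⟩
      · rcases Relation.ReflTransGen.cases_tail hv'w with h1 | ⟨z, _, h1⟩
        · rw [h1]; omega
        · have := h1.1.2.2
          omega

/-- In a chordal graph an order is perfect if, whenever `a < b < c` and `c`, but not `b`, is
adjacent to `a`, some neighbour of `b` before `b` is not adjacent to `c`. -/
theorem IsPerfectOrder.of_max {U : V → V → Prop} (hU : Std.Symm U) {pos₀ pos : V → ℕ}
    (hp : IsPerfectOrder U pos₀) (hinj : Function.Injective pos)
    (hmax : ∀ a b c, pos a < pos b → pos b < pos c → U a c → ¬ U a b →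
      ∃ d, pos d < pos b ∧ U d b ∧ ¬ U d c) : IsPerfectOrder U pos where
  ne a b hab h := by
    rw [hinj h] at hab
    exact hp.ne _ _ hab rfl
  clique a b c hab hcb h1 h2 hac := by
    by_contra h
    exact hp.not_linked hU hinj hmax _ a c rfl hac h b b hab (by omega) (hU.symm _ _ hcb) .refl

section Search

variable [DecidableEq V]

open Classical in
/-- The label of `v` in a search that has visited `τ`: the number of visited neighbours. -/
noncomputable def label (U : V → V → Prop) (τ : List V) (v : V) : ℕ :=
  (τ.toFinset.filter fun u => U u v).card

/-- The vertex `x` can be visited next by a maximum cardinality search that has visited `τ`. -/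
def IsNext (U : V → V → Prop) (τ : List V) (x : V) : Prop :=
  x ∉ τ ∧ ∀ u, u ∉ τ → label U τ u ≤ label U τ x

/-- `τ` is an initial stretch of a maximum cardinality search. -/
def IsSearch (U : V → V → Prop) (τ : List V) : Prop :=
  ∀ τ' x, τ' ++ [x] <+: τ → IsNext U τ' x

theorem label_nil (U : V → V → Prop) (v : V) : label U [] v = 0 := by simp [label]

open Classical in
theorem label_concat (U : V → V → Prop) {τ : List V} {x : V} (hx : x ∉ τ) (v : V) :
    label U (τ ++ [x]) v = label U τ v + if U x v then 1 else 0 := by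
  have h : (τ ++ [x]).toFinset = insert x τ.toFinset := by
    ext; simp
  unfold label
  rw [h, Finset.filter_insert]
  split_ifs
  · rw [Finset.card_insert_of_notMem (by simp [hx])]
  · rfl

open Classical in
theorem label_le_length (U : V → V → Prop) (τ : List V) (v : V) : label U τ v ≤ τ.length := by
  unfold label
  exact (Finset.card_filter_le _ _).trans (List.toFinset_card_le _)

theorem isSearch_nil (U : V → V → Prop) : IsSearch U [] := by
  intro τ' x h
  simp at h

theorem IsSearch.of_prefix {U : V → V → Prop} {τ τ' : List V} (h : IsSearch U τ) (h' : τ' <+: τ) :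
    IsSearch U τ' :=
  fun _ _ h'' => h _ _ (h''.trans h')

theorem isSearch_concat {U : V → V → Prop} {τ : List V} {x : V} :
    IsSearch U (τ ++ [x]) ↔ IsSearch U τ ∧ IsNext U τ x := by
  refine ⟨fun h => ⟨h.of_prefix (List.prefix_append _ _), h _ _ (List.prefix_refl _)⟩, ?_⟩
  rintro ⟨h1, h2⟩ τ' y hy
  rcases List.prefix_concat_iff.1 hy with h3 | h3
  · obtain ⟨rfl, h4⟩ := List.append_inj' h3 rfl
    obtain rfl : y = x := by simpa using h4
    exact h2
  · exact h1 _ _ h3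

theorem IsSearch.nodup {U : V → V → Prop} {τ : List V} (h : IsSearch U τ) : τ.Nodup := by
  induction τ using List.reverseRecOn with
  | nil => exact List.nodup_nil
  | append_singleton τ x ih =>
    obtain ⟨h1, h2⟩ := isSearch_concat.1 h
    rw [List.nodup_append]
    refine ⟨ih h1, List.nodup_singleton _, ?_⟩
    rintro a ha b hb rfl
    exact h2.1 (List.mem_singleton.1 hb ▸ ha)

/-- In a chordal graph the orders found by maximum cardinality search are perfect. -/
theorem IsSearch.isPerfectOrder {U : V → V → Prop} (hU : Std.Symm U) {pos₀ : V → ℕ}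
    (hp : IsPerfectOrder U pos₀) {σ : List V} (hσ : IsSearch U σ) (hall : ∀ v, v ∈ σ) :
    IsPerfectOrder U fun v => σ.idxOf v := by
  classical
  refine hp.of_max hU (fun a b h => (List.idxOf_inj (hall a)).1 h) ?_
  intro a b c hab hbc hac hnab
  have hb : σ.idxOf b < σ.length := List.idxOf_lt_length_iff.2 (hall b)
  set τ := σ.take (σ.idxOf b) with hτ
  have hmem : ∀ v, v ∈ τ ↔ σ.idxOf v < σ.idxOf b := by
    intro v
    constructor
    · intro hv
      obtain ⟨i, hi, rfl⟩ := List.mem_iff_getElem.1 hv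
      have hi' : i < σ.idxOf b := by
        simp only [hτ, List.length_take] at hi
        omega
      simp only [hτ, List.getElem_take]
      rwa [hσ.nodup.idxOf_getElem]
    · intro hv
      have hv' : σ.idxOf v < σ.length := by omega
      refine List.mem_iff_getElem.2 ⟨σ.idxOf v, ?_, ?_⟩
      · simp only [hτ, List.length_take]
        omega
      · simp [hτ]
  have hpre : τ ++ [b] <+: σ := by
    have h1 : σ.take (σ.idxOf b + 1) = τ ++ [b] := by
      rw [List.take_succ_eq_append_getElem hb, List.getElem_idxOf]
    rw [← h1]
    exact List.take_prefix _ _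
  obtain ⟨h1, h2⟩ := hσ _ _ hpre
  have h3 := h2 c (by rw [hmem]; omega)
  by_contra hcon
  push Not at hcon
  refine absurd h3 (not_le.2 (Finset.card_lt_card ⟨?_, fun hsub => ?_⟩))
  · intro d hd
    simp only [Finset.mem_filter, List.mem_toFinset] at hd ⊢
    exact ⟨hd.1, hcon d ((hmem d).1 hd.1) hd.2⟩
  · have h4 : a ∈ τ.toFinset.filter fun u => U u b := hsub (by
      simp only [Finset.mem_filter, List.mem_toFinset]
      exact ⟨(hmem a).2 hab, hac⟩)
    exact hnab (Finset.mem_filter.1 h4).2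

/-- Every start of a search can be completed. -/
theorem IsSearch.exists_extension [Fintype V] {U : V → V → Prop} {τ : List V} (h : IsSearch U τ) :
    ∃ σ, τ <+: σ ∧ IsSearch U σ ∧ ∀ v, v ∈ σ := by
  classical
  by_cases hall : ∀ v, v ∈ τ
  · exact ⟨τ, List.prefix_refl _, h, hall⟩
  push Not at hall
  obtain ⟨v, hv⟩ := hall
  obtain ⟨x, hx, hmax⟩ := Finset.exists_max_image (Finset.univ.filter fun u => u ∉ τ)
    (label U τ) ⟨v, by simpa⟩
  simp only [Finset.mem_filter, Finset.mem_univ, true_and] at hx hmax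
  have hs : IsSearch U (τ ++ [x]) := isSearch_concat.2 ⟨h, hx, hmax⟩
  obtain ⟨σ, h1, h2, h3⟩ := hs.exists_extension
  exact ⟨σ, (List.prefix_append _ _).trans h1, h2, h3⟩
termination_by Fintype.card V - τ.length
decreasing_by
  have := hs.nodup.length_le_card
  simp only [List.length_append, List.length_singleton] at this ⊢
  omega

end Search

end MarkovEnum

namespace MarkovEnum

variable {V : Type*}

/-! ### The structure of CPDAGs -/

/-- The edges of the DAG `D` whose direction follows from its skeleton and its v-structures by
Meek's rules. The side conditions of the rules refer to `D` itself, so that the rules are monotone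
in the set of edges found. -/
inductive Compelled (D : Digraph V) : V → V → Prop where
  | vStruct {a b c : V} : VStruct D a b c → Compelled D a b
  | rule1 {a b c : V} : Compelled D a b → Skel D b c → ¬ Skel D a c → a ≠ c → ¬ D.Adj c b →
      Compelled D b c
  | rule2 {a b c : V} : Compelled D a b → Compelled D b c → Skel D a c → Compelled D a c
  | rule3 {a b e f : V} : Compelled D e b → Compelled D f b → e ≠ f → ¬ Skel D e f →
      Skel D a e → Skel D a f → Skel D a b → ¬ (D.Adj e a ∧ D.Adj f a) → Compelled D a b

/-- The edges of the skeleton of `D` that are not compelled. -/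
def Reversible (D : Digraph V) (a b : V) : Prop :=
  Skel D a b ∧ ¬ Compelled D a b ∧ ¬ Compelled D b a

theorem VStruct.symm {D : Digraph V} {a b c : V} (h : VStruct D a b c) : VStruct D c b a :=
  ⟨h.1.symm, h.2.2.1, h.2.1, fun h' => h.2.2.2 h'.symm⟩

theorem Reversible.symm {D : Digraph V} {a b : V} (h : Reversible D a b) : Reversible D b a :=
  ⟨h.1.symm, h.2.2, h.2.1⟩

theorem Compelled.adj {D D' : Digraph V} (hD' : IsDAG D') (hP : SamePattern D D') {a b : V}
    (h : Compelled D a b) : D'.Adj a b := by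
  induction h with
  | vStruct h => exact ((hP.2 _ _ _).1 h).2.1
  | rule1 _ h1 h2 h3 h4 ih =>
    refine ((hP.1 _ _).1 h1).resolve_right fun h5 => h4 ?_
    exact ((hP.2 _ _ _).2 ⟨h3, ih, h5, fun h6 => h2 ((hP.1 _ _).2 h6)⟩).2.2.1
  | rule2 _ _ h1 ih1 ih2 =>
    exact ((hP.1 _ _).1 h1).resolve_right (hD'.no_triangle ih1 ih2)
  | rule3 _ _ h1 h2 h3 h4 h5 h6 ih1 ih2 =>
    refine ((hP.1 _ _).1 h5).resolve_right fun h7 => h6 ?_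
    have h8 := ((hP.1 _ _).1 h3).resolve_left (hD'.no_triangle ih1 h7)
    have h9 := ((hP.1 _ _).1 h4).resolve_left (hD'.no_triangle ih2 h7)
    have := (hP.2 _ _ _).2 ⟨h1, h8, h9, fun h => h2 ((hP.1 _ _).2 h)⟩
    exact ⟨this.2.1, this.2.2.1⟩

theorem SamePattern.refl (D : Digraph V) : SamePattern D D := ⟨fun _ _ => .rfl, fun _ _ _ => .rfl⟩

theorem Compelled.skel {D : Digraph V} (hD : IsDAG D) {a b : V} (h : Compelled D a b) :
    Skel D a b :=
  .inl (h.adj hD (.refl D))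

/-- Next to a reversible edge, a compelled edge is shielded. -/
theorem Compelled.skel_of_reversible {D : Digraph V} (hD : IsDAG D) {a b c : V}
    (h : Compelled D a b) (hbc : Reversible D b c) : Skel D a c := by
  by_contra hac
  have hne : a ≠ c := by
    rintro rfl
    exact hbc.2.2 h
  refine hbc.2.1 (.rule1 h hbc.1 hac hne fun hcb => hbc.2.2 ?_)
  exact .vStruct (VStruct.symm ⟨hne, h.adj hD (.refl D), hcb, hac⟩)

/-- A compelled edge `a → b` and a reversible edge between `b` and `c` entail a compelled edge
`a → c`. Hence there are no partially directed cycles. -/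
theorem Compelled.trans_reversible {D : Digraph V} (hD : IsDAG D) {a b : V}
    (h : Compelled D a b) : ∀ c, Reversible D b c → Compelled D a c := by
  have start : ∀ {a b c : V}, Compelled D a b → Reversible D b c → ¬ Compelled D a c →
      Reversible D a c := fun {a b c} h hbc hac => ⟨h.skel_of_reversible hD hbc, hac,
    fun hca => hbc.2.2 (.rule2 hca h hbc.1.symm)⟩
  induction h with
  | @vStruct a b d h =>
    intro c hbc
    by_contra hac
    have hrac := start (.vStruct h) hbc hac
    have hdc : Skel D d c := Compelled.skel_of_reversible hD (.vStruct h.symm) hbc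
    refine hbc.2.2 (.rule3 (.vStruct h) (.vStruct h.symm) h.1 h.2.2.2 hrac.1.symm hdc.symm
      hbc.1.symm fun h1 => hac ?_)
    exact .vStruct ⟨h.1, h1.1, h1.2, h.2.2.2⟩
  | @rule1 d a b hda hab hdb hne hba ih =>
    intro c hbc
    by_contra hac
    have hdc := ih c (start (.rule1 hda hab hdb hne hba) hbc hac)
    refine hbc.2.2 (.rule1 hdc hbc.1.symm hdb hne fun h1 => hbc.2.1 ?_)
    exact .vStruct (VStruct.symm ⟨hne, hdc.adj hD (.refl D), h1, hdb⟩)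
  | @rule2 a d b had hdb hab _ ih =>
    intro c hbc
    exact .rule2 had (ih c hbc) (Compelled.skel_of_reversible hD (.rule2 had hdb hab) hbc)
  | @rule3 a b e f heb hfb hne hef hae haf hab hcol ih1 ih2 =>
    intro c hbc
    exact .rule3 (ih1 c hbc) (ih2 c hbc) hne hef hae haf
      (Compelled.skel_of_reversible hD (.rule3 heb hfb hne hef hae haf hab hcol) hbc) hcol

/-- The number of ancestors of `v`; it increases along the edges of a DAG. -/
noncomputable def ancCount (D : Digraph V) (v : V) : ℕ :=
  {w | Relation.ReflTransGen D.Adj w v}.ncard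

theorem ancCount_lt [Finite V] {D : Digraph V} (hD : IsDAG D) {a b : V} (h : D.Adj a b) :
    ancCount D a < ancCount D b := by
  refine Set.ncard_lt_ncard ⟨fun w hw => .tail hw h, fun hsub => ?_⟩ (Set.toFinite _)
  have : Relation.ReflTransGen D.Adj b a := hsub Relation.ReflTransGen.refl
  exact hD _ (.head' h this)

/-- The order by the numbers of ancestors, which extends `D`, is perfect for the reversible edges,
so these form a chordal graph. -/
theorem isPerfectOrder_ancCount [Finite V] {D : Digraph V} (hD : IsDAG D) :
    IsPerfectOrder (Reversible D) (ancCount D) where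
  ne a b h := by
    rcases h.1 with h1 | h1
    · exact (ancCount_lt hD h1).ne
    · exact (ancCount_lt hD h1).ne'
  clique a b c hab hcb h1 h2 hac := by
    have h3 : D.Adj a b := hab.1.resolve_right fun h => by
      have := ancCount_lt hD h
      omega
    have h4 : D.Adj c b := hcb.1.resolve_right fun h => by
      have := ancCount_lt hD h
      omega
    refine ⟨?_, fun h => ?_, fun h => ?_⟩
    · by_contra h
      exact hab.2.1 (.vStruct ⟨hac, h3, h4, h⟩)
    · exact hab.2.1 (h.trans_reversible hD b hcb)
    · exact hcb.2.1 (h.trans_reversible hD b hab)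

/-- The compelled edges of `D` together with its reversible edges, oriented along `pos`. -/
def reorient (D : Digraph V) (pos : V → ℕ) : Digraph V where
  Adj u v := Compelled D u v ∨ (Reversible D u v ∧ pos u < pos v)

/-- A directed cycle could be replaced by one of compelled edges only, since a compelled edge
absorbs the reversible edges after it; but the compelled edges belong to `D`. -/
theorem reorient_isDAG {D : Digraph V} (hD : IsDAG D) (pos : V → ℕ) : IsDAG (reorient D pos) := by
  -- Reversible edges following a compelled edge can be absorbed into it.
  have absorb : ∀ {w v u : V}, Relation.TransGen (Compelled D) w v →
      Relation.ReflTransGen (fun a b => Reversible D a b ∧ pos a < pos b) v u →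
      Relation.TransGen (Compelled D) w u := by
    intro w v u h1 h2
    induction h2 with
    | refl => exact h1
    | tail _ h3 ih =>
      rcases ih with h4 | ⟨h4, h5⟩
      · exact .single (h4.trans_reversible hD _ h3.1)
      · exact .tail h4 (h5.trans_reversible hD _ h3.1)
  have split : ∀ {x y : V}, Relation.TransGen (reorient D pos).Adj x y →
      Relation.TransGen (fun a b => Reversible D a b ∧ pos a < pos b) x y ∨
      ∃ w, Relation.ReflTransGen (fun a b => Reversible D a b ∧ pos a < pos b) x w ∧
        Relation.TransGen (Compelled D) w y := by
    intro x y h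
    induction h with
    | single h =>
      rcases h with h | h
      · exact .inr ⟨_, .refl, .single h⟩
      · exact .inl (.single h)
    | tail _ h ih =>
      rcases h with h | h <;> rcases ih with ih | ⟨w, h1, h2⟩
      · exact .inr ⟨_, ih.to_reflTransGen, .single h⟩
      · exact .inr ⟨w, h1, h2.tail h⟩
      · exact .inl (ih.tail h)
      · exact .inr ⟨w, h1, absorb h2 (.single h)⟩
  intro v hv
  rcases split hv with h | ⟨w, h1, h2⟩
  · have : ∀ {x y : V}, Relation.TransGen (fun a b => Reversible D a b ∧ pos a < pos b) x y →
        pos x < pos y := by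
      intro x y h
      induction h with
      | single h => exact h.2
      | tail _ h ih => exact ih.trans h.2
    exact lt_irrefl _ (this h)
  · exact hD w (Relation.TransGen.mono (fun _ _ h => h.adj hD (.refl D)) _ _ (absorb h2 h1))

/-- A perfect order makes no unshielded collider out of reversible edges, and a collider of a
compelled and a reversible edge is shielded, too. -/
theorem reorient_samePattern {D : Digraph V} (hD : IsDAG D) {pos : V → ℕ}
    (hpos : IsPerfectOrder (Reversible D) pos) : SamePattern D (reorient D pos) := by
  have hsk : ∀ a b, Skel D a b ↔ Skel (reorient D pos) a b := by
    intro a b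
    constructor
    · intro h
      by_cases h1 : Compelled D a b
      · exact .inl (.inl h1)
      by_cases h2 : Compelled D b a
      · exact .inr (.inl h2)
      have h3 : Reversible D a b := ⟨h, h1, h2⟩
      rcases lt_or_gt_of_ne (hpos.ne _ _ h3) with h4 | h4
      · exact .inl (.inr ⟨h3, h4⟩)
      · exact .inr (.inr ⟨h3.symm, h4⟩)
    · rintro ((h | h) | (h | h))
      · exact h.skel hD
      · exact h.1.1
      · exact (h.skel hD).symm
      · exact h.1.1.symm
  refine ⟨hsk, fun a b c => ⟨fun h => ?_, fun ⟨hac, h1, h2, h3⟩ => ?_⟩⟩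
  · exact ⟨h.1, .inl (.vStruct h), .inl (.vStruct h.symm), fun h' => h.2.2.2 ((hsk _ _).2 h')⟩
  · rw [← hsk] at h3
    rcases h1 with h1 | ⟨h1, h1'⟩ <;> rcases h2 with h2 | ⟨h2, h2'⟩
    · exact ⟨hac, h1.adj hD (.refl D), h2.adj hD (.refl D), h3⟩
    · exact (h3 ((h1.trans_reversible hD _ h2.symm).skel hD)).elim
    · exact (h3 ((h2.trans_reversible hD _ h1.symm).skel hD).symm).elim
    · exact (h3 (hpos.clique a b c h1 h2 h1' h2' hac).1).elim

theorem reversible_symm (D : Digraph V) : Std.Symm (Reversible D) := ⟨fun _ _ h => h.symm⟩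

/-- The CPDAG consists of the compelled edges and of both directions of the reversible edges: a
search started at `u` orients every reversible edge at `u` away from `u`. -/
theorem cpdag_adj_iff [Fintype V] {D : Digraph V} (hD : IsDAG D) {u v : V} :
    (cpdag D).Adj u v ↔ Compelled D u v ∨ Reversible D u v := by
  classical
  have hadj : (cpdag D).Adj u v ↔ ∃ D' ∈ markovClass D, D'.Adj u v := by
    simp [cpdag, Digraph.sSup_adj]
  rw [hadj]
  constructor
  · rintro ⟨D', ⟨hD', hE⟩, h⟩
    have hP := (markovEquiv_iff_samePattern hD hD').1 hE
    by_cases h1 : Compelled D u v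
    · exact .inl h1
    · exact .inr ⟨(hP.1 _ _).2 (.inl h), h1, fun h2 => hD'.asymm h (h2.adj hD' hP)⟩
  · rintro (h | h)
    · exact ⟨D, ⟨hD, (markovEquiv_iff_samePattern hD hD).2 (.refl D)⟩, h.adj hD (.refl D)⟩
    · have h1 : IsSearch (Reversible D) [u] :=
        isSearch_concat (τ := []).2 ⟨isSearch_nil _, by simp, fun w _ => by simp [label_nil]⟩
      obtain ⟨σ, ⟨σ', rfl⟩, hσ, hall⟩ := h1.exists_extension
      have hpos := hσ.isPerfectOrder (reversible_symm D) (isPerfectOrder_ancCount hD) hall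
      have hD' := reorient_isDAG hD fun v => ([u] ++ σ').idxOf v
      refine ⟨_, ⟨hD', (markovEquiv_iff_samePattern hD hD').2 (reorient_samePattern hD hpos)⟩,
        .inr ⟨h, ?_⟩⟩
      have hne := h.1.ne hD
      simp [List.idxOf_cons_ne _ hne]

/-- The undirected edges of a graph. -/
def Und (G : Digraph V) (u v : V) : Prop := G.Adj u v ∧ G.Adj v u

theorem und_symm (G : Digraph V) : Std.Symm (Und G) := ⟨fun _ _ h => ⟨h.2, h.1⟩⟩

/-- The orientation of `G` along `pos`: the undirected edges are oriented along `pos`. -/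
def orient (G : Digraph V) (pos : V → ℕ) : Digraph V where
  Adj u v := G.Adj u v ∧ (G.Adj v u → pos u < pos v)

theorem und_cpdag_iff [Fintype V] {D : Digraph V} (hD : IsDAG D) {u v : V} :
    Und (cpdag D) u v ↔ Reversible D u v := by
  unfold Und
  rw [cpdag_adj_iff hD, cpdag_adj_iff hD]
  constructor
  · rintro ⟨h1 | h1, h2 | h2⟩
    · exact (hD.asymm (h1.adj hD (.refl D)) (h2.adj hD (.refl D))).elim
    · exact (h2.2.2 h1).elim
    · exact (h1.2.2 h2).elim
    · exact h1
  · exact fun h => ⟨.inr h, .inr h.symm⟩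

theorem MarkovEquiv.cpdag_eq {D D' : Digraph V} (h : MarkovEquiv D D') : cpdag D = cpdag D' := by
  unfold cpdag
  congr 1
  ext D''
  exact ⟨fun h' => ⟨h'.1, h.symm.trans h'.2⟩, fun h' => ⟨h'.1, h.trans h'.2⟩⟩

theorem IsCPDAG.exists_isPerfectOrder [Fintype V] {G : Digraph V} (hG : IsCPDAG G) :
    ∃ pos, IsPerfectOrder (Und G) pos := by
  obtain ⟨D, hD, rfl⟩ := hG
  have : Und (cpdag D) = Reversible D := by
    ext u v
    exact und_cpdag_iff hD
  rw [this]
  exact ⟨_, isPerfectOrder_ancCount hD⟩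

theorem IsCPDAG.irrefl [Fintype V] {G : Digraph V} (hG : IsCPDAG G) (u : V) : ¬ G.Adj u u := by
  obtain ⟨D, hD, rfl⟩ := hG
  rw [cpdag_adj_iff hD]
  rintro (h | h)
  · exact (h.skel hD).ne hD rfl
  · exact h.1.ne hD rfl

/-- Orienting the undirected edges along a perfect order yields a DAG of the class. -/
theorem IsCPDAG.orient_mem [Fintype V] {G : Digraph V} (hG : IsCPDAG G) {pos : V → ℕ}
    (hpos : IsPerfectOrder (Und G) pos) : orient G pos ∈ representedDAGs G := by
  obtain ⟨D, hD, rfl⟩ := hG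
  have hU : Und (cpdag D) = Reversible D := by
    ext u v
    exact und_cpdag_iff hD
  rw [hU] at hpos
  have hO : orient (cpdag D) pos = reorient D pos := by
    ext u v
    simp only [orient, reorient, cpdag_adj_iff hD]
    constructor
    · rintro ⟨h1 | h1, h2⟩
      · exact .inl h1
      · exact .inr ⟨h1, h2 (.inr h1.symm)⟩
    · rintro (h1 | h1)
      · refine ⟨.inl h1, ?_⟩
        rintro (h2 | h2)
        · exact (hD.asymm (h1.adj hD (.refl D)) (h2.adj hD (.refl D))).elim
        · exact (h2.2.2 h1).elim
      · exact ⟨.inr h1.1, fun _ => h1.2⟩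
  rw [hO]
  have hD' := reorient_isDAG hD pos
  exact ⟨hD', ((markovEquiv_iff_samePattern hD hD').2 (reorient_samePattern hD hpos)).cpdag_eq.symm⟩

section Represented

variable [Fintype V] {G D : Digraph V}

theorem adj_of_represented (hD : D ∈ representedDAGs G) {u v : V} (h : D.Adj u v) : G.Adj u v := by
  obtain ⟨hD, rfl⟩ := hD
  rw [cpdag_adj_iff hD]
  by_cases h1 : Compelled D u v
  · exact .inl h1
  · exact .inr ⟨.inl h, h1, fun h2 => hD.asymm h (h2.adj hD (.refl D))⟩

theorem represented_adj_or (hD : D ∈ representedDAGs G) {u v : V} (h : G.Adj u v) :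
    D.Adj u v ∨ D.Adj v u := by
  obtain ⟨hD, rfl⟩ := hD
  rcases (cpdag_adj_iff hD).1 h with h | h
  · exact h.skel hD
  · exact h.1

/-- In the DAGs of the class, colliders of undirected edges are shielded. -/
theorem represented_collider (hD : D ∈ representedDAGs G) {a b c : V} (hab : Und G a b)
    (hcb : Und G c b) (h1 : D.Adj a b) (h2 : D.Adj c b) (hac : a ≠ c) : Und G a c := by
  obtain ⟨hD, rfl⟩ := hD
  rw [und_cpdag_iff hD] at hab hcb ⊢
  exact (isPerfectOrder_ancCount hD).clique a b c hab hcb (ancCount_lt hD h1)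
    (ancCount_lt hD h2) hac

end Represented

end MarkovEnum

namespace MarkovEnum

variable {V : Type*}

/-! ### The search tree -/

/-- `D` is represented by `G`, and the undirected edges of `G` at the vertices of `τ` are oriented
in `D` as if `τ` were the beginning of a topological order. -/
def Consistent (G : Digraph V) (τ : List V) (D : Digraph V) : Prop :=
  D ∈ representedDAGs G ∧ ∀ τ' x, τ' ++ [x] <+: τ → ∀ w, Und G w x → D.Adj w x → w ∈ τ'

theorem Consistent.of_prefix {G D : Digraph V} {τ τ' : List V} (h : Consistent G τ D)
    (h' : τ' <+: τ) : Consistent G τ' D :=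
  ⟨h.1, fun _ _ h'' => h.2 _ _ (h''.trans h')⟩

theorem consistent_nil {G D : Digraph V} : Consistent G [] D ↔ D ∈ representedDAGs G :=
  ⟨fun h => h.1, fun h => ⟨h, fun τ' x h' => by simp at h'⟩⟩

theorem consistent_concat {G D : Digraph V} {τ : List V} {x : V} :
    Consistent G (τ ++ [x]) D ↔
      Consistent G τ D ∧ ∀ w, Und G w x → D.Adj w x → w ∈ τ := by
  refine ⟨fun h => ⟨h.of_prefix (List.prefix_append _ _), h.2 _ _ (List.prefix_refl _)⟩, ?_⟩
  rintro ⟨h1, h2⟩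
  refine ⟨h1.1, fun τ' y hy => ?_⟩
  rcases List.prefix_concat_iff.1 hy with h3 | h3
  · obtain ⟨rfl, h4⟩ := List.append_inj' h3 rfl
    obtain rfl : y = x := by simpa using h4
    exact h2
  · exact h1.2 _ _ h3

/-- `D` lies below one of the branches of the search tree that leave the branch `τ` and that are
still to be visited; `P i` contains the vertices still to be tried at level `i`. -/
def IsPending (G : Digraph V) (τ : List V) (P : ℕ → Set V) (D : Digraph V) : Prop :=
  ∃ i y, i < τ.length ∧ y ∈ P i ∧ Consistent G (τ.take i ++ [y]) D

theorem isPending_concat {G : Digraph V} {τ : List V} {x : V} {P : ℕ → Set V} {D : Digraph V} :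
    IsPending G (τ ++ [x]) P D ↔
      IsPending G τ P D ∨ ∃ y ∈ P τ.length, Consistent G (τ ++ [y]) D := by
  constructor
  · rintro ⟨i, y, hi, hy, hD⟩
    rcases Nat.lt_or_ge i τ.length with h | h
    · rw [List.take_append_of_le_length h.le] at hD
      exact .inl ⟨i, y, h, hy, hD⟩
    · obtain rfl : i = τ.length := by
        simp only [List.length_append, List.length_singleton] at hi
        omega
      rw [List.take_left'] at hD
      · exact .inr ⟨y, hy, hD⟩
      · rfl
  · rintro (⟨i, y, hi, hy, hD⟩ | ⟨y, hy, hD⟩)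
    · refine ⟨i, y, ?_, hy, ?_⟩
      · simp only [List.length_append, List.length_singleton]
        omega
      · rwa [List.take_append_of_le_length hi.le]
    · refine ⟨τ.length, y, by simp, hy, ?_⟩
      rwa [List.take_left' rfl]

theorem isPending_congr {G : Digraph V} {τ : List V} {P P' : ℕ → Set V} {D : Digraph V}
    (h : ∀ i, i < τ.length → P i = P' i) : IsPending G τ P D ↔ IsPending G τ P' D := by
  constructor
  · rintro ⟨i, y, hi, hy, hD⟩
    exact ⟨i, y, hi, h i hi ▸ hy, hD⟩
  · rintro ⟨i, y, hi, hy, hD⟩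
    exact ⟨i, y, hi, (h i hi).symm ▸ hy, hD⟩

section Tree

variable [DecidableEq V] {G : Digraph V}

/-- The vertices linked to `v` by a path of undirected edges through vertices that are unvisited
and have the same label as `v`. -/
def Alternative (G : Digraph V) (τ : List V) (v y : V) : Prop :=
  Relation.ReflTransGen
    (fun a b => Und G a b ∧ b ∉ τ ∧ label (Und G) τ b = label (Und G) τ v) v y

theorem Alternative.mem {τ : List V} {v y : V} (h : Alternative G τ v y) (hv : v ∉ τ) :
    y ∉ τ ∧ label (Und G) τ y = label (Und G) τ v := by
  rcases Relation.ReflTransGen.cases_tail h with rfl | ⟨z, _, h1⟩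
  · exact ⟨hv, rfl⟩
  · exact h1.2

theorem Alternative.isNext {τ : List V} {v y : V} (h : Alternative G τ v y)
    (hv : IsNext (Und G) τ v) : IsNext (Und G) τ y := by
  obtain ⟨h1, h2⟩ := h.mem hv.1
  refine ⟨h1, fun u hu => ?_⟩
  rw [h2]
  exact hv.2 u hu

theorem Alternative.symm {τ : List V} {v y : V} (hv : v ∉ τ) (h : Alternative G τ v y) :
    Alternative G τ y v := by
  have hlab := (h.mem hv).2
  unfold Alternative at h ⊢
  rw [hlab]
  clear hlab
  suffices H : Relation.ReflTransGen
      (fun a b => Und G a b ∧ b ∉ τ ∧ label (Und G) τ b = label (Und G) τ v) y v ∧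
      y ∉ τ ∧ label (Und G) τ y = label (Und G) τ v from H.1
  induction h with
  | refl => exact ⟨.refl, hv, rfl⟩
  | tail _ h1 ih => exact ⟨.head ⟨(und_symm G).symm _ _ h1.1, ih.2⟩ ih.1, h1.2⟩

theorem Alternative.trans {τ : List V} {v x y : V} (hv : v ∉ τ) (h1 : Alternative G τ v x)
    (h2 : Alternative G τ x y) : Alternative G τ v y := by
  have hlab := (h1.mem hv).2
  unfold Alternative at h1 h2 ⊢
  rw [hlab] at h2
  exact Relation.ReflTransGen.trans h1 h2

theorem Consistent.mem_of_mem {D : Digraph V} {τ : List V} (h : Consistent G τ D) {w x : V}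
    (hx : x ∈ τ) (hU : Und G w x) (hw : D.Adj w x) : w ∈ τ ∧ τ.idxOf w < τ.idxOf x := by
  have hlt := List.idxOf_lt_length_iff.2 hx
  have hpre : τ.take (τ.idxOf x) ++ [x] <+: τ := by
    have h1 : τ.take (τ.idxOf x + 1) = τ.take (τ.idxOf x) ++ [x] := by
      rw [List.take_succ_eq_append_getElem hlt, List.getElem_idxOf]
    rw [← h1]
    exact List.take_prefix _ _
  have hm := h.2 _ _ hpre w hU hw
  refine ⟨List.mem_of_mem_take hm, ?_⟩
  have h2 : (τ.take (τ.idxOf x) ++ τ.drop (τ.idxOf x)).idxOf w < τ.idxOf x := by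
    rw [List.idxOf_append_of_mem hm]
    exact (List.idxOf_lt_length_iff.2 hm).trans_le (by simp)
  rwa [List.take_append_drop] at h2

/-- A complete search order leaves a single orientation. -/
theorem consistent_full_iff [Fintype V] (hG : IsCPDAG G) {σ : List V} (hσ : IsSearch (Und G) σ)
    (hall : ∀ v, v ∈ σ) {D : Digraph V} :
    Consistent G σ D ↔ D = orient G fun v => σ.idxOf v := by
  obtain ⟨pos₀, hpos₀⟩ := hG.exists_isPerfectOrder
  constructor
  · intro h
    ext u v
    constructor
    · intro huv
      have hG' := adj_of_represented h.1 huv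
      exact ⟨hG', fun hvu => (h.mem_of_mem (hall v) ⟨hG', hvu⟩ huv).2⟩
    · rintro ⟨h1, h2⟩
      refine (represented_adj_or h.1 h1).resolve_right fun h3 => ?_
      have hvu := adj_of_represented h.1 h3
      have := (h.mem_of_mem (hall u) ⟨hvu, h1⟩ h3).2
      exact lt_asymm this (h2 hvu)
  · rintro rfl
    refine ⟨hG.orient_mem (hσ.isPerfectOrder (und_symm G) hpos₀ hall), ?_⟩
    rintro τ' x ⟨τ'', rfl⟩ w hU hw
    have h1 : (τ' ++ [x] ++ τ'').idxOf w < (τ' ++ [x] ++ τ'').idxOf x := hw.2 hU.2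
    have hx : x ∉ τ' := (hσ τ' x ⟨τ'', rfl⟩).1
    by_contra hw'
    have hne : w ≠ x := by
      rintro rfl
      exact lt_irrefl _ h1
    rw [List.append_assoc, List.idxOf_append_of_notMem hx, List.idxOf_append_of_notMem hw'] at h1
    simp at h1

/-- Every orientation consistent with `τ` is consistent with one of the alternatives for the next
vertex, namely a source among them: a further parent of this source has a smaller label, so some
vertex of `τ` would form an unshielded collider with it. -/
theorem Consistent.exists_alternative [Fintype V] {τ : List V} {v : V} {D : Digraph V}
    (hv : IsNext (Und G) τ v) (h : Consistent G τ D) :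
    ∃ y, Alternative G τ v y ∧ Consistent G (τ ++ [y]) D := by
  classical
  obtain ⟨y, hy, hmin⟩ := Finset.exists_min_image
    (Finset.univ.filter fun y => Alternative G τ v y) (ancCount D)
    ⟨v, by simp only [Finset.mem_filter, Finset.mem_univ, true_and]; exact .refl⟩
  simp only [Finset.mem_filter, Finset.mem_univ, true_and] at hy hmin
  refine ⟨y, hy, consistent_concat.2 ⟨h, fun p hU hp => ?_⟩⟩
  by_contra hpτ
  obtain ⟨hyτ, hlab⟩ := hy.mem hv.1
  have hD := h.1.1
  have hlt : label (Und G) τ p < label (Und G) τ y := by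
    refine lt_of_le_of_ne (hlab ▸ hv.2 p hpτ) fun heq => ?_
    have h1 : Alternative G τ v p :=
      Relation.ReflTransGen.tail hy ⟨(und_symm G).symm _ _ hU, hpτ, heq.trans hlab⟩
    have := hmin p h1
    have := ancCount_lt hD hp
    omega
  obtain ⟨u, hu, hup⟩ : ∃ u, (u ∈ τ ∧ Und G u y) ∧ ¬ Und G u p := by
    by_contra hcon
    push Not at hcon
    refine absurd (Finset.card_le_card fun u hu => ?_) (not_le.2 hlt)
    simp only [Finset.mem_filter, List.mem_toFinset] at hu ⊢
    exact ⟨hu.1, hcon u hu⟩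
  have huy : D.Adj u y := (represented_adj_or h.1 hu.2.1).resolve_right fun h1 =>
    hyτ (h.mem_of_mem hu.1 ((und_symm G).symm _ _ hu.2) h1).1
  refine hup (represented_collider h.1 hu.2 hU huy hp ?_)
  rintro rfl
  exact hpτ hu.1

/-- Different alternatives for the next vertex lead to different orientations: without unshielded
colliders, a connected set of vertices has only one source. -/
theorem Consistent.alternative_unique [Fintype V] {τ : List V} {v x y : V} {D : Digraph V}
    (hv : v ∉ τ) (hx : Alternative G τ v x) (hy : Alternative G τ v y)
    (h1 : Consistent G (τ ++ [x]) D) (h2 : Consistent G (τ ++ [y]) D) : x = y := by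
  have hxy := (hx.symm hv).trans (hx.mem hv).1 hy
  have hxτ := (hx.mem hv).1
  obtain ⟨hD, hxs⟩ := consistent_concat.1 h1
  obtain ⟨-, hys⟩ := consistent_concat.1 h2
  set A : V → Prop := fun z => z ∉ τ with hA
  set r : V → V → Prop := fun a b => Und G a b ∧ D.Adj a b ∧ A a ∧ A b with hr
  have back : ∀ z, Relation.ReflTransGen r x z → ∀ w, A w → Und G w z → D.Adj w z →
      Relation.ReflTransGen r x w := by
    intro z hz
    induction hz with
    | refl => exact fun w hw hU hwz => (hw (hxs w hU hwz)).elim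
    | @tail z' z hz' hstep ih =>
      intro w hw hU hwz
      by_cases hne : w = z'
      · exact hne ▸ hz'
      · have h3 := represented_collider hD.1 hU hstep.1 hwz hstep.2.1 hne
        rcases represented_adj_or hD.1 h3.1 with h4 | h4
        · exact ih w hw h3 h4
        · exact hz'.tail ⟨(und_symm G).symm _ _ h3, h4, hstep.2.2.1, hw⟩
  have key : ∀ z, Alternative G τ x z → Relation.ReflTransGen r x z ∧ A z := by
    intro z hz
    unfold Alternative at hz
    induction hz with
    | refl => exact ⟨.refl, hxτ⟩
    | tail _ h3 ih =>
      refine ⟨?_, h3.2.1⟩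
      rcases represented_adj_or hD.1 h3.1.1 with h4 | h4
      · exact ih.1.tail ⟨h3.1, h4, ih.2, h3.2.1⟩
      · exact back _ ih.1 _ h3.2.1 ((und_symm G).symm _ _ h3.1) h4
  rcases Relation.ReflTransGen.cases_tail (key y hxy).1 with h3 | ⟨p, _, h3⟩
  · exact h3.symm
  · exact (h3.2.2.1 (hys p h3.1 h3.2.1)).elim

/-- The state of a backtracking search through the tree: `done` lists what has been output, `τ` is
the current branch, `P i` contains the vertices still to be tried at level `i` of it, and `S`
contains what is to be found below the current branch itself. -/
structure TreeInv (G : Digraph V) (done : List (Digraph V)) (τ : List V) (P : ℕ → Set V)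
    (S : Set (Digraph V)) : Prop where
  search : IsSearch (Und G) τ
  pend : ∀ i, (h : i < τ.length) → ∀ y ∈ P i, Alternative G (τ.take i) τ[i] y ∧ y ≠ τ[i]
  nodup : done.Nodup
  mem : ∀ D ∈ done, D ∈ representedDAGs G
  fresh : ∀ D ∈ done, D ∉ S ∧ ¬ IsPending G τ P D
  cover : ∀ D ∈ representedDAGs G, D ∈ done ∨ D ∈ S ∨ IsPending G τ P D

theorem treeInv_init (P : ℕ → Set V) : TreeInv G [] [] P {D | Consistent G [] D} where
  search := isSearch_nil _
  pend i h := by simp at h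
  nodup := List.nodup_nil
  mem D h := by simp at h
  fresh D h := by simp at h
  cover D hD := .inr (.inl (consistent_nil.2 hD))

theorem TreeInv.pend_concat {done : List (Digraph V)} {τ : List V} {P P' : ℕ → Set V}
    {S : Set (Digraph V)} (h : TreeInv G done τ P S) {x : V}
    (hP : ∀ i, i < τ.length → P' i = P i)
    (hx : ∀ y ∈ P' τ.length, Alternative G τ x y ∧ y ≠ x) :
    ∀ i, (h : i < (τ ++ [x]).length) → ∀ y ∈ P' i,
      Alternative G ((τ ++ [x]).take i) (τ ++ [x])[i] y ∧ y ≠ (τ ++ [x])[i] := by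
  intro i hi y hy
  rcases Nat.lt_or_ge i τ.length with h1 | h1
  · rw [List.take_append_of_le_length h1.le, List.getElem_append_left h1]
    exact h.pend i h1 y (hP i h1 ▸ hy)
  · obtain rfl : i = τ.length := by
      simp only [List.length_append, List.length_singleton] at hi
      omega
    rw [List.take_left' rfl, List.getElem_append_right le_rfl]
    simpa using hx y hy

/-- Going down the search tree. -/
theorem TreeInv.extend [Fintype V] {done : List (Digraph V)} {τ : List V} {P P' : ℕ → Set V} {x : V}
    (h : TreeInv G done τ P {D | Consistent G τ D}) (hx : IsNext (Und G) τ x)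
    (hP : ∀ i, i < τ.length → P' i = P i)
    (hPx : P' τ.length = {y | Alternative G τ x y ∧ y ≠ x}) :
    TreeInv G done (τ ++ [x]) P' {D | Consistent G (τ ++ [x]) D} where
  search := isSearch_concat.2 ⟨h.search, hx⟩
  pend := h.pend_concat hP fun y hy => by rwa [hPx] at hy
  nodup := h.nodup
  mem := h.mem
  fresh D hD := by
    obtain ⟨h1, h2⟩ := h.fresh D hD
    refine ⟨fun h3 => h1 (Consistent.of_prefix h3 (List.prefix_append _ _)), fun h3 => ?_⟩
    rw [isPending_concat, isPending_congr hP] at h3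
    rcases h3 with h3 | ⟨y, _, h3⟩
    · exact h2 h3
    · exact h1 (h3.of_prefix (List.prefix_append _ _))
  cover D hD := by
    rw [isPending_concat, isPending_congr hP]
    rcases h.cover D hD with h1 | h1 | h1
    · exact .inl h1
    · obtain ⟨y, hy, hyD⟩ := Consistent.exists_alternative hx h1
      by_cases hyx : y = x
      · exact .inr (.inl (hyx ▸ hyD))
      · exact .inr (.inr (.inr ⟨y, by rw [hPx]; exact ⟨hy, hyx⟩, hyD⟩))
    · exact .inr (.inr (.inl h1))

/-- Output at a leaf of the search tree. -/
theorem TreeInv.output [Fintype V] (hG : IsCPDAG G) {done : List (Digraph V)} {σ : List V}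
    {P : ℕ → Set V} (h : TreeInv G done σ P {D | Consistent G σ D}) (hall : ∀ v, v ∈ σ) :
    TreeInv G (done ++ [orient G fun v => σ.idxOf v]) σ P ∅ := by
  have hfull := fun D => consistent_full_iff hG h.search hall (D := D)
  have hO : Consistent G σ (orient G fun v => σ.idxOf v) := (hfull _).2 rfl
  refine ⟨h.search, h.pend, ?_, ?_, ?_, ?_⟩
  · rw [List.nodup_append]
    refine ⟨h.nodup, List.nodup_singleton _, ?_⟩
    rintro a ha b hb rfl
    rw [List.mem_singleton] at hb
    exact (h.fresh _ ha).1 (hb ▸ hO)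
  · intro D hD
    rcases List.mem_append.1 hD with hD | hD
    · exact h.mem D hD
    · exact List.mem_singleton.1 hD ▸ hO.1
  · intro D hD
    refine ⟨Set.notMem_empty _, ?_⟩
    rcases List.mem_append.1 hD with hD | hD
    · exact (h.fresh D hD).2
    · rw [List.mem_singleton] at hD
      subst hD
      rintro ⟨i, y, hi, hy, hD⟩
      obtain ⟨h1, h2⟩ := h.pend i hi y hy
      have hpre : σ.take i ++ [σ[i]] <+: σ := by
        rw [← List.take_succ_eq_append_getElem hi]
        exact List.take_prefix _ _
      refine h2 (Consistent.alternative_unique (h.search _ _ hpre).1 h1 .refl hD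
        (hO.of_prefix hpre))
  · intro D hD
    rcases h.cover D hD with h1 | h1 | h1
    · exact .inl (List.mem_append_left _ h1)
    · exact .inl (List.mem_append_right _ (List.mem_singleton.2 ((hfull D).1 h1)))
    · exact .inr (.inr h1)

/-- Going up in the search tree. -/
theorem TreeInv.pop {done : List (Digraph V)} {τ : List V} {P : ℕ → Set V} {x : V}
    (h : TreeInv G done (τ ++ [x]) P ∅) (hP : P τ.length = ∅) : TreeInv G done τ P ∅ := by
  have hpend : ∀ D, IsPending G (τ ++ [x]) P D ↔ IsPending G τ P D := by
    intro D
    rw [isPending_concat, hP]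
    simp
  refine ⟨(isSearch_concat.1 h.search).1, fun i hi y hy => ?_, h.nodup, h.mem, fun D hD => ?_,
    fun D hD => ?_⟩
  · have := h.pend i (by simp; omega) y hy
    rwa [List.take_append_of_le_length hi.le, List.getElem_append_left hi] at this
  · rw [← hpend]
    exact h.fresh D hD
  · rw [← hpend]
    exact h.cover D hD

/-- Going to the next branch of the search tree. -/
theorem TreeInv.switch {done : List (Digraph V)} {τ : List V} {P P' : ℕ → Set V} {x y : V}
    (h : TreeInv G done (τ ++ [x]) P ∅) (hy : y ∈ P τ.length)
    (hP : ∀ i, i < τ.length → P' i = P i) (hPy : P' τ.length = P τ.length \ {y}) :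
    TreeInv G done (τ ++ [y]) P' {D | Consistent G (τ ++ [y]) D} := by
  obtain ⟨hτ, hx⟩ := isSearch_concat.1 h.search
  have hlast : ∀ z ∈ P τ.length, Alternative G τ x z ∧ z ≠ x := by
    intro z hz
    have := h.pend τ.length (by simp) z hz
    rw [List.take_left' rfl, List.getElem_append_right le_rfl] at this
    simpa using this
  refine ⟨isSearch_concat.2 ⟨hτ, (hlast y hy).1.isNext hx⟩, ?_, h.nodup, h.mem, fun D hD => ?_,
    fun D hD => ?_⟩
  · intro i hi z hz
    rcases Nat.lt_or_ge i τ.length with h1 | h1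
    · have := h.pend i (by simp; omega) z (hP i h1 ▸ hz)
      rw [List.take_append_of_le_length h1.le, List.getElem_append_left h1] at this ⊢
      exact this
    · obtain rfl : i = τ.length := by
        simp only [List.length_append, List.length_singleton] at hi
        omega
      rw [hPy] at hz
      rw [List.take_left' rfl, List.getElem_append_right le_rfl]
      have h2 := (hlast y hy).1
      simpa using ⟨(h2.symm hx.1).trans (h2.mem hx.1).1 (hlast z hz.1).1, hz.2⟩
  · have h1 := (h.fresh D hD).2
    rw [isPending_concat, not_or] at h1
    refine ⟨fun h2 => h1.2 ⟨y, hy, h2⟩, ?_⟩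
    rw [isPending_concat, isPending_congr hP, hPy]
    rintro (h2 | ⟨z, hz, h2⟩)
    · exact h1.1 h2
    · exact h1.2 ⟨z, hz.1, h2⟩
  · rw [isPending_concat, isPending_congr hP, hPy]
    rcases h.cover D hD with h1 | h1 | h1
    · exact .inl h1
    · exact (Set.notMem_empty _ h1).elim
    · rw [isPending_concat] at h1
      rcases h1 with h1 | ⟨z, hz, h1⟩
      · exact .inr (.inr (.inl h1))
      · by_cases hzy : z = y
        · exact .inr (.inl (hzy ▸ h1))
        · exact .inr (.inr (.inr ⟨z, ⟨hz, hzy⟩, h1⟩))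

/-- When the root of the search tree has been left, everything has been output. -/
theorem TreeInv.mem_iff {done : List (Digraph V)} {P : ℕ → Set V} (h : TreeInv G done [] P ∅)
    (D : Digraph V) : D ∈ done ↔ D ∈ representedDAGs G := by
  refine ⟨h.mem D, fun hD => ?_⟩
  rcases h.cover D hD with h1 | h1 | ⟨i, y, hi, -⟩
  · exact h1
  · exact (Set.notMem_empty _ h1).elim
  · simp at hi

end Tree

end MarkovEnum

namespace MarkovEnum

/-! ### A program logic with time bounds -/

/-- From the store `s`, the program `p` halts without output in a store and after a time that
satisfy `Q`. -/
def Runs (W : ℕ) (p : Prog) (s : Store) (Q : Store → ℕ → Prop) : Prop :=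
  ∃ s' t, Exec W p s s' (ticks t) ∧ Q s' t

theorem ticks_append (a b : ℕ) : ticks a ++ ticks b = ticks (a + b) := by
  simp [ticks, List.replicate_append_replicate]

section Rules

variable {W : ℕ} {p q : Prog} {s : Store} {Q R : Store → ℕ → Prop}

theorem Runs.mono (h : Runs W p s Q) (hQ : ∀ s' t, Q s' t → R s' t) : Runs W p s R := by
  obtain ⟨s', t, h1, h2⟩ := h
  exact ⟨s', t, h1, hQ _ _ h2⟩

theorem Runs.skip (h : Q s 1) : Runs W .skip s Q := ⟨s, 1, .skip s, h⟩

theorem Runs.assign {x : ℕ} {e : Expr} {v : ℕ} (hv : e.eval W s = v)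
    (h : Q (s.setReg x v) (e.cost + 1)) : Runs W (.assign x e) s Q :=
  ⟨_, _, .assign x e s, hv ▸ h⟩

theorem Runs.write {a : ℕ} {i e : Expr} {j v : ℕ} (hj : i.eval W s = j) (hv : e.eval W s = v)
    (h : Q (s.setArr a j v) (i.cost + e.cost + 1)) : Runs W (.write a i e) s Q :=
  ⟨_, _, .write a i e s, hj ▸ hv ▸ h⟩

theorem Runs.seq (h : Runs W p s fun s' t => Runs W q s' fun s'' t' => Q s'' (t + t')) :
    Runs W (.seq p q) s Q := by
  obtain ⟨s', t, h1, s'', t', h2, h3⟩ := h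
  exact ⟨s'', t + t', ticks_append t t' ▸ .seq h1 h2, h3⟩

theorem Runs.ite {b : Test} (h1 : b.Holds W s → Runs W p s fun s' t => Q s' (b.cost + t))
    (h2 : ¬ b.Holds W s → Runs W q s fun s' t => Q s' (b.cost + t)) :
    Runs W (.ite b p q) s Q := by
  by_cases hb : b.Holds W s
  · obtain ⟨s', t, h3, h4⟩ := h1 hb
    exact ⟨s', _, ticks_append _ t ▸ .ite_true q hb h3, h4⟩
  · obtain ⟨s', t, h3, h4⟩ := h2 hb
    exact ⟨s', _, ticks_append _ t ▸ .ite_false p hb h3, h4⟩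

theorem Test.cost_pos (b : Test) : 0 < b.cost := by
  cases b <;> simp [Test.cost]

/-- A loop runs as long as its invariant `I m` allows, where the potential `m` pays for the time
of every iteration. -/
theorem Runs.loop {b : Test} (I : ℕ → Store → Prop)
    (hstep : ∀ m s, I m s → b.Holds W s →
      Runs W p s fun s' t => ∃ m', I m' s' ∧ t + b.cost + m' ≤ m) :
    ∀ m s, I m s → Runs W (.loop b p) s fun s' t =>
      ∃ m', I m' s' ∧ ¬ b.Holds W s' ∧ t + m' ≤ m + b.cost := by
  intro m
  induction m using Nat.strong_induction_on with
  | _ m ih =>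
    intro s hs
    by_cases hb : b.Holds W s
    · obtain ⟨s', t, h1, m', h2, h3⟩ := hstep m s hs hb
      have := b.cost_pos
      obtain ⟨s'', t', h4, m'', h5, h6, h7⟩ := ih m' (by omega) s' h2
      refine ⟨s'', b.cost + t + t', ?_, m'', h5, h6, by omega⟩
      rw [← ticks_append, ← ticks_append]
      exact .loop_true hb h1 h4
    · exact ⟨s, b.cost, .loop_false p hb, m, hs, hb, by omega⟩

end Rules

/-- The registers that a program may change. -/
def Prog.regs : Prog → List ℕ
  | .assign x _ => [x]
  | .seq p q => p.regs ++ q.regs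
  | .ite _ p q => p.regs ++ q.regs
  | .loop _ p => p.regs
  | _ => []

/-- The arrays that a program may change. -/
def Prog.arrs : Prog → List ℕ
  | .write a _ _ => [a]
  | .seq p q => p.arrs ++ q.arrs
  | .ite _ p q => p.arrs ++ q.arrs
  | .loop _ p => p.arrs
  | _ => []

/-- The stores `s` and `s'` differ at most in the registers and arrays that `p` may change. -/
def Frame (p : Prog) (s s' : Store) : Prop :=
  (∀ x, x ∉ p.regs → s'.reg x = s.reg x) ∧ ∀ a, a ∉ p.arrs → s'.arr a = s.arr a

theorem Exec.frame {W : ℕ} {p : Prog} {s s' : Store} {t : List Event} (h : Exec W p s s' t) :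
    Frame p s s' := by
  induction h with
  | skip | emit | mark | loop_false => exact ⟨fun _ _ => rfl, fun _ _ => rfl⟩
  | assign x e s =>
    refine ⟨fun y hy => ?_, fun _ _ => rfl⟩
    simp only [Prog.regs, List.mem_singleton] at hy
    simp [Store.setReg, hy]
  | write a i e s =>
    refine ⟨fun _ _ => rfl, fun b hb => ?_⟩
    simp only [Prog.arrs, List.mem_singleton] at hb
    simp [Store.setArr, hb]
  | seq _ _ ih1 ih2 =>
    simp only [Frame, Prog.regs, Prog.arrs, List.mem_append, not_or] at ih1 ih2 ⊢
    exact ⟨fun x hx => (ih2.1 x hx.2).trans (ih1.1 x hx.1),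
      fun x hx => (ih2.2 x hx.2).trans (ih1.2 x hx.1)⟩
  | ite_true _ _ _ ih =>
    simp only [Frame, Prog.regs, Prog.arrs, List.mem_append, not_or] at ih ⊢
    exact ⟨fun x hx => ih.1 x hx.1, fun x hx => ih.2 x hx.1⟩
  | ite_false _ _ _ ih =>
    simp only [Frame, Prog.regs, Prog.arrs, List.mem_append, not_or] at ih ⊢
    exact ⟨fun x hx => ih.1 x hx.2, fun x hx => ih.2 x hx.2⟩
  | loop_true _ _ _ ih1 ih2 =>
    exact ⟨fun x hx => (ih2.1 x hx).trans (ih1.1 x hx), fun x hx => (ih2.2 x hx).trans (ih1.2 x hx)⟩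

theorem Runs.frame {W : ℕ} {p : Prog} {s : Store} {Q : Store → ℕ → Prop} (h : Runs W p s Q) :
    Runs W p s fun s' t => Q s' t ∧ Frame p s s' := by
  obtain ⟨s', t, h1, h2⟩ := h
  exact ⟨s', t, h1, h2, h1.frame⟩

@[simp]
theorem Store.reg_setReg (s : Store) (x v y : ℕ) :
    (s.setReg x v).reg y = if y = x then v else s.reg y := by
  simp [Store.setReg, Function.update_apply]

@[simp]
theorem Store.arr_setReg (s : Store) (x v : ℕ) : (s.setReg x v).arr = s.arr := rfl

@[simp]
theorem Store.reg_setArr (s : Store) (a i v : ℕ) : (s.setArr a i v).reg = s.reg := rfl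

@[simp]
theorem Store.arr_setArr (s : Store) (a i v b : ℕ) :
    (s.setArr a i v).arr b = if b = a then Function.update (s.arr a) i v else s.arr b := by
  simp only [Store.setArr, Function.update_apply]

theorem Frame.refl (p : Prog) (s : Store) : Frame p s s := ⟨fun _ _ => rfl, fun _ _ => rfl⟩

theorem Frame.trans {p : Prog} {s s' s'' : Store} (h : Frame p s s') (h' : Frame p s' s'') :
    Frame p s s'' :=
  ⟨fun x hx => (h'.1 x hx).trans (h.1 x hx), fun x hx => (h'.2 x hx).trans (h.2 x hx)⟩

/-- The rule for loops, with the frame of the loop added to the invariant. -/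
theorem Runs.loop_frame {W : ℕ} {p : Prog} {b : Test} (I : ℕ → Store → Prop) {s₀ : Store}
    (hstep : ∀ m s, Frame (.loop b p) s₀ s → I m s → b.Holds W s →
      Runs W p s fun s' t => ∃ m', I m' s' ∧ t + b.cost + m' ≤ m) {m : ℕ} (h0 : I m s₀) :
    Runs W (.loop b p) s₀ fun s' t =>
      ∃ m', Frame (.loop b p) s₀ s' ∧ I m' s' ∧ ¬ b.Holds W s' ∧ t + m' ≤ m + b.cost := by
  refine (Runs.loop (fun m s => Frame (.loop b p) s₀ s ∧ I m s) ?_ m s₀ ⟨.refl _ _, h0⟩).mono ?_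
  · rintro m s ⟨h1, h2⟩ hb
    refine (hstep m s h1 h2 hb).frame.mono ?_
    rintro s' t ⟨⟨m', h3, h4⟩, h5⟩
    exact ⟨m', ⟨h1.trans h5, h3⟩, h4⟩
  · rintro s' t ⟨m', ⟨h1, h2⟩, h3, h4⟩
    exact ⟨m', h1, h2, h3, h4⟩

/-- The loop `for j := 0 to e - 1 do p`. -/
def Prog.forUpTo (j : ℕ) (e : Expr) (p : Prog) : Prog :=
  .seq (.assign j (.const 0))
    (.loop (.lt (.reg j) e) (.seq p (.assign j (.add (.reg j) (.const 1)))))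

/-- The rule for bounded loops with the invariant `I`, where each iteration takes time at most
`T`. -/
theorem Runs.forUpTo {W : ℕ} {j N T : ℕ} {e : Expr} {p : Prog} (I : ℕ → Store → Prop)
    {s : Store} (hN : N + 1 < W) (hj : j ∉ p.regs)
    (he : ∀ i s', i ≤ N → Frame (.forUpTo j e p) s s' → I i s' → s'.reg j = i → e.eval W s' = N)
    (hbody : ∀ i s', i < N → Frame (.forUpTo j e p) s s' → I i s' → s'.reg j = i →
      Runs W p s' fun s' t => I (i + 1) (s'.setReg j (i + 1)) ∧ t ≤ T)
    (h0 : I 0 (s.setReg j 0)) :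
    Runs W (.forUpTo j e p) s fun s' t =>
      I N s' ∧ s'.reg j = N ∧ t ≤ N * (T + e.cost + 6) + e.cost + 4 := by
  refine .seq (.assign (v := 0) (by simp [Expr.eval]) ?_)
  have hfr : ∀ {s'}, Frame (.loop (.lt (.reg j) e) (.seq p (.assign j (.add (.reg j) (.const 1)))))
      (s.setReg j 0) s' → Frame (.forUpTo j e p) s s' := by
    intro s' h
    refine ⟨fun x hx => (h.1 x ?_).trans ?_, fun a ha => (h.2 a ?_).trans ?_⟩ <;>
      simp_all [Prog.forUpTo, Prog.regs, Prog.arrs]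
  refine (Runs.loop_frame (fun m s => ∃ i, i ≤ N ∧ I i s ∧ s.reg j = i ∧
    m = (N - i) * (T + e.cost + 6)) (s₀ := s.setReg j 0)
    ?_ (m := N * (T + e.cost + 6)) ⟨0, by simpa using h0⟩).mono ?_
  · rintro m s hf ⟨i, hi, hI, hr, rfl⟩ hb
    simp only [Test.Holds, Expr.eval, hr, he i s hi (hfr hf) hI hr] at hb
    refine .seq ((hbody i s hb (hfr hf) hI hr).frame.mono ?_)
    rintro s' t ⟨⟨h1, h3⟩, h2⟩
    refine .assign (v := i + 1) ?_ ⟨(N - (i + 1)) * (T + e.cost + 6), ⟨i + 1, hb, h1, ?_, rfl⟩, ?_⟩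
    · simp only [Expr.eval, h2.1 j hj, hr]
      rw [Nat.mod_eq_of_lt (by omega : 1 < W), Nat.mod_eq_of_lt (by omega)]
    · simp
    · obtain ⟨r, rfl⟩ : ∃ r, N = i + 1 + r := ⟨N - (i + 1), by omega⟩
      rw [show i + 1 + r - (i + 1) = r by omega, show i + 1 + r - i = r + 1 by omega, Nat.add_mul]
      simp only [Expr.cost, Test.cost]
      omega
  · rintro s' t ⟨m', hf, ⟨i, hi, hI, hr, rfl⟩, hb, ht⟩
    simp only [Test.Holds, Expr.eval, hr, he i s' hi (hfr hf) hI hr] at hb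
    obtain rfl : i = N := by omega
    refine ⟨hI, hr, ?_⟩
    simp only [Expr.cost, Test.cost] at ht ⊢
    omega

end MarkovEnum

namespace MarkovEnum

/-! ### The program -/

/-- Row-major position `(a, b)` in a two-dimensional table; register 13 holds the row length. -/
def Expr.idx (a b : Expr) : Expr := .add (.mul a (.reg 13)) b

/-- Runs `p` with every neighbour of the vertex in register `x` in register 3. -/
def forNbr (x : ℕ) (p : Prog) : Prog :=
  .forUpTo 12 (.read 4 (.reg x)) (.seq (.assign 3 (.read 3 (.idx (.reg x) (.reg 12)))) p)

/-- Increments the label of the vertex in register 3 and adds it to the bucket of its new label. -/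
def push : Prog :=
  .seq (.write 5 (.reg 3) (.add (.read 5 (.reg 3)) (.const 1))) <|
  .seq (.write 8 (.idx (.read 5 (.reg 3)) (.read 7 (.read 5 (.reg 3)))) (.reg 3)) <|
  .write 7 (.read 5 (.reg 3)) (.add (.read 7 (.read 5 (.reg 3))) (.const 1))

/-- Visits the vertex in register 5, at the level in register 4. Register 6 is an upper bound for
the labels of the unvisited vertices. -/
def visit : Prog :=
  .seq (.write 6 (.reg 5) (.reg 4)) <|
  .seq (forNbr 5 push) <|
  .seq (.assign 4 (.add (.reg 4) (.const 1))) <|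
  .assign 6 (.add (.reg 6) (.const 1))

/-- Prepares a search: nothing is visited, and bucket 0 contains all vertices. -/
def initSearch : Prog :=
  .seq (.forUpTo 3 (.reg 0)
    (.seq (.write 5 (.reg 3) (.const 0)) <|
      .seq (.write 6 (.reg 3) (.reg 0)) <|
      .seq (.write 7 (.reg 3) (.const 0)) <|
      .write 8 (.reg 3) (.reg 3))) <|
  .seq (.write 7 (.reg 0) (.const 0)) <|
  .seq (.write 7 (.const 0) (.reg 0)) <|
  .seq (.assign 4 (.const 0)) <|
  .assign 6 (.const 0)

/-- One step of a search: below the level in register 7 it repeats the order in array 9; above it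
visits the last vertex of the highest bucket, unless that entry is outdated. -/
def searchStep : Prog :=
  .ite (.lt (.reg 4) (.reg 7))
    (.seq (.assign 5 (.read 9 (.reg 4))) visit) <|
  .ite (.eq (.read 7 (.reg 6)) (.const 0))
    (.assign 6 (.sub (.reg 6) (.const 1))) <|
  .seq (.write 7 (.reg 6) (.sub (.read 7 (.reg 6)) (.const 1))) <|
  .seq (.assign 5 (.read 8 (.idx (.reg 6) (.read 7 (.reg 6))))) <|
  .ite (.eq (.read 6 (.reg 5)) (.reg 0))
    (.ite (.eq (.read 5 (.reg 5)) (.reg 6))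
      (.seq (.write 9 (.reg 4) (.reg 5)) (.seq (.write 10 (.reg 4) (.const 0)) visit))
      .skip)
    .skip

/-- A maximum cardinality search that starts with the vertices of array 9 below the level in
register 7. -/
def search : Prog :=
  .seq initSearch (.loop (.lt (.reg 4) (.reg 0)) searchStep)

/-- Outputs the orientation of the graph along the visiting order. -/
def output : Prog :=
  .seq (.assign 2 (.const 0)) <|
  .loop (.lt (.reg 2) (.reg 1)) <|
  .seq (.assign 3 (.read 0 (.reg 2))) <|
  .seq (.assign 8 (.read 1 (.reg 2))) <|
  .seq (.ite (.eq (.read 2 (.idx (.reg 8) (.reg 3))) (.const 1))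
    (.ite (.lt (.read 6 (.reg 3)) (.read 6 (.reg 8)))
      (.seq (.emit (.reg 3)) (.emit (.reg 8)))
      .skip)
    (.seq (.emit (.reg 3)) (.emit (.reg 8)))) <|
  .assign 2 (.add (.reg 2) (.const 1))

/-- Adds the vertex in register 3 to the list of alternatives at the level in register 4. -/
def addAlternative : Prog :=
  .seq (.write 11 (.idx (.reg 4) (.reg 9)) (.reg 3)) <|
  .seq (.write 12 (.reg 3) (.reg 9)) <|
  .assign 9 (.add (.reg 9) (.const 1))

/-- Adds the vertex in register 3 to the list of alternatives if it is one and is not there. -/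
def tryAlternative : Prog :=
  .ite (.eq (.read 6 (.reg 3)) (.reg 0))
    (.ite (.eq (.read 5 (.reg 3)) (.read 5 (.reg 5)))
      (.ite (.lt (.read 12 (.reg 3)) (.reg 9))
        (.ite (.eq (.read 11 (.idx (.reg 4) (.read 12 (.reg 3)))) (.reg 3))
          .skip
          addAlternative)
        addAlternative)
      .skip)
    .skip

/-- Lists the alternatives for the vertex in register 5 at the level in register 4 by a breadth
first search. -/
def listAlternatives : Prog :=
  .seq (.write 11 (.idx (.reg 4) (.const 0)) (.reg 5)) <|
  .seq (.write 12 (.reg 5) (.const 0)) <|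
  .seq (.assign 9 (.const 1)) <|
  .seq (.assign 10 (.const 0)) <|
  .seq (.loop (.lt (.reg 10) (.reg 9)) <|
    .seq (.assign 11 (.read 11 (.idx (.reg 4) (.reg 10)))) <|
    .seq (forNbr 11 tryAlternative) <|
    .assign 10 (.add (.reg 10) (.const 1))) <|
  .write 10 (.reg 4) (.reg 9)

/-- Takes back the last visit. -/
def unvisit : Prog :=
  .seq (.assign 4 (.sub (.reg 4) (.const 1))) <|
  .seq (.assign 5 (.read 9 (.reg 4))) <|
  .seq (.write 6 (.reg 5) (.reg 0)) <|
  forNbr 5 (.write 5 (.reg 3) (.sub (.read 5 (.reg 3)) (.const 1)))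

/-- If an alternative at the level in register 4 is left, it becomes the choice at this level. -/
def nextAlternative : Prog :=
  .ite (.lt (.const 1) (.read 10 (.reg 4)))
    (.seq (.write 10 (.reg 4) (.sub (.read 10 (.reg 4)) (.const 1))) <|
      .seq (.write 9 (.reg 4) (.read 11 (.idx (.reg 4) (.read 10 (.reg 4))))) <|
      .seq (.assign 7 (.add (.reg 4) (.const 1))) <|
      .assign 14 (.const 1))
    .skip

/-- Goes up in the search tree until an alternative is found; register 14 says whether there is
one. -/
def backtrack : Prog :=
  .seq (.assign 14 (.const 0)) <|
  .loop (.lt (.const 0) (.mul (.reg 4) (.sub (.const 1) (.reg 14)))) <|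
  .seq unvisit <|
  .seq (.ite (.eq (.read 10 (.reg 4)) (.const 0)) listAlternatives .skip)
  nextAlternative

/-- Builds the adjacency matrix of the graph and the adjacency lists of its undirected edges. -/
def prepare : Prog :=
  .seq (.assign 13 (.add (.add (.reg 0) (.reg 1)) (.const 1))) <|
  .seq (.forUpTo 2 (.reg 1)
    (.write 2 (.idx (.read 0 (.reg 2)) (.read 1 (.reg 2))) (.const 1))) <|
  .seq (.forUpTo 2 (.reg 1) <|
    .seq (.assign 3 (.read 0 (.reg 2))) <|
    .seq (.assign 8 (.read 1 (.reg 2))) <|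
    .ite (.eq (.read 2 (.idx (.reg 8) (.reg 3))) (.const 1))
      (.seq (.write 3 (.idx (.reg 3) (.read 4 (.reg 3))) (.reg 8))
        (.write 4 (.reg 3) (.add (.read 4 (.reg 3)) (.const 1))))
      .skip)
  (.assign 14 (.const 1))

/-- The enumeration algorithm. Registers: 0 number `n` of vertices, 1 length of the input list,
2 position in this list, 3 and 8 its components or a neighbour, 4 level in the search tree,
5 current vertex, 6 bound for the labels, 7 level up to which the order is prescribed, 9 and 10
length and head of the queue of alternatives, 11 vertex of the queue, 12 position in an adjacency
list, 13 row length of tables, 14 whether to continue. Arrays: 0 and 1 input, 2 adjacency matrix,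
3 and 4 adjacency lists of the undirected edges and their lengths, 5 labels, 6 visiting order
(`n` for unvisited vertices), 7 and 8 sizes and entries of the buckets, 9 vertex visited at each
level, 10 and 11 numbers and lists of alternatives left at each level, starting with a used one
(number 0: not determined yet), 12 position in the current list of alternatives. -/
def enumerate : Prog :=
  .seq prepare <|
  .loop (.eq (.reg 14) (.const 1)) <|
  .seq search (.seq output (.seq .mark backtrack))

/-! ### Tables in memory -/

section Tables

variable {n W : ℕ}

/-- The row length of tables. -/
def width (L : List (Fin n × Fin n)) : ℕ := n + L.length + 1

/-- The words are large enough for all positions in tables. -/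
def LargeWords (L : List (Fin n × Fin n)) (W : ℕ) : Prop := (n + 2) * width L + 2 ≤ W

variable {L : List (Fin n × Fin n)}

theorem LargeWords.idx_lt (hW : LargeWords L W) {a b : ℕ} (ha : a ≤ n) (hb : b < width L) :
    a * width L + b < W := by
  unfold LargeWords at hW
  have h1 := Nat.mul_le_mul_right (width L) ha
  have h2 := Nat.add_mul n 2 (width L)
  omega

theorem LargeWords.width_lt (hW : LargeWords L W) : 2 * width L + 2 ≤ W := by
  unfold LargeWords at hW
  have h2 := Nat.add_mul n 2 (width L)
  omega

theorem idx_inj {w a b a' b' : ℕ} (hb : b < w) (hb' : b' < w) :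
    a * w + b = a' * w + b' ↔ a = a' ∧ b = b' := by
  refine ⟨fun h => ?_, fun h => by rw [h.1, h.2]⟩
  have h1 : (a * w + b) / w = (a' * w + b') / w := by rw [h]
  rw [mul_comm a, mul_comm a', Nat.mul_add_div (by omega), Nat.mul_add_div (by omega),
    Nat.div_eq_of_lt hb, Nat.div_eq_of_lt hb'] at h1
  obtain rfl : a = a' := h1
  exact ⟨rfl, by omega⟩

theorem Expr.eval_idx {s : Store} {e f : Expr} {a b : ℕ} (hW : LargeWords L W)
    (h13 : s.reg 13 = width L) (ha : a ≤ n) (hb : b < width L) (he : e.eval W s = a)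
    (hf : f.eval W s = b) : (Expr.idx e f).eval W s = a * width L + b := by
  have := hW.idx_lt ha hb
  simp only [Expr.idx, Expr.eval, he, hf, h13]
  rw [Nat.mod_eq_of_lt (by omega : a * width L < W), Nat.mod_eq_of_lt this]

theorem LargeWords.eval_const (hW : LargeWords L W) {s : Store} {c : ℕ} (hc : c ≤ 1) :
    (Expr.const c).eval W s = c := by
  have := hW.width_lt
  unfold width at this
  exact Nat.mod_eq_of_lt (by omega)

theorem LargeWords.eval_succ (hW : LargeWords L W) {s : Store} {e : Expr} {a : ℕ}
    (he : e.eval W s = a) (ha : a ≤ width L) : (Expr.add e (.const 1)).eval W s = a + 1 := by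
  have := hW.width_lt
  simp only [Expr.eval, he]
  rw [Nat.mod_eq_of_lt (by omega : 1 < W), Nat.mod_eq_of_lt (by omega)]

theorem LargeWords.eval_pred (hW : LargeWords L W) {s : Store} {e : Expr} {a : ℕ}
    (he : e.eval W s = a) : (Expr.sub e (.const 1)).eval W s = a - 1 := by
  have := hW.width_lt
  simp only [Expr.eval, he]
  rw [Nat.mod_eq_of_lt (by omega : 1 < W)]

/-- The store contains the graph with the list `L` of arcs, and the adjacency lists `nb`. -/
structure GraphStore (L : List (Fin n × Fin n)) (nb : Fin n → List (Fin n)) (s : Store) : Prop where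
  reg0 : s.reg 0 = n
  reg1 : s.reg 1 = L.length
  reg13 : s.reg 13 = width L
  src : ∀ j, (h : j < L.length) → s.arr 0 j = L[j].1
  dst : ∀ j, (h : j < L.length) → s.arr 1 j = L[j].2
  mat : ∀ u v : Fin n, s.arr 2 (u * width L + v) = 1 ↔ (u, v) ∈ L
  nbr : ∀ u : Fin n, ∀ j, (h : j < (nb u).length) → s.arr 3 (u * width L + j) = (nb u)[j]
  deg : ∀ u : Fin n, s.arr 4 u = (nb u).length

variable {nb : Fin n → List (Fin n)}

theorem GraphStore.congr {s s' : Store} (h : GraphStore L nb s)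
    (h1 : ∀ x ∈ [0, 1, 13], s'.reg x = s.reg x) (h2 : ∀ a ∈ [0, 1, 2, 3, 4], s'.arr a = s.arr a) :
    GraphStore L nb s' := by
  constructor
  · rw [h1 0 (by simp)]; exact h.reg0
  · rw [h1 1 (by simp)]; exact h.reg1
  · rw [h1 13 (by simp)]; exact h.reg13
  · rw [h2 0 (by simp)]; exact h.src
  · rw [h2 1 (by simp)]; exact h.dst
  · rw [h2 2 (by simp)]; exact h.mat
  · rw [h2 3 (by simp)]; exact h.nbr
  · rw [h2 4 (by simp)]; exact h.deg

theorem GraphStore.frame {s s' : Store} {p : Prog} (h : GraphStore L nb s) (hf : Frame p s s')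
    (h1 : ∀ x ∈ [0, 1, 13], x ∉ p.regs) (h2 : ∀ a ∈ [0, 1, 2, 3, 4], a ∉ p.arrs) :
    GraphStore L nb s' :=
  h.congr (fun x hx => hf.1 x (h1 x hx)) fun a ha => hf.2 a (h2 a ha)

theorem GraphStore.setReg {s : Store} {x v : ℕ} (h : GraphStore L nb s)
    (hx : x ∉ [0, 1, 13]) : GraphStore L nb (s.setReg x v) :=
  h.congr (fun y hy => by
    have : y ≠ x := fun e => hx (e ▸ hy)
    simp [this]) fun _ _ => rfl

theorem GraphStore.setArr {s : Store} {a i v : ℕ} (h : GraphStore L nb s) (ha : 5 ≤ a) :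
    GraphStore L nb (s.setArr a i v) :=
  h.congr (fun _ _ => rfl) fun b hb => by
    have : b ≠ a := by
      simp only [List.mem_cons, List.not_mem_nil, or_false] at hb
      omega
    simp [this]

/-- The rule for loops over the neighbours of `v`; the invariant `I l` refers to the list `l` of the
neighbours that have been treated. -/
theorem Runs.forNbr {p : Prog} {x T : ℕ} (I : List (Fin n) → Store → Prop) (hW : LargeWords L W)
    {s : Store} (hs : GraphStore L nb s) {v : Fin n} (hx : s.reg x = v) (hnd : (nb v).Nodup)
    (h12 : 12 ∉ p.regs) (hxp : x ∉ (forNbr x p).regs)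
    (h1 : ∀ y ∈ [0, 1, 13], y ∉ (MarkovEnum.forNbr x p).regs)
    (h2 : ∀ a ∈ [0, 1, 2, 3, 4], a ∉ (MarkovEnum.forNbr x p).arrs)
    (hst : ∀ l s a, I l s → I l (s.setReg 12 a))
    (hst' : ∀ l s a, I l s → I l (s.setReg 3 a))
    (hbody : ∀ l (y : Fin n) l', nb v = l ++ y :: l' → ∀ s',
      Frame (MarkovEnum.forNbr x p) s s' → I l s' → s'.reg 3 = y →
      Runs W p s' fun s'' t => I (l ++ [y]) s'' ∧ t ≤ T)
    (h0 : I [] s) :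
    Runs W (forNbr x p) s fun s' t => I (nb v) s' ∧ t ≤ (nb v).length * (T + 15) + 6 := by
  have hlen : (nb v).length ≤ n := hnd.length_le_card.trans (by simp)
  have hww := hW.width_lt
  have hw : n < width L := by unfold width; omega
  refine (Runs.forUpTo (fun i s' => I ((nb v).take i) s') (N := (nb v).length) (T := T + 7)
    (by omega) ?_ ?_ ?_ (hst _ _ _ h0)).mono ?_
  · simpa [Prog.regs] using h12
  · intro i s' _ hf _ _
    have hs' := hs.frame hf h1 h2
    simp only [Expr.eval, (hf.1 x hxp).trans hx, hs'.deg]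
  · intro i s' hi hf hI hr
    have hs' := hs.frame hf h1 h2
    refine .seq (.assign (v := (nb v)[i]) ?_ ?_)
    · simp only [Expr.eval]
      rw [Expr.eval_idx (a := v) (b := i) hW hs'.reg13 v.2.le (by omega)
        (by simp only [Expr.eval, (hf.1 x hxp).trans hx]) (by simp only [Expr.eval, hr]),
        hs'.nbr v i hi]
    · have hsplit : nb v = (nb v).take i ++ (nb v)[i] :: (nb v).drop (i + 1) := by
        rw [← List.drop_eq_getElem_cons, List.take_append_drop]
      refine (hbody _ _ _ hsplit _ (hf.trans ?_) (hst' _ _ _ hI) (by simp)).mono ?_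
      · refine ⟨fun y hy => ?_, fun _ _ => rfl⟩
        have : y ≠ 3 := by
          rintro rfl
          exact hy (by simp [Prog.forUpTo, Prog.regs])
        simp [this]
      · rintro s'' t ⟨h3, h4⟩
        refine ⟨hst _ _ _ ?_, ?_⟩
        · rwa [List.take_succ_eq_append_getElem hi]
        · simp only [Expr.cost, Expr.idx]
          omega
  · rintro s' t ⟨h3, -, h4⟩
    rw [List.take_length] at h3
    refine ⟨h3, ?_⟩
    simp only [Expr.cost] at h4
    rw [show T + 7 + (1 + 1) + 6 = T + 15 by omega] at h4
    omega

/-- Every unvisited vertex (those satisfying `P`) is in the bucket of its label `f`, and the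
buckets have `T` entries altogether. They may contain outdated entries. -/
structure Buckets (w : ℕ) (s : Store) (f : Fin n → ℕ) (P : Fin n → Prop) (T : ℕ) : Prop where
  entry : ∀ ℓ j, ℓ ≤ n → j < s.arr 7 ℓ → ∃ v : Fin n, s.arr 8 (ℓ * w + j) = v
  mem : ∀ u, P u → f u ≤ n ∧ ∃ j, j < s.arr 7 (f u) ∧ s.arr 8 (f u * w + j) = u
  total : ∑ ℓ ∈ Finset.range (n + 1), s.arr 7 ℓ = T

theorem Buckets.le_total {w : ℕ} {s : Store} {f : Fin n → ℕ} {P : Fin n → Prop} {T : ℕ}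
    (h : Buckets w s f P T) {ℓ : ℕ} (hℓ : ℓ ≤ n) : s.arr 7 ℓ ≤ T := by
  rw [← h.total]
  exact Finset.single_le_sum (f := s.arr 7) (fun _ _ => Nat.zero_le _) (by simp; omega)

theorem Buckets.congr {w : ℕ} {s s' : Store} {f : Fin n → ℕ} {P P' : Fin n → Prop} {T : ℕ}
    (h : Buckets w s f P T) (h7 : s'.arr 7 = s.arr 7) (h8 : s'.arr 8 = s.arr 8)
    (hP : ∀ u, P' u → P u) : Buckets w s' f P' T := by
  constructor
  · rw [h7, h8]; exact h.entry
  · rw [h7, h8]; exact fun u hu => h.mem u (hP u hu)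
  · rw [h7]; exact h.total

theorem sum_update {m ℓ a : ℕ} (c : ℕ → ℕ) (hℓ : ℓ ∈ Finset.range m) :
    ∑ i ∈ Finset.range m, Function.update c ℓ a i + c ℓ = ∑ i ∈ Finset.range m, c i + a := by
  rw [Finset.sum_update_of_mem hℓ, Finset.sum_eq_add_sum_sdiff_singleton_of_mem hℓ c]
  omega

/-- The effect of incrementing the label of `y`; its old entry stays where it is and becomes
outdated. -/
theorem Buckets.push {w : ℕ} {s s' : Store} {f : Fin n → ℕ} {P : Fin n → Prop} {T : ℕ}
    (h : Buckets w s f P T) {y : Fin n} (hf : f y + 1 ≤ n) (hT : T < w)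
    (h7 : s'.arr 7 = Function.update (s.arr 7) (f y + 1) (s.arr 7 (f y + 1) + 1))
    (h8 : s'.arr 8 = Function.update (s.arr 8) ((f y + 1) * w + s.arr 7 (f y + 1)) y) :
    Buckets w s' (Function.update f y (f y + 1)) P (T + 1) := by
  have hlt : ∀ {ℓ}, ℓ ≤ n → s.arr 7 ℓ < w := fun hℓ => (h.le_total hℓ).trans_lt hT
  have hold : ∀ ℓ j, ℓ ≤ n → j < s.arr 7 ℓ →
      j < s'.arr 7 ℓ ∧ s'.arr 8 (ℓ * w + j) = s.arr 8 (ℓ * w + j) := by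
    intro ℓ j hℓ hj
    constructor
    · rw [h7, Function.update_apply]
      split_ifs with h1
      · subst h1; omega
      · exact hj
    · rw [h8, Function.update_of_ne]
      rw [Ne, idx_inj (hj.trans (hlt hℓ)) (hlt hf)]
      rintro ⟨rfl, rfl⟩
      exact lt_irrefl _ hj
  have hnew : s.arr 7 (f y + 1) < s'.arr 7 (f y + 1) ∧
      s'.arr 8 ((f y + 1) * w + s.arr 7 (f y + 1)) = y := by
    rw [h7, h8]
    simp
  refine ⟨fun ℓ j hℓ hj => ?_, fun u hu => ?_, ?_⟩
  · by_cases h1 : j < s.arr 7 ℓ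
    · rw [(hold ℓ j hℓ h1).2]
      exact h.entry ℓ j hℓ h1
    · rw [h7, Function.update_apply] at hj
      split_ifs at hj with h2
      · subst h2
        obtain rfl : j = s.arr 7 (f y + 1) := by omega
        exact ⟨y, hnew.2⟩
      · exact (h1 hj).elim
  · by_cases h1 : u = y
    · subst h1
      rw [Function.update_self]
      exact ⟨hf, _, hnew⟩
    · rw [Function.update_of_ne h1]
      obtain ⟨h2, j, h3, h4⟩ := h.mem u hu
      exact ⟨h2, j, (hold _ _ h2 h3).1, (hold _ _ h2 h3).2.trans h4⟩
  · have := sum_update (m := n + 1) (a := s.arr 7 (f y + 1) + 1) (s.arr 7)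
      (Finset.mem_range.2 (by omega : f y + 1 < n + 1))
    rw [h7]
    have := h.total
    omega

/-- The effect of removing the last entry of the bucket `k`, provided that it is outdated or of no
interest any more. -/
theorem Buckets.pop {w : ℕ} {s s' : Store} {f : Fin n → ℕ} {P P' : Fin n → Prop} {T k : ℕ}
    (h : Buckets w s f P T) (hk : k ≤ n) (hpos : 0 < s.arr 7 k)
    (h7 : s'.arr 7 = Function.update (s.arr 7) k (s.arr 7 k - 1))
    (h8 : s'.arr 8 = s.arr 8)
    (hP : ∀ u, P' u → P u ∧ ¬ (f u = k ∧ s.arr 8 (k * w + (s.arr 7 k - 1)) = u)) :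
    Buckets w s' f P' (T - 1) := by
  refine ⟨fun ℓ j hℓ hj => ?_, fun u hu => ?_, ?_⟩
  · rw [h8]
    refine h.entry ℓ j hℓ ?_
    rw [h7, Function.update_apply] at hj
    split_ifs at hj with h1
    · subst h1; omega
    · exact hj
  · obtain ⟨h1, h2⟩ := hP u hu
    obtain ⟨h3, j, h4, h5⟩ := h.mem u h1
    refine ⟨h3, j, ?_, by rw [h8, h5]⟩
    rw [h7, Function.update_apply]
    split_ifs with h6
    · rw [h6] at h4 h5
      have : j ≠ s.arr 7 k - 1 := by
        rintro rfl
        exact h2 ⟨h6, h5⟩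
      omega
    · exact h4
  · have := sum_update (m := n + 1) (a := s.arr 7 k - 1) (s.arr 7)
      (Finset.mem_range.2 (by omega : k < n + 1))
    rw [h7]
    have := h.total
    have := h.le_total hk
    omega

theorem runs_push (hW : LargeWords L W) {s : Store} {f : Fin n → ℕ} {P : Fin n → Prop} {T : ℕ}
    (h13 : s.reg 13 = width L) (hb : Buckets (width L) s f P T)
    (hlab : ∀ v : Fin n, s.arr 5 v = f v) {y : Fin n} (hy : s.reg 3 = y) (hf : f y + 1 ≤ n)
    (hT : T < width L) :
    Runs W push s fun s' t => (Buckets (width L) s' (Function.update f y (f y + 1)) P (T + 1) ∧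
      ∀ v : Fin n, s'.arr 5 v = Function.update f y (f y + 1) v) ∧ t ≤ 30 := by
  have hw : n < width L := by unfold width; omega
  have hle := hb.le_total hf
  refine .seq (.write (j := y) (v := f y + 1) (by simp only [Expr.eval, hy])
    (hW.eval_succ (by simp only [Expr.eval, hy, hlab]) (by omega)) ?_)
  refine .seq (.write (j := (f y + 1) * width L + s.arr 7 (f y + 1)) (v := y)
    (Expr.eval_idx hW (by simpa using h13) hf (by omega) (by simp [Expr.eval, hy])
      (by simp [Expr.eval, hy])) (by simpa [Expr.eval] using hy) ?_)
  refine .write (j := f y + 1) (v := s.arr 7 (f y + 1) + 1) (by simp [Expr.eval, hy])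
    (hW.eval_succ (by simp [Expr.eval, hy]) (by omega)) ⟨⟨?_, ?_⟩, ?_⟩
  · exact hb.push hf hT (by simp) (by simp)
  · intro v
    simp [Function.update_apply, Fin.ext_iff, hlab]
  · simp [Expr.cost, Expr.idx]

end Tables

end MarkovEnum

namespace MarkovEnum

/-! ### Running a search -/

section Search

variable {n W : ℕ} {L : List (Fin n × Fin n)} {nb : Fin n → List (Fin n)}
  {U : Fin n → Fin n → Prop}

/-- `nb` consists of adjacency lists of the graph `U`, whose total length is at most that of `L`. -/
structure AdjLists (L : List (Fin n × Fin n)) (nb : Fin n → List (Fin n))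
    (U : Fin n → Fin n → Prop) : Prop where
  mem : ∀ u v, v ∈ nb u ↔ U u v
  nodup : ∀ u, (nb u).Nodup
  total : ∑ u, (nb u).length ≤ L.length

/-- The number of vertices of `τ` and of the entries of their adjacency lists. -/
def weight (nb : Fin n → List (Fin n)) (τ : List (Fin n)) : ℕ :=
  (τ.map fun v => (nb v).length + 1).sum

@[simp]
theorem weight_concat (τ : List (Fin n)) (x : Fin n) :
    weight nb (τ ++ [x]) = weight nb τ + ((nb x).length + 1) := by
  simp [weight]

@[simp]
theorem weight_nil : weight nb [] = 0 := rfl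

theorem nodup_length_le {τ : List (Fin n)} (h : τ.Nodup) : τ.length ≤ n :=
  h.length_le_card.trans (by simp)

theorem AdjLists.weight_le_length (h : AdjLists L nb U) {τ : List (Fin n)} (hτ : τ.Nodup) :
    weight nb τ ≤ τ.length + L.length := by
  have h1 : weight nb τ = ∑ v ∈ τ.toFinset, ((nb v).length + 1) := by
    rw [List.sum_toFinset _ hτ]
    rfl
  have h2 : ∑ v ∈ τ.toFinset, (nb v).length ≤ ∑ v, (nb v).length :=
    Finset.sum_le_sum_of_subset (Finset.subset_univ _)
  rw [Finset.sum_add_distrib, Finset.sum_const, List.toFinset_card_of_nodup hτ, smul_eq_mul,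
    mul_one] at h1
  have := h.total
  omega

theorem AdjLists.weight_le (h : AdjLists L nb U) {τ : List (Fin n)} (hτ : τ.Nodup) :
    weight nb τ ≤ n + L.length := by
  have := h.weight_le_length hτ
  have := nodup_length_le hτ
  omega

/-- The labels and positions after a search has visited `τ`. -/
structure SearchStore (U : Fin n → Fin n → Prop) (τ : List (Fin n)) (s : Store) : Prop where
  label : ∀ v : Fin n, s.arr 5 v = label U τ v
  pos : ∀ v : Fin n, s.arr 6 v = if v ∈ τ then τ.idxOf v else n

theorem SearchStore.congr {τ : List (Fin n)} {s s' : Store} (h : SearchStore U τ s)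
    (h5 : s'.arr 5 = s.arr 5) (h6 : s'.arr 6 = s.arr 6) : SearchStore U τ s' :=
  ⟨by rw [h5]; exact h.label, by rw [h6]; exact h.pos⟩

theorem SearchStore.pos_eq_iff {τ : List (Fin n)} {s : Store} (h : SearchStore U τ s)
    (hτ : τ.Nodup) (v : Fin n) : s.arr 6 v = n ↔ v ∉ τ := by
  rw [h.pos]
  split_ifs with h1
  · have := List.idxOf_lt_length_iff.2 h1
    have := nodup_length_le hτ
    simp only [h1, not_true_eq_false, iff_false]
    omega
  · simp [h1]

/-- A visit takes time proportional to the degree of the vertex. -/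
theorem runs_visit (hW : LargeWords L W) (hA : AdjLists L nb U) {s : Store} {τ : List (Fin n)}
    {x : Fin n} {T k : ℕ} (hG : GraphStore L nb s) (hS : SearchStore U τ s)
    (hnd : (τ ++ [x]).Nodup) (hb : Buckets (width L) s (label U τ) (· ∉ τ ++ [x]) T)
    (h5 : s.reg 5 = x) (h4 : s.reg 4 = τ.length) (h6 : s.reg 6 = k) (hk : k ≤ τ.length)
    (hT : T + (nb x).length ≤ width L) :
    Runs W visit s fun s' t => SearchStore U (τ ++ [x]) s' ∧
      Buckets (width L) s' (label U (τ ++ [x])) (· ∉ τ ++ [x]) (T + (nb x).length) ∧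
      s'.reg 4 = τ.length + 1 ∧ s'.reg 6 = k + 1 ∧ t ≤ 45 * ((nb x).length + 1) := by
  have hxτ : x ∉ τ := fun h => by
    rw [List.nodup_append] at hnd
    exact hnd.2.2 x h x (by simp) rfl
  have hlen : τ.length + 1 ≤ n := by simpa using nodup_length_le hnd
  have hw : n < width L := by unfold width; omega
  set f : List (Fin n) → Fin n → ℕ := fun l v => label U τ v + if v ∈ l then 1 else 0 with hf
  refine .seq (.write (j := x) (v := τ.length) (by simp [Expr.eval, h5])
    (by simp [Expr.eval, h4]) ?_)
  set s₁ := s.setArr 6 x τ.length with hs₁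
  have hloop := Runs.forNbr (W := W) (p := push) (x := 5) (T := 30) (v := x) (s := s₁)
    (fun l s' => Buckets (width L) s' (f l) (· ∉ τ ++ [x]) (T + l.length) ∧
      ∀ v : Fin n, s'.arr 5 v = f l v) hW (hG.setArr (by omega)) (by simpa [hs₁] using h5)
    (hA.nodup x) (by decide) (by decide) (by decide) (by decide)
    (fun l s a h => ⟨h.1.congr rfl rfl fun _ => id, h.2⟩)
    (fun l s a h => ⟨h.1.congr rfl rfl fun _ => id, h.2⟩)
    (fun l y l' hl s' hfr hI hy => by
      have hyl : y ∉ l := fun h => by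
        have := hl ▸ hA.nodup x
        rw [List.nodup_append] at this
        exact this.2.2 y h y (by simp) rfl
      have hfy : f l y + 1 ≤ n := by
        have := label_le_length U τ y
        simp only [hf, hyl, if_false]
        omega
      have hup : Function.update (f l) y (f l y + 1) = f (l ++ [y]) := by
        ext v
        rw [Function.update_apply]
        split_ifs with h
        · subst h
          simp [hf, hyl]
        · simp [hf, h]
      have hll : l.length < (nb x).length := by
        rw [hl]
        simp
      refine (runs_push hW ?_ hI.1 hI.2 hy hfy (by omega)).mono ?_
      · rw [hfr.1 13 (by decide), hs₁, Store.reg_setArr]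
        exact hG.reg13
      · rintro s'' t ⟨⟨h1, h2⟩, h3⟩
        rw [hup] at h1 h2
        refine ⟨⟨?_, h2⟩, h3⟩
        simpa [add_assoc] using h1)
    ⟨by
      have : f [] = label U τ := by ext v; simp [hf]
      rw [this]
      exact hb.congr (by simp [hs₁]) (by simp [hs₁]) fun _ => id,
     fun v => by simpa [hf, hs₁] using hS.label v⟩
  refine .seq (hloop.frame.mono ?_)
  rintro s₂ t ⟨⟨⟨hb₂, hlab₂⟩, ht⟩, hfr⟩
  have hfx : f (nb x) = label U (τ ++ [x]) := by
    ext v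
    rw [label_concat U hxτ]
    have := hA.mem x v
    by_cases h : U x v
    · simp [hf, h, this.2 h]
    · have h' : v ∉ nb x := mt this.1 h
      simp [hf, h, h']
  rw [hfx] at hb₂ hlab₂
  have h4' : s₂.reg 4 = τ.length := (hfr.1 4 (by decide)).trans (by simpa [hs₁] using h4)
  have h6' : s₂.reg 6 = k := (hfr.1 6 (by decide)).trans (by simpa [hs₁] using h6)
  refine .seq (.assign (v := τ.length + 1) (hW.eval_succ (by simp [Expr.eval, h4']) (by omega)) ?_)
  refine .assign (v := k + 1) (hW.eval_succ (by simp [Expr.eval, h6']) (by omega)) ?_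
  refine ⟨⟨?_, ?_⟩, hb₂.congr rfl rfl fun _ => id, by simp, by simp, ?_⟩
  · simpa using hlab₂
  · intro v
    have h7 : s₂.arr 6 = s₁.arr 6 := hfr.2 6 (by decide)
    simp only [Store.arr_setReg, h7, hs₁, Store.arr_setArr, if_true, Function.update_apply,
      ← Fin.ext_iff, hS.pos, List.mem_append, List.mem_singleton]
    by_cases hvx : v = x
    · subst hvx
      simp [List.idxOf_append_of_notMem hxτ]
    · by_cases hvτ : v ∈ τ
      · simp [hvx, hvτ, List.idxOf_append_of_mem hvτ]
      · simp [hvx, hvτ]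
  · simp only [Expr.cost]
    omega

theorem runs_initSearch (hW : LargeWords L W) {s : Store} (hG : GraphStore L nb s) :
    Runs W initSearch s fun s' t => SearchStore U [] s' ∧
      Buckets (width L) s' (label U []) (· ∉ ([] : List (Fin n))) n ∧
      s'.reg 4 = 0 ∧ s'.reg 6 = 0 ∧ t ≤ 40 * (n + 1) := by
  have hww := hW.width_lt
  have hw : n < width L := by unfold width; omega
  have hc : ∀ s : Store, (Expr.const 0).eval W s = 0 := fun s => hW.eval_const (by omega)
  have hloop := Runs.forUpTo (W := W) (j := 3) (e := .reg 0) (N := n) (T := 20) (s := s)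
    (p := .seq (.write 5 (.reg 3) (.const 0)) <|
      .seq (.write 6 (.reg 3) (.reg 0)) <|
      .seq (.write 7 (.reg 3) (.const 0)) <|
      .write 8 (.reg 3) (.reg 3))
    (fun i s' => ∀ j, j < i → s'.arr 5 j = 0 ∧ s'.arr 6 j = n ∧ s'.arr 7 j = 0 ∧ s'.arr 8 j = j)
    (by omega) (by decide)
    (fun i s' _ hf _ _ => by simp only [Expr.eval, hf.1 0 (by decide), hG.reg0])
    (fun i s' hi hf hI hr => by
      have h0 : s'.reg 0 = n := (hf.1 0 (by decide)).trans hG.reg0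
      refine .seq (.write (j := i) (v := 0) (by simp [Expr.eval, hr]) (hc _) ?_)
      refine .seq (.write (j := i) (v := n) (by simp [Expr.eval, hr]) (by simp [Expr.eval, h0]) ?_)
      refine .seq (.write (j := i) (v := 0) (by simp [Expr.eval, hr]) (hc _) ?_)
      refine .write (j := i) (v := i) (by simp [Expr.eval, hr]) (by simp [Expr.eval, hr])
        ⟨fun j hj => ?_, by simp [Expr.cost]⟩
      by_cases hji : j = i
      · simp [hji]
      · simpa [Function.update_apply, hji] using hI j (by omega))
    (fun j hj => by omega)
  refine .seq (hloop.frame.mono ?_)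
  rintro s₁ t ⟨⟨hI, -, ht⟩, hfr⟩
  have h0 : s₁.reg 0 = n := (hfr.1 0 (by decide)).trans hG.reg0
  refine .seq (.write (j := n) (v := 0) (by simp [Expr.eval, h0]) (hc _) ?_)
  refine .seq (.write (j := 0) (v := n) (hc _) (by simp [Expr.eval, h0]) ?_)
  refine .seq (.assign (v := 0) (hc _) ?_)
  refine .assign (v := 0) (hc _) ⟨⟨?_, ?_⟩, ⟨?_, ?_, ?_⟩, by simp, by simp, ?_⟩
  · intro v
    simpa [label_nil] using (hI v v.2).1
  · intro v
    simpa using (hI v v.2).2.1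
  · intro ℓ j hℓ hj
    have hℓ0 : ℓ = 0 := by
      by_contra h
      have : s₁.arr 7 ℓ = 0 ∨ ℓ = n := by
        rcases Nat.lt_or_ge ℓ n with h1 | h1
        · exact .inl (hI ℓ h1).2.2.1
        · exact .inr (by omega)
      rcases this with h1 | h1 <;> simp [Function.update_apply, h, h1] at hj
      split_ifs at hj <;> omega
    subst hℓ0
    simp at hj
    exact ⟨⟨j, hj⟩, by simpa using (hI j hj).2.2.2⟩
  · intro u _
    refine ⟨by simp [label_nil], u, by simp [label_nil], ?_⟩
    simpa [label_nil] using (hI u u.2).2.2.2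
  · rw [Finset.sum_eq_single 0]
    · simp
    · intro ℓ hℓ h
      rw [Finset.mem_range] at hℓ
      by_cases h1 : ℓ = n
      · subst h1
        simp [h]
      · simpa [Function.update_apply, h, h1] using (hI ℓ (by omega)).2.2.1
    · simp
  · simp only [Expr.cost] at ht ⊢
    omega

/-- The state of a search that repeats `σ₀` first and has visited `τ`. The array of numbers of
alternatives is that of `c` at the levels of `σ₀`, and reset at the levels above. -/
structure SearchInv (L : List (Fin n × Fin n)) (nb : Fin n → List (Fin n))
    (U : Fin n → Fin n → Prop) (σ₀ : List (Fin n)) (c : ℕ → ℕ) (τ : List (Fin n)) (T k : ℕ)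
    (s : Store) : Prop where
  graph : GraphStore L nb s
  reg7 : s.reg 7 = σ₀.length
  cases : τ <+: σ₀ ∨ σ₀ <+: τ
  search : IsSearch U τ
  store : SearchStore U τ s
  buckets : Buckets (width L) s (label U τ) (· ∉ τ) T
  reg4 : s.reg 4 = τ.length
  reg6 : s.reg 6 = k
  k_le : k ≤ τ.length
  label_le : ∀ u, u ∉ τ → label U τ u ≤ k
  total : T + τ.length ≤ n + weight nb τ
  order₀ : ∀ i, (h : i < σ₀.length) → s.arr 9 i = σ₀[i]
  order : ∀ i, (h : i < τ.length) → s.arr 9 i = τ[i]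
  alt₀ : ∀ i, i < σ₀.length → s.arr 10 i = c i
  alt : ∀ i, σ₀.length ≤ i → i < τ.length → s.arr 10 i = 0

/-- A visit to an admissible vertex `x`, in the store `s'` that is prepared for it, keeps the
invariant of the search. -/
theorem SearchInv.visit (hW : LargeWords L W) (hA : AdjLists L nb U) {σ₀ τ : List (Fin n)}
    {c : ℕ → ℕ} {T T' k : ℕ} {s s' : Store} {x : Fin n} (h : SearchInv L nb U σ₀ c τ T k s)
    (hx : IsNext U τ x) (hcases : τ ++ [x] <+: σ₀ ∨ σ₀ <+: τ ++ [x])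
    (hreg : ∀ y, y ≠ 5 → s'.reg y = s.reg y) (h5 : s'.reg 5 = x)
    (harr : ∀ a ∈ [0, 1, 2, 3, 4, 5, 6], s'.arr a = s.arr a)
    (hb : Buckets (width L) s' (label U τ) (· ∉ τ ++ [x]) T') (hT : T' ≤ T)
    (h9 : ∀ i, i ≠ τ.length → s'.arr 9 i = s.arr 9 i) (h9' : s'.arr 9 τ.length = x)
    (h10 : ∀ i, i ≠ τ.length → s'.arr 10 i = s.arr 10 i)
    (h10' : s'.arr 10 τ.length = if τ.length < σ₀.length then c τ.length else 0) :
    Runs W visit s' fun s'' t =>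
      SearchInv L nb U σ₀ c (τ ++ [x]) (T' + (nb x).length) (k + 1) s'' ∧
        t ≤ 45 * ((nb x).length + 1) := by
  have hs : IsSearch U (τ ++ [x]) := isSearch_concat.2 ⟨h.search, hx⟩
  have hG : GraphStore L nb s' := h.graph.congr
    (fun y hy => hreg y (by simp only [List.mem_cons, List.not_mem_nil, or_false] at hy; omega))
    fun a ha => harr a (by
      simp only [List.mem_cons, List.not_mem_nil, or_false] at ha ⊢
      omega)
  have htot := hA.weight_le_length hs.nodup
  have := h.total
  rw [weight_concat, List.length_append, List.length_singleton] at htot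
  refine (runs_visit hW hA hG (h.store.congr (harr 5 (by simp)) (harr 6 (by simp))) hs.nodup hb h5
    ((hreg 4 (by omega)).trans h.reg4) ((hreg 6 (by omega)).trans h.reg6) h.k_le ?_).frame.mono ?_
  · unfold width
    omega
  rintro s'' t ⟨⟨h1, h2, h3, h4, h5⟩, hf⟩
  have h9f : s''.arr 9 = s'.arr 9 := hf.2 9 (by decide)
  have h10f : s''.arr 10 = s'.arr 10 := hf.2 10 (by decide)
  refine ⟨⟨hG.frame hf (by decide) (by decide), ?_, hcases, hs, h1, h2, by simpa using h3, h4,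
    ?_, ?_, ?_, ?_, ?_, ?_, ?_⟩, h5⟩
  · rw [hf.1 7 (by decide), hreg 7 (by omega), h.reg7]
  · simpa using h.k_le
  · intro u hu
    rw [label_concat U hx.1]
    have := h.label_le u fun h' => hu (by simp [h'])
    split_ifs <;> omega
  · rw [weight_concat, List.length_append, List.length_singleton]
    omega
  · intro i hi
    rw [h9f]
    by_cases hiτ : i = τ.length
    · subst hiτ
      rw [h9']
      rcases hcases with h6 | h6
      · rw [← h6.getElem (by simp)]
        simp
      · have := h6.length_le
        rw [h6.getElem hi]
        simp
    · rw [h9 i hiτ]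
      exact h.order₀ i hi
  · intro i hi
    rw [h9f]
    by_cases hiτ : i = τ.length
    · subst hiτ
      rw [h9']
      simp
    · have hi' : i < τ.length := by
        simp only [List.length_append, List.length_singleton] at hi
        omega
      rw [h9 i hiτ, List.getElem_append_left hi']
      exact h.order i hi'
  · intro i hi
    rw [h10f]
    by_cases hiτ : i = τ.length
    · subst hiτ
      rw [h10', if_pos hi]
    · rw [h10 i hiτ, h.alt₀ i hi]
  · intro i hi hi'
    rw [h10f]
    by_cases hiτ : i = τ.length
    · subst hiτ
      rw [h10', if_neg (by omega)]
    · simp only [List.length_append, List.length_singleton] at hi'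
      rw [h10 i hiτ]
      exact h.alt i hi (by omega)

/-- The potential of a search: it pays for the vertices still to be visited, for the entries of
the buckets, and for the highest bucket. -/
def searchPotential (L : List (Fin n × Fin n)) (nb : Fin n → List (Fin n)) (τ : List (Fin n))
    (T k : ℕ) : ℕ :=
  200 * (n + L.length - weight nb τ) + 60 * T + 60 * k

/-- Every step of a search is paid for by the potential: a visit by the vertex and its adjacency
list, the removal of an outdated entry by this entry, and a step to a lower bucket by the bound on
the labels. -/
theorem runs_searchStep (hW : LargeWords L W) (hA : AdjLists L nb U) {σ₀ τ : List (Fin n)}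
    (hσ₀ : IsSearch U σ₀) {c : ℕ → ℕ} {T k : ℕ} {s : Store} (h : SearchInv L nb U σ₀ c τ T k s)
    (hτ : τ.length < n) :
    Runs W searchStep s fun s' t => ∃ τ' T' k', SearchInv L nb U σ₀ c τ' T' k' s' ∧
      t + 3 + searchPotential L nb τ' T' k' ≤ searchPotential L nb τ T k := by
  have hww := hW.width_lt
  have hw : width L = n + L.length + 1 := rfl
  have htot := h.total
  have hwle := hA.weight_le_length h.search.nodup
  have hpay : ∀ x T', IsSearch U (τ ++ [x]) → T' ≤ T → ∀ t, t ≤ 45 * ((nb x).length + 1) + 50 →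
      t + 3 + searchPotential L nb (τ ++ [x]) (T' + (nb x).length) (k + 1) ≤
        searchPotential L nb τ T k := by
    intro x T' hx hT t ht
    have := hA.weight_le hx.nodup
    rw [weight_concat] at this
    unfold searchPotential
    rw [weight_concat]
    omega
  refine .ite (fun hlt => ?_) fun hlt => ?_
  · simp only [Test.Holds, Expr.eval, h.reg4, h.reg7] at hlt
    have hpre : τ <+: σ₀ := by
      rcases h.cases with h1 | h1
      · exact h1
      · have := h1.length_le
        omega
    have hpre' : τ ++ [σ₀[τ.length]] <+: σ₀ := by
      have h1 : σ₀.take (τ.length + 1) = τ ++ [σ₀[τ.length]] := by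
        rw [List.take_succ_eq_append_getElem hlt, ← List.prefix_iff_eq_take.1 hpre]
      rw [← h1]
      exact List.take_prefix _ _
    refine .seq (.assign (v := σ₀[τ.length])
      (by simp only [Expr.eval, h.reg4]; exact h.order₀ _ hlt) ?_)
    refine (h.visit hW hA (hσ₀ _ _ hpre') (.inl hpre') (T' := T)
      (s' := s.setReg 5 σ₀[τ.length]) (fun y hy => by simp [hy])
      (by simp) (fun _ _ => rfl) (h.buckets.congr rfl rfl fun u hu h' => hu (by simp [h'])) le_rfl
      (fun _ _ => rfl) (by simpa using h.order₀ _ hlt) (fun _ _ => rfl) ?_).mono ?_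
    · rw [if_pos hlt]
      exact h.alt₀ _ hlt
    · rintro s' t ⟨h1, h2⟩
      refine ⟨_, _, _, h1, hpay _ _ h1.search le_rfl _ ?_⟩
      simp only [Expr.cost, Test.cost]
      omega
  simp only [Test.Holds, Expr.eval, h.reg4, h.reg7, not_lt] at hlt
  have hsuf : σ₀ <+: τ := by
    rcases h.cases with h1 | h1
    · rw [h1.eq_of_length (by have := h1.length_le; omega)]
    · exact h1
  have hkn : k ≤ n := by have := h.k_le; omega
  refine .ite (fun hz => ?_) fun hz => ?_
  · simp only [Test.Holds, hW.eval_const (Nat.zero_le 1)] at hz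
    simp only [Expr.eval, h.reg6] at hz
    have hlab : ∀ u, u ∉ τ → label U τ u < k := by
      intro u hu
      refine lt_of_le_of_ne (h.label_le u hu) fun heq => ?_
      obtain ⟨-, j, h1, -⟩ := h.buckets.mem u hu
      rw [heq] at h1
      omega
    obtain ⟨u, hu⟩ : ∃ u, u ∉ τ := by
      by_contra hcon
      push Not at hcon
      have h1 : Finset.univ ⊆ τ.toFinset := fun v _ => by simpa using hcon v
      have := (Finset.card_le_card h1).trans (List.toFinset_card_le τ)
      simp at this
      omega
    have hkpos := hlab u hu
    refine .assign (v := k - 1) (hW.eval_pred (by simp [Expr.eval, h.reg6])) ?_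
    refine ⟨τ, T, k - 1, ⟨h.graph.setReg (by simp), by simpa using h.reg7, h.cases, h.search,
      h.store.congr rfl rfl, h.buckets.congr rfl rfl fun _ => id, by simpa using h.reg4, by simp,
      by have := h.k_le; omega, fun u hu => by have := hlab u hu; omega, h.total, h.order₀, h.order,
      h.alt₀, h.alt⟩, ?_⟩
    simp only [Expr.cost, Test.cost, searchPotential]
    omega
  simp only [Test.Holds, hW.eval_const (Nat.zero_le 1)] at hz
  simp only [Expr.eval, h.reg6] at hz
  have hcT := h.buckets.le_total hkn
  obtain ⟨x, hx⟩ := h.buckets.entry k (s.arr 7 k - 1) hkn (by omega)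
  refine .seq (.write (j := k) (v := s.arr 7 k - 1) (by simp [Expr.eval, h.reg6])
    (hW.eval_pred (by simp [Expr.eval, h.reg6])) ?_)
  refine .seq (.assign (v := x) ?_ ?_)
  · simp only [Expr.eval]
    rw [Expr.eval_idx (a := k) (b := s.arr 7 k - 1) hW (by simpa using h.graph.reg13) hkn (by omega)
      (by simp [Expr.eval, h.reg6]) (by simp [Expr.eval, h.reg6])]
    simpa using hx
  set s₁ := (s.setArr 7 k (s.arr 7 k - 1)).setReg 5 x with hs₁
  have hb₁ : ∀ P' : Fin n → Prop, (∀ u, P' u → u ∉ τ ∧ ¬ (label U τ u = k ∧ x = u)) →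
      Buckets (width L) s₁ (label U τ) P' (T - 1) := fun P' hP' =>
    h.buckets.pop hkn (by omega) (by simp [hs₁]) (by simp [hs₁]) fun u hu =>
      ⟨(hP' u hu).1, fun h1 => (hP' u hu).2 ⟨h1.1, Fin.ext (hx.symm.trans h1.2)⟩⟩
  have hstale : ¬ (x ∉ τ ∧ label U τ x = k) → ∀ t, t ≤ 50 →
      ∃ τ' T' k', SearchInv L nb U σ₀ c τ' T' k' s₁ ∧
        t + 3 + searchPotential L nb τ' T' k' ≤ searchPotential L nb τ T k := by
    intro hxs t ht
    refine ⟨τ, T - 1, k, ⟨(h.graph.setArr (by omega)).setReg (by simp), by simpa [hs₁] using h.reg7,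
      h.cases, h.search, h.store.congr (by simp [hs₁]) (by simp [hs₁]), hb₁ _ fun u hu => ⟨hu, ?_⟩,
      by simpa [hs₁] using h.reg4, by simpa [hs₁] using h.reg6, h.k_le, h.label_le, by omega,
      by simpa [hs₁] using h.order₀, by simpa [hs₁] using h.order, by simpa [hs₁] using h.alt₀,
      by simpa [hs₁] using h.alt⟩, ?_⟩
    · rintro ⟨h1, rfl⟩
      exact hxs ⟨hu, h1⟩
    · unfold searchPotential
      omega
  have h6 : s₁.arr 6 x = n ↔ x ∉ τ := by
    rw [← h.store.pos_eq_iff h.search.nodup x]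
    simp [hs₁]
  have h0 : s₁.reg 0 = n := by simpa [hs₁] using h.graph.reg0
  refine .ite (fun hp => ?_) fun hp => ?_
  swap
  · refine .skip (hstale ?_ _ ?_)
    · intro h1
      refine hp ?_
      simp only [Test.Holds, Expr.eval, h0]
      rw [show s₁.reg 5 = x by simp [hs₁]]
      exact h6.2 h1.1
    · simp [Expr.cost, Expr.idx, Test.cost]
  have hxτ : x ∉ τ := by
    simp only [Test.Holds, Expr.eval, h0] at hp
    rw [show s₁.reg 5 = x by simp [hs₁]] at hp
    exact h6.1 hp
  have hlx : s₁.arr 5 x = label U τ x := by simpa [hs₁] using h.store.label x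
  refine .ite (fun hp' => ?_) fun hp' => ?_
  swap
  · refine .skip (hstale ?_ _ ?_)
    · intro h1
      refine hp' ?_
      simp only [Test.Holds, Expr.eval]
      rw [show s₁.reg 5 = x by simp [hs₁], show s₁.reg 6 = k by simpa [hs₁] using h.reg6, hlx, h1.2]
    · simp [Expr.cost, Expr.idx, Test.cost]
  have hlk : label U τ x = k := by
    simp only [Test.Holds, Expr.eval] at hp'
    rwa [show s₁.reg 5 = x by simp [hs₁], show s₁.reg 6 = k by simpa [hs₁] using h.reg6, hlx] at hp'
  have h4 : s₁.reg 4 = τ.length := by simpa [hs₁] using h.reg4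
  refine .seq (.write (j := τ.length) (v := x) (by simp [Expr.eval, h4])
    (by simp [Expr.eval, hs₁]) ?_)
  refine .seq (.write (j := τ.length) (v := 0) (by simp [Expr.eval, h4])
    (hW.eval_const (Nat.zero_le 1)) ?_)
  refine (h.visit hW hA (x := x) (T' := T - 1) ⟨hxτ, fun u hu => hlk ▸ h.label_le u hu⟩
    (.inr (hsuf.trans (List.prefix_append _ _))) (fun y hy => by simp [hs₁, hy]) (by simp [hs₁])
    ?_ ((hb₁ _ ?_).congr (by simp) (by simp) fun _ => id) (by omega) ?_ ?_ ?_ ?_).mono ?_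
  · intro a ha
    have h1 : a ≠ 7 := by rintro rfl; simp at ha
    have h2 : a ≠ 9 := by rintro rfl; simp at ha
    have h3 : a ≠ 10 := by rintro rfl; simp at ha
    simp [hs₁, h1, h2, h3]
  · intro u hu
    rw [List.mem_append, not_or] at hu
    refine ⟨hu.1, ?_⟩
    rintro ⟨-, rfl⟩
    simp at hu
  · intro i hi
    simp [hs₁, hi]
  · simp
  · intro i hi
    simp [hs₁, hi]
  · simp [show ¬ τ.length < σ₀.length by omega]
  · rintro s' t ⟨h1, h2⟩
    refine ⟨_, _, _, h1, hpay _ _ h1.search (by omega) _ ?_⟩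
    simp only [Expr.cost, Expr.idx, Test.cost]
    omega

/-- Starting from `σ₀`, a search visits all vertices in linear time. It resets the numbers of
alternatives at the levels above `σ₀` and keeps the stored lists of alternatives. -/
theorem runs_search (hW : LargeWords L W) (hA : AdjLists L nb U) {σ₀ : List (Fin n)}
    (hσ₀ : IsSearch U σ₀) {s : Store} (hG : GraphStore L nb s) (h7 : s.reg 7 = σ₀.length)
    (h9 : ∀ i, (h : i < σ₀.length) → s.arr 9 i = σ₀[i]) :
    Runs W search s fun s' t => ∃ σ, σ₀ <+: σ ∧ IsSearch U σ ∧ (∀ v, v ∈ σ) ∧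
      GraphStore L nb s' ∧ SearchStore U σ s' ∧ s'.reg 4 = σ.length ∧
      (∀ i, (h : i < σ.length) → s'.arr 9 i = σ[i]) ∧
      (∀ i, i < σ₀.length → s'.arr 10 i = s.arr 10 i) ∧
      (∀ i, σ₀.length ≤ i → i < σ.length → s'.arr 10 i = 0) ∧ s'.arr 11 = s.arr 11 ∧
      t ≤ 400 * (n + L.length + 1) := by
  have hgoal : Runs W search s fun s' t => ∃ σ, σ₀ <+: σ ∧ IsSearch U σ ∧ (∀ v, v ∈ σ) ∧
      GraphStore L nb s' ∧ SearchStore U σ s' ∧ s'.reg 4 = σ.length ∧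
      (∀ i, (h : i < σ.length) → s'.arr 9 i = σ[i]) ∧
      (∀ i, i < σ₀.length → s'.arr 10 i = s.arr 10 i) ∧
      (∀ i, σ₀.length ≤ i → i < σ.length → s'.arr 10 i = 0) ∧
      t ≤ 400 * (n + L.length + 1) := by
    refine .seq ((runs_initSearch (U := U) hW hG).frame.mono ?_)
    rintro s₁ t₁ ⟨⟨h1, h2, h3, h4, ht₁⟩, hf₁⟩
    have hinv : SearchInv L nb U σ₀ (s.arr 10) [] n 0 s₁ :=
      ⟨hG.frame hf₁ (by decide) (by decide), (hf₁.1 7 (by decide)).trans h7,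
        .inl (List.nil_prefix), isSearch_nil U, h1, h2, by simpa using h3, h4, le_rfl,
        fun u _ => by simp [label_nil], by simp, by rw [hf₁.2 9 (by decide)]; exact h9, by simp,
        by rw [hf₁.2 10 (by decide)]; simp, by simp⟩
    refine (Runs.loop (fun m s' => ∃ τ T k, SearchInv L nb U σ₀ (s.arr 10) τ T k s' ∧
      m = searchPotential L nb τ T k) ?_ _ s₁ ⟨_, _, _, hinv, rfl⟩).mono ?_
    · rintro m s' ⟨τ, T, k, h, rfl⟩ hlt
      simp only [Test.Holds, Expr.eval, h.reg4, h.graph.reg0] at hlt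
      refine (runs_searchStep hW hA hσ₀ h hlt).mono ?_
      rintro s'' t ⟨τ', T', k', h', ht⟩
      exact ⟨_, ⟨τ', T', k', h', rfl⟩, by simpa [Test.cost, Expr.cost] using ht⟩
    · rintro s' t ⟨m', ⟨τ, T, k, h, rfl⟩, hlt, ht⟩
      simp only [Test.Holds, Expr.eval, h.reg4, h.graph.reg0] at hlt
      have hall : ∀ v, v ∈ τ := by
        have h5 : τ.toFinset = Finset.univ := by
          refine Finset.eq_univ_of_card _ ?_
          rw [List.toFinset_card_of_nodup h.search.nodup, Fintype.card_fin]
          have := nodup_length_le h.search.nodup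
          omega
        intro v
        have := Finset.mem_univ v
        rwa [← h5, List.mem_toFinset] at this
      have hpre : σ₀ <+: τ := by
        rcases h.cases with h5 | h5
        · have := nodup_length_le hσ₀.nodup
          rw [h5.eq_of_length (by have := h5.length_le; omega)]
        · exact h5
      refine ⟨τ, hpre, h.search, hall, h.graph, h.store, h.reg4, h.order, h.alt₀, h.alt, ?_⟩
      simp only [searchPotential, weight_nil, Test.cost, Expr.cost] at ht
      omega
  refine hgoal.frame.mono ?_
  rintro s' t ⟨⟨σ, h1, h2, h3, h4, h5, h6, h7, h8, h9, h10⟩, hf⟩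
  exact ⟨σ, h1, h2, h3, h4, h5, h6, h7, h8, h9, hf.2 11 (by decide), h10⟩

end Search

end MarkovEnum

namespace MarkovEnum

/-! ### Alternatives and backtracking -/

section Backtrack

variable {n W : ℕ} {L : List (Fin n × Fin n)} {nb : Fin n → List (Fin n)} {G : Digraph (Fin n)}

/-- The queue `l` of alternatives at level `i`, starting with `x`. Array 12 contains the positions
in the queue; whether it does so for a given vertex is checked by looking there, so its other
entries need not be reset. `b` is the table of alternatives at the other levels. -/
structure Queue (w i : ℕ) (b : ℕ → ℕ) (x : Fin n) (l : List (Fin n)) (s : Store) : Prop where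
  nodup : l.Nodup
  start : [x] <+: l
  reg9 : s.reg 9 = l.length
  entry : ∀ j, (h : j < l.length) → s.arr 11 (i * w + j) = l[j]
  index : ∀ j, (h : j < l.length) → s.arr 12 l[j] = j
  other : ∀ i' j, i' ≠ i → j < w → s.arr 11 (i' * w + j) = b (i' * w + j)

theorem Queue.setReg {w i : ℕ} {b : ℕ → ℕ} {x : Fin n} {l : List (Fin n)} {s : Store}
    (h : Queue w i b x l s) {y v : ℕ} (hy : y ≠ 9) : Queue w i b x l (s.setReg y v) :=
  ⟨h.nodup, h.start, by simpa [hy.symm] using h.reg9, h.entry, h.index, h.other⟩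

theorem runs_addAlternative (hW : LargeWords L W) {b : ℕ → ℕ} {i : ℕ} {x y : Fin n}
    {l : List (Fin n)} {s : Store} (h : Queue (width L) i b x l s) (hi : i ≤ n)
    (h13 : s.reg 13 = width L) (h4 : s.reg 4 = i) (h3 : s.reg 3 = y) (hy : y ∉ l) :
    Runs W addAlternative s fun s' t => Queue (width L) i b x (l ++ [y]) s' ∧ t ≤ 20 := by
  have hww := hW.width_lt
  have hw : n < width L := by unfold width; omega
  have hnd : (l ++ [y]).Nodup := by
    rw [List.nodup_append]
    refine ⟨h.nodup, List.nodup_singleton _, ?_⟩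
    rintro a ha c hc rfl
    exact hy (List.mem_singleton.1 hc ▸ ha)
  have hlen := nodup_length_le hnd
  rw [List.length_append, List.length_singleton] at hlen
  refine .seq (.write (j := i * width L + l.length) (v := y) (Expr.eval_idx hW h13 hi (by omega)
    (by simp [Expr.eval, h4]) (by simp [Expr.eval, h.reg9])) (by simp [Expr.eval, h3]) ?_)
  refine .seq (.write (j := y) (v := l.length) (by simp [Expr.eval, h3])
    (by simp [Expr.eval, h.reg9]) ?_)
  refine .assign (v := l.length + 1) (hW.eval_succ (by simp [Expr.eval, h.reg9]) (by omega))
    ⟨⟨hnd, h.start.trans (List.prefix_append _ _), by simp, ?_, ?_, ?_⟩, ?_⟩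
  · intro j hj
    simp only [List.length_append, List.length_singleton] at hj
    by_cases hjl : j = l.length
    · subst hjl
      simp
    · rw [List.getElem_append_left (by omega), ← h.entry j (by omega)]
      simp only [Store.arr_setReg, Store.arr_setArr]
      simp [Function.update_of_ne, hjl]
  · intro j hj
    simp only [List.length_append, List.length_singleton] at hj
    by_cases hjl : j = l.length
    · subst hjl
      simp
    · have hne : (l[j]'(by omega) : ℕ) ≠ y := fun h' => hy (Fin.ext h' ▸ List.getElem_mem _)
      rw [List.getElem_append_left (by omega)]
      simp only [Store.arr_setReg, Store.arr_setArr, if_true]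
      rw [Function.update_of_ne hne]
      simpa using h.index j (by omega)
  · intro i' j hi' hj
    simp only [Store.arr_setReg, Store.arr_setArr]
    have : i' * width L + j ≠ i * width L + l.length := fun h' =>
      hi' ((idx_inj hj (by omega)).1 h').1
    simpa [Function.update_of_ne this] using h.other i' j hi' hj
  · simp [Expr.cost, Expr.idx]

/-- The queue is extended by `y` exactly if `y` is unvisited, has the label of `x` and is not in the
queue. -/
theorem runs_tryAlternative (hW : LargeWords L W) {τ : List (Fin n)} (hτ : τ.Nodup) {b : ℕ → ℕ}
    {i : ℕ} {x y : Fin n} {l : List (Fin n)} {s : Store} (hG : GraphStore L nb s)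
    (hS : SearchStore (Und G) τ s) (h : Queue (width L) i b x l s) (hi : i ≤ n)
    (h4 : s.reg 4 = i) (h5 : s.reg 5 = x) (h3 : s.reg 3 = y) :
    Runs W tryAlternative s fun s' t => (∃ l', Queue (width L) i b x l' s' ∧ l <+: l' ∧
      (y ∉ τ → label (Und G) τ y = label (Und G) τ x → y ∈ l') ∧
      ∀ z ∈ l', z ∈ l ∨ (z = y ∧ y ∉ τ ∧ label (Und G) τ y = label (Und G) τ x)) ∧ t ≤ 50 := by
  have hlen := nodup_length_le h.nodup
  have hw : n < width L := by unfold width; omega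
  have hstay : (y ∉ τ → label (Und G) τ y = label (Und G) τ x → y ∈ l) →
      ∃ l', Queue (width L) i b x l' s ∧ l <+: l' ∧
        (y ∉ τ → label (Und G) τ y = label (Und G) τ x → y ∈ l') ∧
        ∀ z ∈ l', z ∈ l ∨ (z = y ∧ y ∉ τ ∧ label (Und G) τ y = label (Und G) τ x) :=
    fun h' => ⟨l, h, List.prefix_refl _, h', fun z hz => .inl hz⟩
  refine .ite (fun hp => ?_) fun hp => ?_
  swap
  · refine .skip ⟨hstay fun hy => (hp ?_).elim, by simp [Expr.cost, Test.cost]⟩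
    simpa only [Test.Holds, Expr.eval, h3, hG.reg0] using (hS.pos_eq_iff hτ y).2 hy
  have hyτ : y ∉ τ := by
    rw [← hS.pos_eq_iff hτ y]
    simpa only [Test.Holds, Expr.eval, h3, hG.reg0] using hp
  refine .ite (fun hp => ?_) fun hp => ?_
  swap
  · refine .skip ⟨hstay fun _ hy => (hp ?_).elim, by simp [Expr.cost, Test.cost]⟩
    simpa only [Test.Holds, Expr.eval, h3, h5, hS.label] using hy
  have hyx : label (Und G) τ y = label (Und G) τ x := by
    simpa only [Test.Holds, Expr.eval, h3, h5, hS.label] using hp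
  have hadd : y ∉ l → ∀ c, c ≤ 30 → Runs W addAlternative s fun s' t =>
      (∃ l', Queue (width L) i b x l' s' ∧ l <+: l' ∧
        (y ∉ τ → label (Und G) τ y = label (Und G) τ x → y ∈ l') ∧
        ∀ z ∈ l', z ∈ l ∨ (z = y ∧ y ∉ τ ∧ label (Und G) τ y = label (Und G) τ x)) ∧
      c + t ≤ 50 := by
    intro hyl c hc
    refine (runs_addAlternative hW h hi hG.reg13 h4 h3 hyl).mono ?_
    rintro s' t ⟨h1, h2⟩
    refine ⟨⟨l ++ [y], h1, List.prefix_append _ _, fun _ _ => by simp, fun z hz => ?_⟩, by omega⟩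
    rcases List.mem_append.1 hz with hz | hz
    · exact .inl hz
    · exact .inr ⟨List.mem_singleton.1 hz, hyτ, hyx⟩
  refine .ite (fun hp => ?_) fun hp => ?_
  swap
  · refine (hadd ?_ 20 (by omega)).mono ?_
    · intro hy
      obtain ⟨j, hj, rfl⟩ := List.mem_iff_getElem.1 hy
      refine hp ?_
      simp only [Test.Holds, Expr.eval, h3, h.reg9, h.index j hj]
      exact hj
    · rintro s' t ⟨h1, h2⟩
      refine ⟨h1, ?_⟩
      simp only [Test.cost, Expr.cost]
      omega
  have hj : s.arr 12 y < l.length := by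
    simpa only [Test.Holds, Expr.eval, h3, h.reg9] using hp
  have heval : (Expr.read 11 (.idx (.reg 4) (.read 12 (.reg 3)))).eval W s = l[s.arr 12 y] := by
    simp only [Expr.eval]
    rw [Expr.eval_idx (a := i) (b := s.arr 12 y) hW hG.reg13 hi (by omega)
      (by simp [Expr.eval, h4]) (by simp [Expr.eval, h3]), h.entry _ hj]
  refine .ite (fun hp => ?_) fun hp => ?_
  · simp only [Test.Holds, heval] at hp
    simp only [Expr.eval, h3] at hp
    refine .skip ⟨hstay fun _ _ => ?_, by simp [Expr.cost, Expr.idx, Test.cost]⟩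
    rw [← Fin.ext hp]
    exact List.getElem_mem _
  · simp only [Test.Holds, heval] at hp
    simp only [Expr.eval, h3] at hp
    refine (hadd ?_ 30 (by omega)).mono ?_
    · intro hy
      obtain ⟨j, hj', rfl⟩ := List.mem_iff_getElem.1 hy
      refine hp ?_
      simp only [h.index j hj']
    · rintro s' t ⟨h1, h2⟩
      refine ⟨h1, ?_⟩
      simp only [Test.cost, Expr.cost, Expr.idx]
      omega

/-- The alternatives are listed in time proportional to their number and the total length of their
adjacency lists. -/
theorem runs_listAlternatives (hW : LargeWords L W) (hA : AdjLists L nb (Und G))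
    {τ : List (Fin n)} (hτ : τ.Nodup) {x : Fin n} {s : Store}
    (hG : GraphStore L nb s) (hS : SearchStore (Und G) τ s) (h4 : s.reg 4 = τ.length)
    (h5 : s.reg 5 = x) :
    Runs W listAlternatives s fun s' t => ∃ l, (x :: l).Nodup ∧
      (∀ y, y ∈ x :: l ↔ Alternative G τ x y) ∧
      s'.arr 10 = Function.update (s.arr 10) τ.length (l.length + 1) ∧
      (∀ j, (h : j < l.length) → s'.arr 11 (τ.length * width L + (j + 1)) = l[j]) ∧
      (∀ i j, i ≠ τ.length → j < width L →
        s'.arr 11 (i * width L + j) = s.arr 11 (i * width L + j)) ∧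
      t ≤ 100 * weight nb (x :: l) + 50 := by
  have hww := hW.width_lt
  have hw : n < width L := by unfold width; omega
  have hτn := nodup_length_le hτ
  refine .seq (.write (j := τ.length * width L + 0) (v := x)
    (Expr.eval_idx hW hG.reg13 hτn (by omega) (by simp [Expr.eval, h4]) (hW.eval_const (by omega)))
    (by simp [Expr.eval, h5]) ?_)
  refine .seq (.write (j := x) (v := 0) (by simp [Expr.eval, h5]) (hW.eval_const (by omega)) ?_)
  refine .seq (.assign (v := 1) (hW.eval_const le_rfl) ?_)
  refine .seq (.assign (v := 0) (hW.eval_const (by omega)) ?_)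
  set s₁ := ((((s.setArr 11 (τ.length * width L + 0) x).setArr 12 x 0).setReg 9 1).setReg 10 0)
    with hs₁
  have hG₁ : GraphStore L nb s₁ :=
    (((hG.setArr (by omega)).setArr (by omega)).setReg (by simp)).setReg (by simp)
  have hS₁ : SearchStore (Und G) τ s₁ := hS.congr (by simp [hs₁]) (by simp [hs₁])
  have hq₁ : Queue (width L) τ.length (s.arr 11) x [x] s₁ := by
    refine ⟨List.nodup_singleton _, List.prefix_refl _, by simp [hs₁], ?_, ?_, ?_⟩
    · intro j hj
      obtain rfl : j = 0 := by simpa using hj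
      simp [hs₁]
    · intro j hj
      obtain rfl : j = 0 := by simpa using hj
      simp [hs₁]
    · intro i' j hi' hj
      have : i' * width L + j ≠ τ.length * width L + 0 := fun h' =>
        hi' ((idx_inj hj (by omega)).1 h').1
      simp only [Nat.add_zero] at this
      simp [hs₁, Function.update_of_ne this]
  -- The neighbours of the entries before the head of the queue are in the queue if they are
  -- alternatives.
  have hloop := Runs.loop_frame (W := W) (b := .lt (.reg 10) (.reg 9)) (s₀ := s₁)
    (p := .seq (.assign 11 (.read 11 (.idx (.reg 4) (.reg 10)))) <|
      .seq (forNbr 11 tryAlternative) <| .assign 10 (.add (.reg 10) (.const 1)))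
    (m := 100 * (n + L.length))
    (fun m s' => ∃ l h, Queue (width L) τ.length (s.arr 11) x l s' ∧ s'.reg 10 = h ∧
      h ≤ l.length ∧ (∀ v ∈ l.take h, ∀ y ∈ nb v, y ∉ τ →
        label (Und G) τ y = label (Und G) τ x → y ∈ l) ∧
      (∀ z ∈ l, Alternative G τ x z) ∧ m = 100 * (n + L.length - weight nb (l.take h)))
    (by
      rintro m s₂ hf ⟨l, h, hq, h10, hhl, hcl, halt, rfl⟩ hb
      simp only [Test.Holds, Expr.eval, h10, hq.reg9] at hb
      have hln := nodup_length_le hq.nodup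
      have hG₂ : GraphStore L nb s₂ := hG₁.frame hf (by decide) (by decide)
      have hS₂ : SearchStore (Und G) τ s₂ := hS₁.congr (hf.2 5 (by decide)) (hf.2 6 (by decide))
      have h4₂ : s₂.reg 4 = τ.length := (hf.1 4 (by decide)).trans (by simp [hs₁, h4])
      have h5₂ : s₂.reg 5 = x := (hf.1 5 (by decide)).trans (by simp [hs₁, h5])
      refine .seq (.assign (v := l[h]) ?_ ?_)
      · simp only [Expr.eval]
        rw [Expr.eval_idx (a := τ.length) (b := h) hW hG₂.reg13 hτn (by omega)
          (by simp [Expr.eval, h4₂]) (by simp [Expr.eval, h10]), hq.entry h hb]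
      set s₃ := s₂.setReg 11 l[h] with hs₃
      have hnbr := Runs.forNbr (W := W) (p := tryAlternative) (x := 11) (T := 50) (v := l[h])
        (s := s₃) (fun d s' => ∃ l', Queue (width L) τ.length (s.arr 11) x l' s' ∧ l <+: l' ∧
          (∀ y ∈ d, y ∉ τ → label (Und G) τ y = label (Und G) τ x → y ∈ l') ∧
          ∀ z ∈ l', Alternative G τ x z) hW (hG₂.setReg (by simp)) (by simp [hs₃])
        (hA.nodup _) (by decide) (by decide) (by decide) (by decide)
        (fun d s' a ⟨l', h1, h2⟩ => ⟨l', h1.setReg (by omega), h2⟩)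
        (fun d s' a ⟨l', h1, h2⟩ => ⟨l', h1.setReg (by omega), h2⟩)
        (fun d y d' hd s₄ hf₄ ⟨l', h1, h2, h3, h6⟩ hy => by
          refine (runs_tryAlternative hW hτ (y := y)
            ((hG₂.setReg (x := 11) (by simp)).frame hf₄ (by decide) (by decide))
            (hS₂.congr (hf₄.2 5 (by decide)) (hf₄.2 6 (by decide))) h1 hτn
            ((hf₄.1 4 (by decide)).trans (by simp [hs₃, h4₂]))
            ((hf₄.1 5 (by decide)).trans (by simp [hs₃, h5₂])) hy).mono ?_
          rintro s₅ t ⟨⟨l'', h7, h8, h9, h11⟩, ht⟩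
          refine ⟨⟨l'', h7, h2.trans h8, fun z hz hzτ hzx => ?_, fun z hz => ?_⟩, ht⟩
          · rcases List.mem_append.1 hz with hz | hz
            · exact h8.subset (h3 z hz hzτ hzx)
            · obtain rfl := List.mem_singleton.1 hz
              exact h9 hzτ hzx
          · rcases h11 z hz with hz | ⟨rfl, hz, hzx⟩
            · exact h6 z hz
            · refine Relation.ReflTransGen.tail (halt _ (List.getElem_mem hb)) ⟨?_, hz, hzx⟩
              rw [← hA.mem, hd]
              simp)
        ⟨l, hq.setReg (by omega), List.prefix_refl _, by simp, halt⟩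
      refine .seq (hnbr.frame.mono ?_)
      rintro s₄ t ⟨⟨⟨l', hq', hll', hd, halt'⟩, ht⟩, hf₄⟩
      have h10₄ : s₄.reg 10 = h := (hf₄.1 10 (by decide)).trans (by simp [hs₃, h10])
      have hlen' := hll'.length_le
      have htake : l'.take (h + 1) = l.take h ++ [l[h]] := by
        rw [← List.take_succ_eq_append_getElem hb]
        obtain ⟨r, rfl⟩ := hll'
        rw [List.take_append_of_le_length (by omega)]
      have hwt := hA.weight_le (hq'.nodup.sublist (List.take_sublist (h + 1) l'))
      refine .assign (v := h + 1) (hW.eval_succ (by simp [Expr.eval, h10₄]) (by omega))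
        ⟨_, ⟨l', h + 1, hq'.setReg (by omega), by simp, by omega, ?_, halt', rfl⟩, ?_⟩
      · intro v hv y hy hyτ hyx
        rw [htake] at hv
        rcases List.mem_append.1 hv with hv | hv
        · exact hll'.subset (hcl v hv y hy hyτ hyx)
        · rw [List.mem_singleton] at hv
          subst hv
          exact hd y hy hyτ hyx
      · rw [htake, weight_concat] at hwt ⊢
        simp only [Expr.cost, Expr.idx, Test.cost]
        omega)
    ⟨[x], 0, hq₁, by simp [hs₁], by simp, by simp, by
      intro z hz
      rw [List.mem_singleton.1 hz]
      exact .refl, by simp⟩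
  refine .seq (hloop.mono ?_)
  rintro s₂ t ⟨m', hf, ⟨l, h, hq, h10, hhl, hcl, halt, rfl⟩, hb, ht⟩
  simp only [Test.Holds, Expr.eval, h10, hq.reg9] at hb
  obtain rfl : h = l.length := by omega
  rw [List.take_length] at hcl ht
  have hln := nodup_length_le hq.nodup
  have h4₂ : s₂.reg 4 = τ.length := (hf.1 4 (by decide)).trans (by simp [hs₁, h4])
  obtain ⟨l', rfl⟩ := hq.start
  simp only [List.cons_append, List.nil_append] at hq hcl halt ht hln
  have hwt := hA.weight_le hq.nodup
  refine .write (j := τ.length) (v := l'.length + 1) (by simp [Expr.eval, h4₂])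
    (by simp [Expr.eval, hq.reg9]) ⟨l', hq.nodup, fun y => ⟨halt y, fun hy => ?_⟩, ?_, ?_, ?_, ?_⟩
  · unfold Alternative at hy
    induction hy with
    | refl => simp
    | @tail v z _ h1 ih => exact hcl v ih z ((hA.mem _ _).2 h1.1) h1.2.1 h1.2.2
  · have : s₂.arr 10 = s₁.arr 10 := hf.2 10 (by decide)
    simp [this, hs₁]
  · intro j hj
    have := hq.entry (j + 1) (by simpa using hj)
    simpa using this
  · intro i j hi hj
    simpa using hq.other i j hi hj
  · simp only [Expr.cost, Expr.idx, Test.cost] at ht ⊢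
    omega

theorem runs_unvisit (hW : LargeWords L W) (hA : AdjLists L nb (Und G)) {τ : List (Fin n)}
    {x : Fin n} {s : Store} (hG : GraphStore L nb s) (hS : SearchStore (Und G) (τ ++ [x]) s)
    (hnd : (τ ++ [x]).Nodup) (h4 : s.reg 4 = τ.length + 1) (h9 : s.arr 9 τ.length = x) :
    Runs W unvisit s fun s' t => SearchStore (Und G) τ s' ∧ s'.reg 4 = τ.length ∧
      s'.reg 5 = x ∧ t ≤ 50 * ((nb x).length + 1) := by
  have hxτ : x ∉ τ := fun h => by
    rw [List.nodup_append] at hnd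
    exact hnd.2.2 x h x (by simp) rfl
  have h4' : (Expr.sub (.reg 4) (.const 1)).eval W s = τ.length := by
    rw [hW.eval_pred (a := τ.length + 1) (by simp [Expr.eval, h4])]
    rfl
  refine .seq (.assign h4' ?_)
  refine .seq (.assign (v := x) (by simp [Expr.eval, h9]) ?_)
  refine .seq (.write (j := x) (v := n) (by simp [Expr.eval]) (by simp [Expr.eval, hG.reg0]) ?_)
  set s₁ := ((s.setReg 4 τ.length).setReg 5 x).setArr 6 x n with hs₁
  have hloop := Runs.forNbr (W := W) (p := .write 5 (.reg 3) (.sub (.read 5 (.reg 3)) (.const 1)))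
    (x := 5) (T := 10) (v := x) (s := s₁)
    (fun l s' => ∀ v : Fin n, s'.arr 5 v = label (Und G) (τ ++ [x]) v - if v ∈ l then 1 else 0) hW
    (((hG.setReg (by simp)).setReg (by simp)).setArr (by omega)) (by simp [hs₁]) (hA.nodup x)
    (by decide) (by decide) (by decide) (by decide) (fun l s a h => h) (fun l s a h => h)
    (fun l y l' hl s' hfr hI hy => by
      have hyl : y ∉ l := fun h => by
        have := hl ▸ hA.nodup x
        rw [List.nodup_append] at this
        exact this.2.2 y h y (by simp) rfl
      refine .write (j := y) (v := label (Und G) (τ ++ [x]) y - 1) (by simp [Expr.eval, hy])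
        (hW.eval_pred (by simp [Expr.eval, hy, hI, hyl])) ⟨fun v => ?_, by simp [Expr.cost]⟩
      simp only [Store.arr_setArr, if_true, Function.update_apply, ← Fin.ext_iff, hI,
        List.mem_append, List.mem_singleton]
      by_cases h : v = y
      · subst h
        simp
      · simp [h])
    (fun v => by simp [hs₁, hS.label])
  refine (hloop.frame.mono ?_)
  rintro s₂ t ⟨⟨hlab, ht⟩, hfr⟩
  refine ⟨⟨fun v => ?_, fun v => ?_⟩, (hfr.1 4 (by decide)).trans (by simp [hs₁]),
    (hfr.1 5 (by decide)).trans (by simp [hs₁]), ?_⟩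
  · rw [hlab, label_concat (Und G) hxτ]
    have := hA.mem x v
    by_cases h : Und G x v
    · simp [h, this.2 h]
    · simp [h, mt this.1 h]
  · have h7 : s₂.arr 6 = s₁.arr 6 := hfr.2 6 (by decide)
    simp only [h7, hs₁, Store.arr_setArr, if_true, Function.update_apply, ← Fin.ext_iff,
      Store.arr_setReg, hS.pos, List.mem_append, List.mem_singleton]
    by_cases hvx : v = x
    · subst hvx
      simp [hxτ]
    · by_cases hvτ : v ∈ τ
      · simp [hvx, hvτ, List.idxOf_append_of_mem hvτ]
      · simp [hvx, hvτ]
  · simp only [Expr.cost]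
    omega

/-- The list `l` of alternatives that are left is stored at level `i`. -/
structure StoredList (w i : ℕ) (l : List (Fin n)) (s : Store) : Prop where
  nodup : l.Nodup
  length : s.arr 10 i = l.length + 1
  entry : ∀ j, (h : j < l.length) → s.arr 11 (i * w + (j + 1)) = l[j]

theorem StoredList.congr {i : ℕ} {l : List (Fin n)} {s s' : Store}
    (h : StoredList (width L) i l s) (h10 : s'.arr 10 i = s.arr 10 i)
    (h11 : ∀ j, j < width L → s'.arr 11 (i * width L + j) = s.arr 11 (i * width L + j)) :
    StoredList (width L) i l s' := by
  have := nodup_length_le h.nodup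
  exact ⟨h.nodup, h10.trans h.length, fun j hj =>
    (h11 _ (by unfold width; omega)).trans (h.entry j hj)⟩

/-- The last one of the alternatives left is chosen. -/
theorem runs_nextAlternative (hW : LargeWords L W) {i : ℕ} {l : List (Fin n)} {s : Store}
    (hi : i ≤ n) (h13 : s.reg 13 = width L) (h4 : s.reg 4 = i)
    (h : StoredList (width L) i l s) :
    Runs W nextAlternative s fun s' t => (l = [] ∧ s' = s ∨
      ∃ (l' : List (Fin n)) (y : Fin n), l = l' ++ [y] ∧
      s'.arr 10 = Function.update (s.arr 10) i (l'.length + 1) ∧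
      s'.arr 9 = Function.update (s.arr 9) i y ∧ s'.reg 7 = i + 1 ∧ s'.reg 14 = 1) ∧ t ≤ 50 := by
  have hw : n < width L := by unfold width; omega
  have hlen := nodup_length_le h.nodup
  have hww := hW.width_lt
  refine .ite (fun hp => ?_) fun hp => ?_
  · simp only [Test.Holds, Expr.eval, h4, h.length, Nat.mod_eq_of_lt (by omega : 1 < W)] at hp
    rcases List.eq_nil_or_concat' l with rfl | ⟨l', y, rfl⟩
    · simp at hp
    have hl : (l' ++ [y]).length = l'.length + 1 := by simp
    have hy := h.entry l'.length (by simp)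
    rw [List.getElem_append_right le_rfl] at hy
    refine .seq (.write (j := i) (v := l'.length + 1) (by simp [Expr.eval, h4])
      ((hW.eval_pred (a := l'.length + 1 + 1)
        (by simp only [Expr.eval, h4, h.length, hl])).trans rfl) ?_)
    refine .seq (.write (j := i) (v := y) (by simp [Expr.eval, h4]) ?_ ?_)
    · simp only [Expr.eval]
      rw [Expr.eval_idx (a := i) (b := l'.length + 1) hW (by simpa using h13) hi (by omega)
        (by simp [Expr.eval, h4]) (by simp [Expr.eval, h4])]
      simpa using hy
    refine .seq (.assign (v := i + 1) (hW.eval_succ (by simp [Expr.eval, h4]) (by omega)) ?_)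
    refine .assign (v := 1) (hW.eval_const le_rfl) ⟨.inr ⟨l', y, rfl, ?_, ?_, ?_, ?_⟩, ?_⟩ <;>
      simp [Expr.cost, Expr.idx, Test.cost]
  · simp only [Test.Holds, Expr.eval, h4, h.length, Nat.mod_eq_of_lt (by omega : 1 < W)] at hp
    refine .skip ⟨.inl ⟨List.eq_nil_of_length_eq_zero (by omega), rfl⟩, ?_⟩
    simp [Expr.cost, Test.cost]

/-- `A` contains the alternatives left at the level of `x` in the branch `τ ++ [x]`. They are
listed only when the search goes back to this level for the first time. -/
def StoredAlternatives (G : Digraph (Fin n)) (w : ℕ) (τ : List (Fin n)) (x : Fin n)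
    (A : Set (Fin n)) (s : Store) : Prop :=
  (s.arr 10 τ.length = 0 ∧ A = {y | Alternative G τ x y ∧ y ≠ x}) ∨
    ∃ l, StoredList w τ.length l s ∧ A = {y | y ∈ l}

/-- The branch `τ` of the search tree, with the sets `P` of alternatives left, is stored. -/
structure StoredBranch (G : Digraph (Fin n)) (w : ℕ) (τ : List (Fin n)) (P : ℕ → Set (Fin n))
    (s : Store) : Prop where
  order : ∀ i, (h : i < τ.length) → s.arr 9 i = τ[i]
  alt : ∀ τ' x, τ' ++ [x] <+: τ → StoredAlternatives G w τ' x (P τ'.length) s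

theorem length_lt_of_concat_prefix {α : Type*} {l l' : List α} {x : α} (h : l' ++ [x] <+: l) :
    l'.length < l.length := by
  have := h.length_le
  simp only [List.length_append, List.length_singleton] at this
  omega

theorem StoredAlternatives.congr {τ : List (Fin n)} {x : Fin n} {A : Set (Fin n)} {s s' : Store}
    (h : StoredAlternatives G (width L) τ x A s) (h10 : s'.arr 10 τ.length = s.arr 10 τ.length)
    (h11 : ∀ j, j < width L →
      s'.arr 11 (τ.length * width L + j) = s.arr 11 (τ.length * width L + j)) :
    StoredAlternatives G (width L) τ x A s' := by
  rcases h with ⟨h1, h2⟩ | ⟨l, h1, h2⟩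
  · exact .inl ⟨h10.trans h1, h2⟩
  · exact .inr ⟨l, h1.congr h10 h11, h2⟩

theorem StoredBranch.congr {τ : List (Fin n)} {P P' : ℕ → Set (Fin n)} {s s' : Store}
    (h : StoredBranch G (width L) τ P s) (hP : ∀ i, i < τ.length → P' i = P i)
    (h9 : ∀ i, i < τ.length → s'.arr 9 i = s.arr 9 i)
    (h10 : ∀ i, i < τ.length → s'.arr 10 i = s.arr 10 i)
    (h11 : ∀ i j, i < τ.length → j < width L →
      s'.arr 11 (i * width L + j) = s.arr 11 (i * width L + j)) :
    StoredBranch G (width L) τ P' s' := by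
  refine ⟨fun i hi => (h9 i hi).trans (h.order i hi), fun τ' x hx => ?_⟩
  have hlt := length_lt_of_concat_prefix hx
  rw [hP _ hlt]
  exact (h.alt τ' x hx).congr (h10 _ hlt) fun j hj => h11 _ j hlt hj

theorem storedBranch_concat {w : ℕ} {τ : List (Fin n)} {x : Fin n} {P : ℕ → Set (Fin n)}
    {s : Store} : StoredBranch G w (τ ++ [x]) P s ↔ StoredBranch G w τ P s ∧
      s.arr 9 τ.length = x ∧ StoredAlternatives G w τ x (P τ.length) s := by
  constructor
  · intro h
    refine ⟨⟨fun i hi => ?_, fun τ' y hy => h.alt τ' y (hy.trans (List.prefix_append _ _))⟩, ?_,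
      h.alt τ x (List.prefix_refl _)⟩
    · rw [h.order i (by simp; omega), List.getElem_append_left hi]
    · rw [h.order τ.length (by simp)]
      simp
  · rintro ⟨h1, h2, h3⟩
    refine ⟨fun i hi => ?_, fun τ' y hy => ?_⟩
    · rcases Nat.lt_or_ge i τ.length with h4 | h4
      · rw [List.getElem_append_left h4]
        exact h1.order i h4
      · obtain rfl : i = τ.length := by
          simp only [List.length_append, List.length_singleton] at hi
          omega
        simpa using h2
    · rcases List.prefix_concat_iff.1 hy with h4 | h4
      · obtain ⟨rfl, h5⟩ := List.append_inj' h4 rfl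
        obtain rfl : y = x := by simpa using h5
        exact h3
      · exact h1.alt τ' y h4

/-- The state when a level of the search tree is left for a further alternative. -/
structure Found (G : Digraph (Fin n)) (w : ℕ) (done : List (Digraph (Fin n))) (s : Store)
    (τ : List (Fin n)) (P : ℕ → Set (Fin n)) : Prop where
  tree : TreeInv G done τ P {D | Consistent G τ D}
  branch : StoredBranch G w τ P s
  reg7 : s.reg 7 = τ.length
  reg14 : s.reg 14 = 1

/-- The state when everything below the branch `τ` has been output. -/
structure Exhausted (G : Digraph (Fin n)) (w : ℕ) (done : List (Digraph (Fin n))) (s : Store)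
    (τ : List (Fin n)) (P : ℕ → Set (Fin n)) : Prop where
  tree : TreeInv G done τ P ∅
  branch : StoredBranch G w τ P s
  store : SearchStore (Und G) τ s
  reg4 : s.reg 4 = τ.length
  reg14 : s.reg 14 = 0

/-- The alternatives left are available afterwards. If there are none, then listing them takes only
time proportional to the degree of `x`. -/
theorem runs_ensureListed (hW : LargeWords L W) (hA : AdjLists L nb (Und G)) {τ : List (Fin n)}
    {x : Fin n} {A : Set (Fin n)} {s : Store} (hG : GraphStore L nb s)
    (hS : SearchStore (Und G) τ s) (hτ : τ.Nodup) (h4 : s.reg 4 = τ.length) (h5 : s.reg 5 = x)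
    (h : StoredAlternatives G (width L) τ x A s) :
    Runs W (.ite (.eq (.read 10 (.reg 4)) (.const 0)) listAlternatives .skip) s fun s' t =>
      ∃ l, StoredList (width L) τ.length l s' ∧ A = {y | y ∈ l} ∧
        (∀ i, i ≠ τ.length → s'.arr 10 i = s.arr 10 i) ∧
        (∀ i j, i ≠ τ.length → j < width L →
          s'.arr 11 (i * width L + j) = s.arr 11 (i * width L + j)) ∧
        t ≤ 100 * (n + L.length) + 60 ∧ (l = [] → t ≤ 100 * ((nb x).length + 1) + 60) := by
  refine .ite (fun hp => ?_) fun hp => ?_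
  · simp only [Test.Holds, Expr.eval, h4, Nat.zero_mod] at hp
    obtain ⟨-, rfl⟩ : s.arr 10 τ.length = 0 ∧ A = {y | Alternative G τ x y ∧ y ≠ x} := by
      rcases h with h | ⟨l, h, -⟩
      · exact h
      · rw [h.length] at hp
        omega
    refine (runs_listAlternatives hW hA hτ hG hS h4 h5).mono ?_
    rintro s' t ⟨l, h1, h2, h3, h6, h7, h8⟩
    have hwt := hA.weight_le h1
    refine ⟨l, ⟨(List.nodup_cons.1 h1).2, by simp [h3], h6⟩, ?_, fun i hi => by simp [h3, hi], h7,
      ?_, ?_⟩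
    · ext y
      rw [Set.mem_ofPred_eq, Set.mem_ofPred_eq, ← h2, List.mem_cons]
      refine ⟨fun ⟨h9, h10⟩ => h9.resolve_left h10, fun h9 => ⟨.inr h9, ?_⟩⟩
      rintro rfl
      exact (List.nodup_cons.1 h1).1 h9
    · simp only [Test.cost, Expr.cost]
      omega
    · rintro rfl
      have : weight nb [x] = (nb x).length + 1 := by simp [weight]
      simp only [Test.cost, Expr.cost]
      omega
  · simp only [Test.Holds, Expr.eval, h4, Nat.zero_mod] at hp
    rcases h with h | ⟨l, h, hA⟩
    · exact (hp h.1).elim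
    · refine .skip ⟨l, h, hA, fun _ _ => rfl, fun _ _ _ _ => rfl, ?_, fun _ => ?_⟩ <;>
        simp only [Test.cost, Expr.cost] <;> omega

/-- Leaving a level takes time proportional to the degree of the vertex `x` visited there, unless a
further alternative is found; this happens only once per backtracking. -/
theorem runs_backtrackStep (hW : LargeWords L W) (hA : AdjLists L nb (Und G))
    {done : List (Digraph (Fin n))} {τ : List (Fin n)} {x : Fin n} {P : ℕ → Set (Fin n)}
    {s : Store} (hG : GraphStore L nb s) (h : Exhausted G (width L) done s (τ ++ [x]) P) :
    Runs W (.seq unvisit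
      (.seq (.ite (.eq (.read 10 (.reg 4)) (.const 0)) listAlternatives .skip) nextAlternative)) s
      fun s' t =>
        (Exhausted G (width L) done s' τ P ∧ t ≤ 300 * ((nb x).length + 1)) ∨
        (s'.reg 4 = τ.length ∧ (∃ τ' P', Found G (width L) done s' τ' P') ∧
          t ≤ 300 * ((nb x).length + 1) + 100 * (n + L.length)) := by
  have hnd := h.tree.search.nodup
  have hτ : τ.Nodup := hnd.sublist (List.sublist_append_left _ _)
  have hτn := nodup_length_le hτ
  obtain ⟨hbr, h9, halt⟩ := storedBranch_concat.1 h.branch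
  refine .seq ((runs_unvisit hW hA hG h.store hnd (by simpa using h.reg4) h9).frame.mono ?_)
  rintro s₁ t₁ ⟨⟨hS₁, h4₁, h5₁, ht₁⟩, hf₁⟩
  have h9₁ : s₁.arr 9 = s.arr 9 := hf₁.2 9 (by decide)
  have h10₁ : s₁.arr 10 = s.arr 10 := hf₁.2 10 (by decide)
  have h11₁ : s₁.arr 11 = s.arr 11 := hf₁.2 11 (by decide)
  have hG₁ : GraphStore L nb s₁ := hG.frame hf₁ (by decide) (by decide)
  refine .seq ((runs_ensureListed hW hA hG₁ hS₁ hτ h4₁ h5₁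
    (halt.congr (by rw [h10₁]) fun j _ => by rw [h11₁])).frame.mono ?_)
  rintro s₂ t₂ ⟨⟨l, hl, hPl, h10₂, h11₂, ht₂, ht₂'⟩, hf₂⟩
  have h9₂ : s₂.arr 9 = s.arr 9 := (hf₂.2 9 (by decide)).trans h9₁
  have h4₂ : s₂.reg 4 = τ.length := (hf₂.1 4 (by decide)).trans h4₁
  have hbr₂ : StoredBranch G (width L) τ P s₂ := hbr.congr (fun _ _ => rfl)
    (fun i _ => by rw [h9₂]) (fun i hi => by rw [h10₂ i hi.ne, h10₁])
    (fun i j hi hj => by rw [h11₂ i j hi.ne hj, h11₁])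
  have h13₂ : s₂.reg 13 = width L := (hf₂.1 13 (by decide)).trans hG₁.reg13
  refine ((runs_nextAlternative hW hτn h13₂ h4₂ hl).frame.mono ?_)
  rintro s₃ t₃ ⟨⟨hcase, ht₃⟩, hf₃⟩
  rcases hcase with ⟨rfl, rfl⟩ | ⟨l', y, rfl, h10₃, h9₃, h7₃, h14₃⟩
  · have := ht₂' rfl
    refine .inl ⟨⟨h.tree.pop (by simpa using hPl), hbr₂,
      hS₁.congr (hf₂.2 5 (by decide)) (hf₂.2 6 (by decide)), h4₂, ?_⟩, by omega⟩
    rw [hf₂.1 14 (by decide), hf₁.1 14 (by decide), h.reg14]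
  · have hyl' : y ∉ l' := fun h' => by
      have := hl.nodup
      rw [List.nodup_append] at this
      exact this.2.2 y h' y (by simp) rfl
    have hP' : ∀ i, i < τ.length → Function.update P τ.length {z | z ∈ l'} i = P i :=
      fun i hi => Function.update_of_ne hi.ne _ _
    have h11₃ : s₃.arr 11 = s₂.arr 11 := hf₃.2 11 (by decide)
    refine .inr ⟨(hf₃.1 4 (by decide)).trans h4₂,
      ⟨τ ++ [y], Function.update P τ.length {z | z ∈ l'}, ⟨?_, ?_, ?_, h14₃⟩⟩, by omega⟩
    · refine h.tree.switch (y := y) (by rw [hPl]; simp) hP' ?_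
      rw [Function.update_self, hPl]
      ext z
      simp only [Set.mem_ofPred_eq, Set.mem_sdiff, List.mem_append, List.mem_singleton,
        Set.mem_singleton_iff]
      refine ⟨fun hz => ⟨.inl hz, ?_⟩, fun ⟨hz, hzy⟩ => hz.resolve_right hzy⟩
      rintro rfl
      exact hyl' hz
    · refine storedBranch_concat.2 ⟨hbr₂.congr hP' (fun i hi => by simp [h9₃, hi.ne])
        (fun i hi => by simp [h10₃, hi.ne]) (fun i j _ _ => by rw [h11₃]), by simp [h9₃],
        .inr ⟨l', ⟨hl.nodup.sublist (List.sublist_append_left _ _), by simp [h10₃],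
          fun j hj => ?_⟩, by simp⟩⟩
      rw [h11₃, hl.entry j (by simp; omega), List.getElem_append_left hj]
    · simpa using h7₃

/-- Backtracking takes linear time, as the degrees of the vertices left behind sum up to at most the
length of the list of arcs. -/
theorem runs_backtrack (hW : LargeWords L W) (hA : AdjLists L nb (Und G))
    {done : List (Digraph (Fin n))} {σ : List (Fin n)} {P : ℕ → Set (Fin n)} {s : Store}
    (hG : GraphStore L nb s) (htree : TreeInv G done σ P ∅)
    (hbr : StoredBranch G (width L) σ P s) (hS : SearchStore (Und G) σ s)
    (h4 : s.reg 4 = σ.length) :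
    Runs W backtrack s fun s' t => GraphStore L nb s' ∧
      ((s'.reg 14 = 0 ∧ ∃ P', TreeInv G done [] P' ∅) ∨
        ∃ τ' P', Found G (width L) done s' τ' P') ∧ t ≤ 600 * (n + L.length + 1) := by
  refine .seq (.assign (v := 0) (hW.eval_const (Nat.zero_le 1)) ?_)
  set s₁ := s.setReg 14 0 with hs₁
  have hG₁ : GraphStore L nb s₁ := hG.setReg (by simp)
  have hwt := hA.weight_le htree.search.nodup
  have htest : ∀ s' : Store, ∀ i, s'.reg 4 = i → i ≤ n → ∀ f, s'.reg 14 = f → f ≤ 1 →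
      ((Test.lt (.const 0) (.mul (.reg 4) (.sub (.const 1) (.reg 14)))).Holds W s' ↔
        0 < i ∧ f = 0) := by
    intro s' i hi hin f hf hf1
    have hww := hW.width_lt
    have hw : n < width L := by unfold width; omega
    simp only [Test.Holds, Expr.eval, hi, hf]
    rw [Nat.mod_eq_of_lt (by omega : 1 < W), Nat.zero_mod]
    obtain rfl | rfl : f = 0 ∨ f = 1 := by omega
    · simp [Nat.mod_eq_of_lt (by omega : i < W)]
    · simp
  refine (Runs.loop_frame (W := W) (s₀ := s₁) (m := 400 * weight nb σ + 100 * (n + L.length))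
    (fun m s' => (∃ τ P, Exhausted G (width L) done s' τ P ∧
        m = 400 * weight nb τ + 100 * (n + L.length)) ∨
      (s'.reg 4 ≤ n ∧ ∃ τ' P', Found G (width L) done s' τ' P')) ?_
    (.inl ⟨σ, P, ⟨htree, hbr.congr (fun _ _ => rfl) (fun _ _ => rfl) (fun _ _ => rfl)
      (fun _ _ _ _ => rfl), hS.congr rfl rfl, by simpa [hs₁] using h4, by simp [hs₁]⟩,
        rfl⟩)).mono ?_
  · rintro m s' hf h hb
    rcases h with ⟨τ, P, h, rfl⟩ | ⟨h4', τ, P, h⟩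
    swap
    · rw [htest s' _ rfl h4' 1 h.reg14 le_rfl] at hb
      omega
    have hτn := nodup_length_le h.tree.search.nodup
    rw [htest s' _ h.reg4 hτn 0 h.reg14 (Nat.zero_le 1)] at hb
    rcases List.eq_nil_or_concat' τ with rfl | ⟨τ, x, rfl⟩
    · simp at hb
    rw [List.length_append, List.length_singleton] at hτn
    refine (runs_backtrackStep hW hA (hG₁.frame hf (by decide) (by decide)) h).mono ?_
    rintro s'' t (⟨h1, ht⟩ | ⟨h4', h1, ht⟩)
    · refine ⟨_, .inl ⟨τ, P, h1, rfl⟩, ?_⟩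
      simp only [Test.cost, Expr.cost, weight_concat]
      omega
    · refine ⟨0, .inr ⟨by omega, h1⟩, ?_⟩
      simp only [Test.cost, Expr.cost, weight_concat]
      omega
  · rintro s' t ⟨m', hf, h, hb, ht⟩
    refine ⟨hG₁.frame hf (by decide) (by decide), ?_, ?_⟩
    · rcases h with ⟨τ, P, h, -⟩ | ⟨-, h⟩
      · have hτn := nodup_length_le h.tree.search.nodup
        rw [htest s' _ h.reg4 hτn 0 h.reg14 (Nat.zero_le 1)] at hb
        obtain rfl : τ = [] := List.eq_nil_of_length_eq_zero (by omega)
        exact .inl ⟨h.reg14, P, h.tree⟩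
      · exact .inr h
    · simp only [Test.cost, Expr.cost] at ht ⊢
      omega

end Backtrack

end MarkovEnum

namespace MarkovEnum

/-! ### Reading the input -/

section Prepare

variable {n W : ℕ} {L : List (Fin n × Fin n)} {G : Digraph (Fin n)}

/-- The neighbours of `u` along the undirected edges with the list `L` of arcs, in the order in
which they occur in the list `L'`. -/
def nbrList (L L' : List (Fin n × Fin n)) (u : Fin n) : List (Fin n) :=
  (L'.filter fun e => e.1 = u ∧ (e.2, e.1) ∈ L).map Prod.snd

/-- Every arc occurs in at most one of the adjacency lists. -/
theorem sum_length_nbrList_le (L L' : List (Fin n × Fin n)) :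
    ∑ u, (nbrList L L' u).length ≤ L'.length := by
  induction L' with
  | nil => simp [nbrList]
  | cons e L' ih =>
    have h1 : ∀ u, (nbrList L (e :: L') u).length ≤
        (nbrList L L' u).length + if e.1 = u then 1 else 0 := by
      intro u
      by_cases h : e.1 = u <;> by_cases h' : (e.2, e.1) ∈ L <;>
        simp [nbrList, List.filter_cons, h, h']
      all_goals
        rw [h] at h'
        simp [h']
    refine (Finset.sum_le_sum fun u _ => h1 u).trans ?_
    rw [Finset.sum_add_distrib, Finset.sum_ite_eq]
    simpa using ih

theorem IsArcList.adjLists (hL : IsArcList L G) : AdjLists L (nbrList L L) (Und G) := by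
  refine ⟨fun u v => ?_, fun u => ?_, sum_length_nbrList_le L L⟩
  · simp only [nbrList, List.mem_map, List.mem_filter, decide_eq_true_eq, Prod.exists, hL.2, Und]
    constructor
    · rintro ⟨a, b, ⟨h1, rfl, h2⟩, rfl⟩
      exact ⟨h1, h2⟩
    · rintro ⟨h1, h2⟩
      exact ⟨u, v, ⟨h1, rfl, h2⟩, rfl⟩
  · refine List.Nodup.map_on ?_ (hL.1.filter _)
    rintro ⟨a, b⟩ h1 ⟨c, d⟩ h2 rfl
    simp only [List.mem_filter, decide_eq_true_eq] at h1 h2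
    rw [h1.2.1, h2.2.1]

theorem nbrList_take_succ (L : List (Fin n × Fin n)) {i : ℕ} (hi : i < L.length) (u : Fin n) :
    nbrList L (L.take (i + 1)) u = nbrList L (L.take i) u ++
      if L[i].1 = u ∧ (L[i].2, L[i].1) ∈ L then [L[i].2] else [] := by
  rw [List.take_succ_eq_append_getElem hi, nbrList, List.filter_append, List.map_append]
  congr 1
  by_cases h : L[i].1 = u ∧ (L[i].2, L[i].1) ∈ L
  · rw [if_pos h, List.filter_cons_of_pos (by simpa using h)]
    simp
  · rw [if_neg h, List.filter_cons_of_neg (by simpa using h)]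
    simp

theorem length_nbrList_le (L L' : List (Fin n × Fin n)) (u : Fin n) :
    (nbrList L L' u).length ≤ L'.length := by
  rw [nbrList, List.length_map]
  exact List.length_filter_le _ _

theorem runs_prepare (hW : LargeWords L W) :
    Runs W prepare (inputStore L) fun s t => GraphStore L (nbrList L L) s ∧ s.reg 7 = 0 ∧
      s.reg 14 = 1 ∧ t ≤ 100 * (n + L.length + 1) := by
  have hww := hW.width_lt
  have hw : width L = n + L.length + 1 := rfl
  refine .seq (.assign (v := width L) (hW.eval_succ (a := n + L.length) ?_ (by omega)) ?_)
  · simp only [Expr.eval, inputStore]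
    simpa using Nat.mod_eq_of_lt (by omega : n + L.length < W)
  set s₀ := (inputStore L).setReg 13 (width L) with hs₀
  have h0 : s₀.reg 0 = n := by simp [hs₀, inputStore]
  have h1 : s₀.reg 1 = L.length := by simp [hs₀, inputStore]
  have h13 : s₀.reg 13 = width L := by simp [hs₀]
  have hsrc : ∀ j, (h : j < L.length) → s₀.arr 0 j = L[j].1 := by
    intro j hj
    simp [hs₀, inputStore, hj]
  have hdst : ∀ j, (h : j < L.length) → s₀.arr 1 j = L[j].2 := by
    intro j hj
    simp [hs₀, inputStore, hj]
  have hz : ∀ a, 2 ≤ a → ∀ i, s₀.arr a i = 0 := by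
    intro a ha i
    simp [hs₀, inputStore, show a ≠ 0 by omega, show a ≠ 1 by omega]
  have hmat := Runs.forUpTo (W := W) (j := 2) (e := .reg 1) (N := L.length) (T := 20) (s := s₀)
    (p := .write 2 (.idx (.read 0 (.reg 2)) (.read 1 (.reg 2))) (.const 1))
    (fun i s => ∀ u v : Fin n, s.arr 2 (u * width L + v) = 1 ↔ (u, v) ∈ L.take i)
    (by omega) (by decide)
    (fun i s _ hf _ _ => by simp only [Expr.eval, hf.1 1 (by decide), h1])
    (fun i s hi hf hI hr => by
      have h0 : s.arr 0 i = L[i].1 := by rw [hf.2 0 (by decide)]; exact hsrc i hi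
      have h1 : s.arr 1 i = L[i].2 := by rw [hf.2 1 (by decide)]; exact hdst i hi
      refine .write (j := L[i].1 * width L + L[i].2) (v := 1)
        (Expr.eval_idx hW ((hf.1 13 (by decide)).trans h13) (by omega) (by omega)
          (by simp [Expr.eval, hr, h0]) (by simp [Expr.eval, hr, h1])) (hW.eval_const le_rfl)
        ⟨fun u v => ?_, by simp [Expr.cost, Expr.idx]⟩
      rw [List.take_succ_eq_append_getElem hi, List.mem_append, List.mem_singleton, ← hI]
      simp only [Store.arr_setReg, Store.arr_setArr, if_true, Function.update_apply,
        idx_inj (show (v : ℕ) < width L by omega) (show (L[i].2 : ℕ) < width L by omega),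
        Prod.ext_iff, Fin.ext_iff]
      split_ifs with h <;> simp [h])
    (fun u v => by simp [hz])
  refine .seq (hmat.frame.mono ?_)
  rintro s₁ t₁ ⟨⟨hmat₁, -, ht₁⟩, hf₁⟩
  rw [List.take_length] at hmat₁
  have h1₁ : s₁.reg 1 = L.length := (hf₁.1 1 (by decide)).trans h1
  have h13₁ : s₁.reg 13 = width L := (hf₁.1 13 (by decide)).trans h13
  have hnbr := Runs.forUpTo (W := W) (j := 2) (e := .reg 1) (N := L.length) (T := 50) (s := s₁)
    (p := .seq (.assign 3 (.read 0 (.reg 2))) <|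
      .seq (.assign 8 (.read 1 (.reg 2))) <|
      .ite (.eq (.read 2 (.idx (.reg 8) (.reg 3))) (.const 1))
        (.seq (.write 3 (.idx (.reg 3) (.read 4 (.reg 3))) (.reg 8))
          (.write 4 (.reg 3) (.add (.read 4 (.reg 3)) (.const 1))))
        .skip)
    (fun i s => (∀ u : Fin n, ∀ j, (h : j < (nbrList L (L.take i) u).length) →
      s.arr 3 (u * width L + j) = (nbrList L (L.take i) u)[j]) ∧
      ∀ u : Fin n, s.arr 4 u = (nbrList L (L.take i) u).length)
    (by omega) (by decide)
    (fun i s _ hf _ _ => by simp only [Expr.eval, hf.1 1 (by decide), h1₁])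
    (fun i s hi hf hI hr => by
      have h0 : s.arr 0 i = L[i].1 := by
        rw [hf.2 0 (by decide), hf₁.2 0 (by decide)]; exact hsrc i hi
      have h1 : s.arr 1 i = L[i].2 := by
        rw [hf.2 1 (by decide), hf₁.2 1 (by decide)]; exact hdst i hi
      have h2 : s.arr 2 = s₁.arr 2 := hf.2 2 (by decide)
      have h13 : s.reg 13 = width L := (hf.1 13 (by decide)).trans h13₁
      have hsucc := nbrList_take_succ L hi
      have hlen := (length_nbrList_le L (L.take i) L[i].1).trans (List.length_take_le i L)
      generalize L[i] = e at h0 h1 hsucc hlen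
      obtain ⟨x, y⟩ := e
      simp only at h0 h1 hsucc hlen
      refine .seq (.assign (v := x) (by simp [Expr.eval, hr, h0]) ?_)
      refine .seq (.assign (v := y) (by simp [Expr.eval, hr, h1]) ?_)
      have hidx : (Expr.idx (.reg 8) (.reg 3)).eval W ((s.setReg 3 x).setReg 8 y) =
          y * width L + x :=
        Expr.eval_idx hW (by simpa using h13) (by omega) (by omega) (by simp [Expr.eval])
          (by simp [Expr.eval])
      have htest : (Test.eq (.read 2 (.idx (.reg 8) (.reg 3))) (.const 1)).Holds W
          ((s.setReg 3 x).setReg 8 y) ↔ (y, x) ∈ L := by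
        rw [Test.Holds, hW.eval_const le_rfl, Expr.eval, hidx, ← hmat₁, ← h2]
        simp
      refine .ite (fun hp => ?_) fun hp => ?_
      · rw [htest] at hp
        refine .seq (.write (j := x * width L + (nbrList L (L.take i) x).length) (v := y)
          (Expr.eval_idx hW (by simpa using h13) (by omega) (by omega) (by simp [Expr.eval])
            (by simp [Expr.eval, hI.2])) (by simp [Expr.eval]) ?_)
        refine .write (j := x) (v := (nbrList L (L.take i) x).length + 1) (by simp [Expr.eval])
          (hW.eval_succ (by simp [Expr.eval, hI.2]) (by omega))
          ⟨⟨fun u => ?_, fun u => ?_⟩, by simp [Expr.cost, Expr.idx, Test.cost]⟩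
        · have hlu := (length_nbrList_le L (L.take i) u).trans (List.length_take_le i L)
          rw [hsucc]
          intro j hj
          have hne : ¬ (x = u ∧ j = (nbrList L (L.take i) x).length) →
              u * width L + j ≠ x * width L + (nbrList L (L.take i) x).length := by
            rw [List.length_append] at hj
            have : (if x = u ∧ (y, x) ∈ L then [y] else []).length ≤ 1 := by split_ifs <;> simp
            intro h h'
            obtain ⟨h3, h4⟩ := (idx_inj (by omega) (by omega)).1 h'
            exact h ⟨(Fin.ext h3).symm, h4⟩
          by_cases hju : j < (nbrList L (L.take i) u).length
          · rw [List.getElem_append_left hju, ← hI.1 u j hju]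
            have := hne (by rintro ⟨rfl, rfl⟩; exact lt_irrefl _ hju)
            simp [Function.update_of_ne this]
          · by_cases hxu : x = u
            · subst hxu
              simp only [hp, and_self, if_true, List.length_append, List.length_singleton] at hj ⊢
              obtain rfl : j = (nbrList L (L.take i) x).length := by omega
              simp
            · simp [hxu] at hj
              exact (hju hj).elim
        · rw [hsucc]
          by_cases hxu : x = u
          · subst hxu
            simp [hp]
          · have : (u : ℕ) ≠ x := fun h => hxu (Fin.ext h).symm
            simp [hxu, Function.update_of_ne this, hI.2]
      · rw [htest] at hp
        have hsame : ∀ u, nbrList L (L.take (i + 1)) u = nbrList L (L.take i) u := by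
          intro u
          rw [hsucc, if_neg (fun h => hp h.2), List.append_nil]
        refine .skip ⟨⟨fun u => ?_, fun u => ?_⟩, by simp [Expr.cost, Expr.idx, Test.cost]⟩
        · rw [hsame]
          exact hI.1 u
        · rw [hsame]
          exact hI.2 u)
    ⟨fun u j hj => by simp [nbrList] at hj, fun u => by
      rw [Store.arr_setReg, hf₁.2 4 (by decide), hz 4 (by omega)]
      simp [nbrList]⟩
  refine .seq (hnbr.frame.mono ?_)
  rintro s₂ t₂ ⟨⟨⟨hnbr₂, hdeg₂⟩, -, ht₂⟩, hf₂⟩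
  rw [List.take_length] at hnbr₂ hdeg₂
  refine .assign (v := 1) (hW.eval_const le_rfl) ⟨.setReg ⟨?_, ?_, ?_, ?_, ?_, ?_, ?_, ?_⟩
    (by simp), ?_, by simp, ?_⟩
  · rw [hf₂.1 0 (by decide), hf₁.1 0 (by decide), h0]
  · rw [hf₂.1 1 (by decide), h1₁]
  · rw [hf₂.1 13 (by decide), h13₁]
  · rw [hf₂.2 0 (by decide), hf₁.2 0 (by decide)]; exact hsrc
  · rw [hf₂.2 1 (by decide), hf₁.2 1 (by decide)]; exact hdst
  · rw [hf₂.2 2 (by decide)]; exact hmat₁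
  · exact hnbr₂
  · exact hdeg₂
  · simp [hf₂.1 7 (by decide), hf₁.1 7 (by decide), hs₀, inputStore]
  · simp only [Expr.cost] at ht₁ ht₂ ⊢
    omega

end Prepare

/-! ### Output -/

/-- From the store `s`, the program `p` halts after writing out the words `ws`, in a store and
after a time that satisfy `Q`. It does not complete an output object. -/
def Outputs (W : ℕ) (p : Prog) (s : Store) (ws : List ℕ) (Q : Store → ℕ → Prop) : Prop :=
  ∃ s' tr, Exec W p s s' tr ∧ Event.mark ∉ tr ∧ outputWords tr = ws ∧ Q s' tr.length

theorem outputWords_append (a b : List Event) :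
    outputWords (a ++ b) = outputWords a ++ outputWords b :=
  List.filterMap_append

@[simp]
theorem outputWords_ticks (t : ℕ) : outputWords (ticks t) = [] := by
  simp [outputWords, ticks]

@[simp]
theorem length_ticks (t : ℕ) : (ticks t).length = t := by
  simp [ticks]

@[simp]
theorem mark_notMem_ticks (t : ℕ) : Event.mark ∉ ticks t := by
  simp [ticks]

section Output

variable {W : ℕ} {p q : Prog} {s : Store} {ws ws' : List ℕ} {Q R : Store → ℕ → Prop}

theorem Runs.outputs (h : Runs W p s Q) : Outputs W p s [] Q := by
  obtain ⟨s', t, h1, h2⟩ := h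
  exact ⟨s', ticks t, h1, by simp, by simp, by simpa using h2⟩

theorem Outputs.mono (h : Outputs W p s ws Q) (hQ : ∀ s' t, Q s' t → R s' t) :
    Outputs W p s ws R := by
  obtain ⟨s', t, h1, h2, h3, h4⟩ := h
  exact ⟨s', t, h1, h2, h3, hQ _ _ h4⟩

theorem Outputs.seq
    (h : Outputs W p s ws fun s' t => Outputs W q s' ws' fun s'' t' => Q s'' (t + t')) :
    Outputs W (.seq p q) s (ws ++ ws') Q := by
  obtain ⟨s', t, h1, h2, h3, s'', t', h4, h5, h6, h7⟩ := h
  exact ⟨s'', t ++ t', .seq h1 h4, by simp [h2, h5], by rw [outputWords_append, h3, h6],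
    by simpa using h7⟩

theorem Outputs.ite {b : Test}
    (h1 : b.Holds W s → Outputs W p s ws fun s' t => Q s' (b.cost + t))
    (h2 : ¬ b.Holds W s → Outputs W q s ws fun s' t => Q s' (b.cost + t)) :
    Outputs W (.ite b p q) s ws Q := by
  by_cases hb : b.Holds W s
  · obtain ⟨s', t, h3, h4, h5, h6⟩ := h1 hb
    exact ⟨s', _, .ite_true q hb h3, by simp [h4], by simp [outputWords_append, h5],
      by simpa using h6⟩
  · obtain ⟨s', t, h3, h4, h5, h6⟩ := h2 hb
    exact ⟨s', _, .ite_false p hb h3, by simp [h4], by simp [outputWords_append, h5],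
      by simpa using h6⟩

theorem Outputs.emit {e : Expr} {v : ℕ} (hv : e.eval W s = v) (h : Q s (e.cost + 1)) :
    Outputs W (.emit e) s [v] Q :=
  ⟨s, _, .emit e s, by simp, by rw [outputWords_append, outputWords_ticks, hv]; rfl,
    by simpa using h⟩

variable {n : ℕ} {L : List (Fin n × Fin n)} {nb : Fin n → List (Fin n)}

/-- Whether the arc `e` of the list `L` belongs to the orientation along `pos`. -/
def IsKept (L : List (Fin n × Fin n)) (pos : Fin n → ℕ) (e : Fin n × Fin n) : Bool :=
  (e.2, e.1) ∉ L ∨ pos e.1 < pos e.2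

/-- The kept arcs are those of the orientation along `pos`. -/
theorem describes_orient {G : Digraph (Fin n)} (hL : IsArcList L G) (pos : Fin n → ℕ) :
    Describes ((L.filter (IsKept L pos)).flatMap fun e => [(e.1 : ℕ), (e.2 : ℕ)])
      (orient G pos) := by
  refine ⟨_, ⟨hL.1.filter _, fun u v => ?_⟩, rfl⟩
  simp only [List.mem_filter, IsKept, decide_eq_true_eq, hL.2, orient]
  refine and_congr_right fun _ => ?_
  rw [imp_iff_not_or]

theorem outputs_output (hW : LargeWords L W) {pos : Fin n → ℕ} (hG : GraphStore L nb s)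
    (hpos : ∀ v : Fin n, s.arr 6 v = pos v) :
    Outputs W output s ((L.filter (IsKept L pos)).flatMap fun e => [(e.1 : ℕ), (e.2 : ℕ)])
      fun _ t => t ≤ 60 * (n + L.length + 1) := by
  have hww := hW.width_lt
  have hw : width L = n + L.length + 1 := rfl
  have hemit : ∀ {s₀ : Store} {e : Fin n × Fin n}, s₀.reg 3 = e.1 → s₀.reg 8 = e.2 →
      Outputs W (.seq (.emit (.reg 3)) (.emit (.reg 8))) s₀ [(e.1 : ℕ), (e.2 : ℕ)]
        fun s' t => s' = s₀ ∧ t ≤ 4 := fun h3 h8 =>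
    .seq (.emit (by simpa [Expr.eval] using h3)
      (.emit (by simpa [Expr.eval] using h8) ⟨rfl, by simp [Expr.cost]⟩))
  have hbody : ∀ j, (hj : j < L.length) → ∀ s₀, Frame output s s₀ → s₀.reg 2 = j →
      Outputs W (.seq (.assign 3 (.read 0 (.reg 2))) <|
        .seq (.assign 8 (.read 1 (.reg 2))) <|
        .seq (.ite (.eq (.read 2 (.idx (.reg 8) (.reg 3))) (.const 1))
          (.ite (.lt (.read 6 (.reg 3)) (.read 6 (.reg 8)))
            (.seq (.emit (.reg 3)) (.emit (.reg 8)))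
            .skip)
          (.seq (.emit (.reg 3)) (.emit (.reg 8)))) <|
        .assign 2 (.add (.reg 2) (.const 1))) s₀
        (if IsKept L pos L[j] then [(L[j].1 : ℕ), (L[j].2 : ℕ)] else [])
        fun s' t => s'.reg 2 = j + 1 ∧ t ≤ 50 := by
    intro j hj s₀ hf h2
    have h0 : s₀.arr 0 j = L[j].1 := by rw [hf.2 0 (by decide)]; exact hG.src j hj
    have h1 : s₀.arr 1 j = L[j].2 := by rw [hf.2 1 (by decide)]; exact hG.dst j hj
    generalize L[j] = e at h0 h1
    have hG₀ : GraphStore L nb s₀ := hG.frame hf (by decide) (by decide)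
    have h6 : s₀.arr 6 = s.arr 6 := hf.2 6 (by decide)
    set s₁ := (s₀.setReg 3 e.1).setReg 8 e.2 with hs₁
    have h31 : s₁.reg 3 = e.1 := by simp [hs₁]
    have h81 : s₁.reg 8 = e.2 := by simp [hs₁]
    have htest : (Test.eq (.read 2 (.idx (.reg 8) (.reg 3))) (.const 1)).Holds W s₁ ↔
        (e.2, e.1) ∈ L := by
      rw [Test.Holds, hW.eval_const le_rfl, Expr.eval, Expr.eval_idx (a := e.2) (b := e.1) hW
        (by simpa [hs₁] using hG₀.reg13) (by omega) (by omega) (by simpa [Expr.eval] using h81)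
        (by simpa [Expr.eval] using h31), ← hG₀.mat]
      simp [hs₁]
    have htest' : (Test.lt (.read 6 (.reg 3)) (.read 6 (.reg 8))).Holds W s₁ ↔
        pos e.1 < pos e.2 := by
      simp [Test.Holds, Expr.eval, hs₁, h6, hpos]
    rw [← List.nil_append (ite _ _ _)]
    refine .seq (Runs.outputs (.assign (v := e.1) (by simp [Expr.eval, h2, h0]) ?_))
    rw [← List.nil_append (ite _ _ _)]
    refine .seq (Runs.outputs (.assign (v := e.2) (by simp [Expr.eval, h2, h1]) ?_))
    rw [← List.append_nil (ite _ _ _)]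
    have hite : Outputs W (.ite (.eq (.read 2 (.idx (.reg 8) (.reg 3))) (.const 1))
        (.ite (.lt (.read 6 (.reg 3)) (.read 6 (.reg 8)))
          (.seq (.emit (.reg 3)) (.emit (.reg 8)))
          .skip)
        (.seq (.emit (.reg 3)) (.emit (.reg 8)))) s₁
        (if IsKept L pos e then [(e.1 : ℕ), (e.2 : ℕ)] else [])
        fun s' t => s' = s₁ ∧ t ≤ 30 := by
      refine .ite (fun hp => .ite (fun hp' => ?_) fun hp' => ?_) fun hp => ?_
      · rw [htest'] at hp'
        rw [if_pos (by simp [IsKept, hp'])]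
        refine (hemit h31 h81).mono fun s' t h => ⟨h.1, ?_⟩
        have := h.2
        simp only [Test.cost, Expr.cost, Expr.idx]
        omega
      · rw [htest'] at hp'
        rw [htest] at hp
        rw [if_neg (by simpa [IsKept, hp] using hp')]
        exact Runs.outputs (.skip ⟨rfl, by simp [Test.cost, Expr.cost, Expr.idx]⟩)
      · rw [htest] at hp
        rw [if_pos (by simp [IsKept, hp])]
        refine (hemit h31 h81).mono fun s' t h => ⟨h.1, ?_⟩
        have := h.2
        simp only [Test.cost, Expr.cost, Expr.idx]
        omega
    refine .seq (hite.mono ?_)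
    rintro s' t ⟨rfl, ht⟩
    refine Runs.outputs (.assign (v := j + 1)
      (hW.eval_succ (by simp [Expr.eval, hs₁, h2]) (by omega)) ⟨by simp, ?_⟩)
    simp only [Expr.cost]
    omega
  have hloop : ∀ k j s₀, j + k = L.length → Frame output s s₀ → s₀.reg 2 = j →
      Outputs W (.loop (.lt (.reg 2) (.reg 1)) <|
        .seq (.assign 3 (.read 0 (.reg 2))) <|
        .seq (.assign 8 (.read 1 (.reg 2))) <|
        .seq (.ite (.eq (.read 2 (.idx (.reg 8) (.reg 3))) (.const 1))
          (.ite (.lt (.read 6 (.reg 3)) (.read 6 (.reg 8)))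
            (.seq (.emit (.reg 3)) (.emit (.reg 8)))
            .skip)
          (.seq (.emit (.reg 3)) (.emit (.reg 8)))) <|
        .assign 2 (.add (.reg 2) (.const 1))) s₀
        (((L.drop j).filter (IsKept L pos)).flatMap fun e => [(e.1 : ℕ), (e.2 : ℕ)])
        fun _ t => t ≤ 60 * k + 3 := by
    intro k
    induction k with
    | zero =>
      intro j s₀ hj hf h2
      have h1 : s₀.reg 1 = L.length := (hf.1 1 (by decide)).trans hG.reg1
      refine ⟨s₀, _, .loop_false _ ?_, by simp, ?_, by simp [Test.cost, Expr.cost]⟩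
      · simp only [Test.Holds, Expr.eval, h1, h2]
        omega
      · rw [List.drop_eq_nil_of_le (by omega)]
        simp
    | succ k ih =>
      intro j s₀ hj hf h2
      have h1 : s₀.reg 1 = L.length := (hf.1 1 (by decide)).trans hG.reg1
      have hjL : j < L.length := by omega
      obtain ⟨s₁, t₁, he₁, hm₁, hw₁, h2₁, ht₁⟩ := hbody j hjL s₀ hf h2
      obtain ⟨s₂, t₂, he₂, hm₂, hw₂, ht₂⟩ := ih (j + 1) s₁ (by omega)
        (hf.trans ⟨fun x hx => he₁.frame.1 x fun h => hx (List.mem_append_right _ h),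
          fun a ha => he₁.frame.2 a fun h => ha (List.mem_append_right _ h)⟩) h2₁
      refine ⟨s₂, _, .loop_true ?_ he₁ he₂, by simp [hm₁, hm₂], ?_, ?_⟩
      · simp only [Test.Holds, Expr.eval, h1, h2]
        exact hjL
      · rw [outputWords_append, outputWords_append, hw₁, hw₂, List.drop_eq_getElem_cons hjL,
          List.filter_cons, outputWords_ticks, List.nil_append]
        split_ifs <;> simp
      · simp only [List.length_append, length_ticks, Test.cost, Expr.cost]
        omega
  rw [← List.nil_append (List.flatMap _ _)]
  refine .seq (Runs.outputs (.assign (v := 0) (hW.eval_const (Nat.zero_le 1)) ?_))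
  refine (hloop L.length 0 (s.setReg 2 0) (by omega) ⟨fun x hx => ?_, fun _ _ => rfl⟩
    (by simp)).mono ?_
  · have : x ≠ 2 := by
      rintro rfl
      exact hx (by decide)
    simp [this]
  · intro s' t ht
    simp only [Expr.cost]
    omega

end Output

end MarkovEnum

namespace MarkovEnum

/-! ### The enumeration -/

theorem enumeratesWithDelay_ticks {n t B : ℕ} (ht : t ≤ B) :
    EnumeratesWithDelay (ticks t) (∅ : Set (Digraph (Fin n))) B :=
  ⟨[], ticks t, [], by simp, by simp, by simp, .nil, by simp, by simp, by simp, by simp,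
    by simpa using ht⟩

/-- A block that describes `D` is put in front of an enumeration of the other graphs. -/
theorem EnumeratesWithDelay.cons {n B : ℕ} {t tr : List Event} {D : Digraph (Fin n)}
    {S : Set (Digraph (Fin n))} (h : EnumeratesWithDelay tr (S \ {D}) B)
    (hD : D ∈ S) (hm : Event.mark ∉ t) (hd : Describes (outputWords t) D) (ht : t.length + 1 ≤ B) :
    EnumeratesWithDelay (t ++ [Event.mark] ++ tr) S B := by
  obtain ⟨blocks, rest, Ds, rfl, h1, h2, h3, h4, h5, h6, h7, h8⟩ := h
  refine ⟨t :: blocks, rest, D :: Ds, by simp, ?_, h2, .cons hd h3, h4, ?_, ?_, ?_, h8⟩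
  · exact List.forall_mem_cons.2 ⟨hm, h1⟩
  · exact List.nodup_cons.2 ⟨fun h => by simpa using (h6 D).1 h, h5⟩
  · intro D'
    rw [List.mem_cons, h6]
    by_cases h : D' = D
    · simp [h, hD]
    · simp [h]
  · exact List.forall_mem_cons.2 ⟨ht, h7⟩

section Main

variable {n W : ℕ} {L : List (Fin n × Fin n)} {nb : Fin n → List (Fin n)} {G : Digraph (Fin n)}

/-- Going down the search tree along `σ`, from the branch `σ₀`, none of the alternatives to the
choices on the way is tried yet. -/
theorem TreeInv.extend_prefix {done : List (Digraph (Fin n))} {σ₀ σ : List (Fin n)}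
    {P : ℕ → Set (Fin n)} (h : TreeInv G done σ₀ P {D | Consistent G σ₀ D}) (hpre : σ₀ <+: σ)
    (hσ : IsSearch (Und G) σ) :
    ∃ P', (∀ i, i < σ₀.length → P' i = P i) ∧
      (∀ τ x, τ ++ [x] <+: σ → σ₀.length ≤ τ.length →
        P' τ.length = {y | Alternative G τ x y ∧ y ≠ x}) ∧
      TreeInv G done σ P' {D | Consistent G σ D} := by
  induction σ using List.reverseRecOn with
  | nil =>
    obtain rfl := List.prefix_nil.1 hpre
    exact ⟨P, fun _ _ => rfl, fun τ x hx => by simp at hx, h⟩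
  | append_singleton σ x ih =>
    rcases List.prefix_concat_iff.1 hpre with rfl | hpre
    · refine ⟨P, fun _ _ => rfl, fun τ y hy hle => ?_, h⟩
      have := length_lt_of_concat_prefix hy
      omega
    obtain ⟨hσ', hx⟩ := isSearch_concat.1 hσ
    obtain ⟨P', h1, h2, h3⟩ := ih hpre hσ'
    have hlen := hpre.length_le
    refine ⟨Function.update P' σ.length {y | Alternative G σ x y ∧ y ≠ x}, fun i hi => ?_,
      fun τ y hy hle => ?_,
      h3.extend hx (fun i hi => Function.update_of_ne hi.ne _ _) (Function.update_self _ _ _)⟩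
    · rw [Function.update_of_ne (by omega), h1 i hi]
    · rcases List.prefix_concat_iff.1 hy with h4 | h4
      · obtain ⟨rfl, h5⟩ := List.append_inj' h4 rfl
        obtain rfl : y = x := by simpa using h5
        exact Function.update_self _ _ _
      · rw [Function.update_of_ne (length_lt_of_concat_prefix h4).ne, h2 τ y h4 hle]

/-- An iteration of the main loop, up to the output. -/
theorem runs_search_found (hW : LargeWords L W) (hA : AdjLists L nb (Und G))
    {done : List (Digraph (Fin n))} {σ₀ : List (Fin n)} {P : ℕ → Set (Fin n)} {s : Store}
    (hG : GraphStore L nb s) (h : Found G (width L) done s σ₀ P) :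
    Runs W search s fun s' t => GraphStore L nb s' ∧ (∃ σ P', (∀ v, v ∈ σ) ∧
      TreeInv G done σ P' {D | Consistent G σ D} ∧ StoredBranch G (width L) σ P' s' ∧
      SearchStore (Und G) σ s' ∧ s'.reg 4 = σ.length) ∧ t ≤ 400 * (n + L.length + 1) := by
  refine (runs_search hW hA h.tree.search hG h.reg7 h.branch.order).mono ?_
  rintro s' t ⟨σ, hpre, hσ, hall, hG', hS, h4, h9, h10, h10', h11, ht⟩
  obtain ⟨P', hP, hP', htree⟩ := h.tree.extend_prefix hpre hσ
  refine ⟨hG', ⟨σ, P', hall, htree, ⟨h9, fun τ x hx => ?_⟩, hS, h4⟩, ht⟩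
  rcases Nat.lt_or_ge τ.length σ₀.length with h1 | h1
  · rw [hP _ h1]
    exact (h.branch.alt τ x (List.prefix_of_prefix_length_le hx hpre (by simpa using h1))).congr
      (h10 _ h1) fun j _ => by rw [h11]
  · exact .inl ⟨h10' _ h1 (length_lt_of_concat_prefix hx), hP' τ x hx h1⟩

/-- The main loop enumerates what has not been output yet. The `t₀` preceding steps are counted
with the time until the first output. -/
theorem exec_mainLoop (hW : LargeWords L W) (hL : IsArcList L G) (hG : IsCPDAG G)
    (hA : AdjLists L nb (Und G)) (k : ℕ) : ∀ (done : List (Digraph (Fin n)))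
    (τ : List (Fin n)) (P : ℕ → Set (Fin n)) (s : Store) (t₀ : ℕ), GraphStore L nb s →
    Found G (width L) done s τ P → t₀ ≤ 600 * (n + L.length + 1) →
    (representedDAGs G \ {D | D ∈ done}).ncard < k →
    ∃ s' tr, Exec W (.loop (.eq (.reg 14) (.const 1))
        (.seq search (.seq output (.seq .mark backtrack)))) s s' tr ∧
      EnumeratesWithDelay (ticks t₀ ++ tr) (representedDAGs G \ {D | D ∈ done})
        (2000 * (n + L.length + 1)) := by
  induction k with
  | zero => exact fun _ _ _ _ _ _ _ _ hk => (Nat.not_lt_zero _ hk).elim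
  | succ k ih =>
  intro done τ P s t₀ hs h ht₀ hk
  have htest : ∀ s : Store, (Test.eq (.reg 14) (.const 1)).Holds W s ↔ s.reg 14 = 1 := by
    intro s
    rw [Test.Holds, hW.eval_const le_rfl, Expr.eval]
  obtain ⟨s₁, t₁, he₁, hG₁, ⟨σ, P', hall, htree, hbr, hS, h4⟩, ht₁⟩ := runs_search_found hW hA hs h
  set D := orient G fun v => σ.idxOf v with hD
  obtain ⟨s₂, tr₂, he₂, hm₂, hw₂, ht₂⟩ := outputs_output hW hG₁ (pos := fun v => σ.idxOf v)
    fun v => by rw [hS.pos, if_pos (hall v)]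
  have htree' := htree.output hG hall
  have hf := he₂.frame
  obtain ⟨s₃, t₃, he₃, hG₃, hcase, ht₃⟩ := runs_backtrack hW hA
    (hG₁.frame hf (by decide) (by decide)) htree'
    (hbr.congr (fun _ _ => rfl) (fun _ _ => by rw [hf.2 9 (by decide)])
      (fun _ _ => by rw [hf.2 10 (by decide)]) fun _ _ _ _ => by rw [hf.2 11 (by decide)])
    (hS.congr (hf.2 5 (by decide)) (hf.2 6 (by decide))) ((hf.1 4 (by decide)).trans h4)
  have hDmem : D ∈ representedDAGs G \ {D | D ∈ done} := by
    refine ⟨htree'.mem D (by simp [hD]), fun h' => ?_⟩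
    have := htree'.nodup
    rw [List.nodup_append] at this
    exact this.2.2 D h' D (by simp [hD]) rfl
  have hsdiff : representedDAGs G \ {D' | D' ∈ done ++ [D]} =
      (representedDAGs G \ {D' | D' ∈ done}) \ {D} := by
    ext D'
    simp only [Set.mem_sdiff, Set.mem_ofPred_eq, List.mem_append, List.mem_singleton,
      Set.mem_singleton_iff, not_or, and_assoc]
  have hdesc : Describes (outputWords (ticks (t₀ + 3 + t₁) ++ tr₂)) D := by
    rw [outputWords_append, outputWords_ticks, List.nil_append, hw₂]
    exact describes_orient hL _
  -- It suffices to treat the run after the output of `D`.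
  suffices H : ∃ s' tr, Exec W (.loop (.eq (.reg 14) (.const 1))
        (.seq search (.seq output (.seq .mark backtrack)))) s₃ s' tr ∧
      EnumeratesWithDelay (ticks t₃ ++ tr) ((representedDAGs G \ {D' | D' ∈ done}) \ {D})
        (2000 * (n + L.length + 1)) by
    obtain ⟨s', tr, he, hen⟩ := H
    refine ⟨s', _, .loop_true ((htest s).2 h.reg14)
      (.seq he₁ (.seq he₂ (.seq (.mark s₂) he₃))) he, ?_⟩
    have := hen.cons hDmem (t := ticks (t₀ + 3 + t₁) ++ tr₂) (by simp [hm₂]) hdesc (by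
      rw [List.length_append, length_ticks]
      omega)
    simpa [← ticks_append, Test.cost, Expr.cost] using this
  rcases hcase with ⟨h14, P'', htree''⟩ | ⟨τ', P'', hfound⟩
  · refine ⟨s₃, _, .loop_false _ (by rw [htest, h14]; omega), ?_⟩
    have hempty : (representedDAGs G \ {D' | D' ∈ done}) \ {D} = ∅ := by
      rw [← hsdiff, Set.sdiff_eq_empty]
      exact fun D' hD' => (htree''.mem_iff D').2 hD'
    rw [hempty, ticks_append]
    refine enumeratesWithDelay_ticks ?_
    simp only [Test.cost, Expr.cost]
    omega
  · rw [← hsdiff]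
    refine ih _ τ' P'' s₃ t₃ hG₃ hfound ht₃ ?_
    rw [hsdiff]
    have := Set.ncard_sdiff_singleton_lt_of_mem hDmem (Set.toFinite _)
    omega

end Main

/-! ### Size of the input -/

section Size

variable {n : ℕ} {L : List (Fin n × Fin n)} {G : Digraph (Fin n)}

/-- Every edge of a graph without loops is listed at most twice. -/
theorem IsArcList.length_le (hL : IsArcList L G) (hirr : ∀ v, ¬ G.Adj v v) :
    L.length ≤ 2 * numEdges G := by
  classical
  have h1 : ((L.toFinset.image fun e => s(e.1, e.2)) : Set (Sym2 (Fin n))) ⊆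
      G.toSimpleGraphInclusive.edgeSet := by
    intro e he
    simp only [Finset.coe_image, Set.mem_image, Finset.mem_coe, List.mem_toFinset, Prod.exists,
      hL.2] at he
    obtain ⟨u, v, huv, rfl⟩ := he
    rw [SimpleGraph.mem_edgeSet]
    refine ⟨?_, .inl huv⟩
    rintro rfl
    exact hirr u huv
  have h2 := Set.ncard_le_ncard h1 (Set.toFinite _)
  rw [Set.ncard_coe_finset] at h2
  have h3 := Finset.card_le_mul_card_image (f := fun e : Fin n × Fin n => s(e.1, e.2)) L.toFinset 2
    (by
      intro e _
      induction e with
      | _ a b =>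
      refine (Finset.card_le_card (t := {(a, b), (b, a)}) ?_).trans Finset.card_le_two
      rintro ⟨u, v⟩ he
      simp only [Finset.mem_filter, Sym2.eq_iff] at he
      simp only [Finset.mem_insert, Finset.mem_singleton, Prod.mk.injEq]
      exact he.2)
  rw [List.toFinset_card_of_nodup hL.1] at h3
  unfold numEdges
  omega

/-- Words of `3 log (n + m + 2)` bits suffice. -/
theorem largeWords_of_pow_le {m W : ℕ} (hm : L.length ≤ 2 * m) (hW : (n + m + 2) ^ 3 ≤ W) :
    LargeWords L W := by
  refine le_trans ?_ hW
  unfold width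
  nlinarith [Nat.zero_le (n * m), Nat.zero_le (n * n), Nat.zero_le (m * m),
    Nat.zero_le (n * n * n), Nat.zero_le (n * n * m), Nat.zero_le (n * m * m),
    Nat.zero_le (m * m * m), Nat.mul_le_mul_left (n + 2) hm]

end Size

end MarkovEnum

/-- There is one program, running on a word RAM whose words have `O(log (n + m))` bits, that
enumerates the Markov equivalence class `[G]` of every CPDAG `G` with `n` vertices and `m` edges
with worst-case delay `O(n + m)`. -/
theorem mainTheorem1 :
    ∃ (P : MarkovEnum.Prog) (C k : ℕ),
      ∀ (n : ℕ) (G : Digraph (Fin n)), MarkovEnum.IsCPDAG G →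
      ∀ L : List (Fin n × Fin n), MarkovEnum.IsArcList L G →
      ∀ W : ℕ, (n + MarkovEnum.numEdges G + 2) ^ k ≤ W →
        ∃ (s : MarkovEnum.Store) (tr : List MarkovEnum.Event),
          MarkovEnum.Exec W P (MarkovEnum.inputStore L) s tr ∧
          MarkovEnum.EnumeratesWithDelay tr (MarkovEnum.representedDAGs G)
            (C * (n + MarkovEnum.numEdges G + 1)) := by
  refine ⟨MarkovEnum.enumerate, 4000, 3, fun n G hG L hL W hW => ?_⟩
  have hlen := hL.length_le hG.irrefl
  have hLW : MarkovEnum.LargeWords L W := MarkovEnum.largeWords_of_pow_le hlen hW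
  obtain ⟨s, t, he, hs, h7, h14, ht⟩ := MarkovEnum.runs_prepare hLW
  obtain ⟨s', tr, he', hen⟩ := MarkovEnum.exec_mainLoop hLW hL hG hL.adjLists _ [] []
    (fun _ => ∅) s t hs ⟨MarkovEnum.treeInv_init _, ⟨by simp, fun τ x hx => by simp at hx⟩, h7, h14⟩
    (by omega) (Nat.lt_succ_self _)
  refine ⟨s', _, .seq he he', ?_⟩
  obtain ⟨blocks, rest, Ds, h1, h2, h3, h4, h5, h6, h8, h9, h10⟩ := hen
  exact ⟨blocks, rest, Ds, h1, h2, h3, h4, h5, h6, by simpa using h8,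
    fun b hb => (h9 b hb).trans (by omega), h10.trans (by omega)⟩
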